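/- **Setting.** An instance consists of $n\ge 0$ fixed points and $k$ closed line segments in the plane, the segments being in general position: none is a single point and no two are parallel. Its $n+k$ elements are the fixed points and the segments. A choice $p$ assigns to every fixed point itself and to every segment $E$ a point $p_E\in E$. For $\alpha\ge 0$ the connectivity graph $G_\alpha(p)$ has the elements as vertices and joins two of them when their chosen points have Euclidean distance at most $2\alpha$. The problem BCU asks for the minimum $\alpha^*\ge 0$ for which some choice $p$ has a connected graph $G_{\alpha^*}(p)$; a choice $p$ for which $G_{\alpha^*}(p)$ is connected is called optimal. A spanning tree $T$ on a choice $p$ is a *minimum solution tree* if no spanning tree on any choice has a list of edge lengths, sorted from longest to shortest, that is lexicographically smaller than that of $T$. Let $(E_1,\dots,E_m)$, $m\ge2$, be a sequence of distinct elements in which $E_2,\dots,E_{m-1}$ are segments. Points $x_i\in E_i$ form a *critical path* on it if the distances $|x_ix_{i+1}|$ are all equal and no points $y_i\in E_i$ satisfy $|y_iy_{i+1}|\le|x_ix_{i+1}|$ for all $i$ with strict inequality for some $i$. The sequence *supports a critical path of locally longest edges* in the minimum solution tree $T$ on $p$ if consecutive elements are adjacent in $T$, each edge $E_iE_{i+1}$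 is, at each of its ends that is a segment, at least as long as every other edge of $T$ at that end, and the points $p_{E_i}$ form a critical path. Model of computation: a real RAM with a memory of natural numbers (addition, truncated subtraction, comparison) and a memory of real numbers ($+,-,\times,/,\sqrt{\ }$, rational constants, comparison), indirect addressing, and unit cost per assignment and test. *Exact bisection* is the additional instruction that, for a subprogram which halts on every real input $x$ within $t$ steps and accepts exactly the inputs $x\ge L$, for some real $L$, ends as the subprogram does on input $L$, at cost $t+1$. **Theorem.** Write $B(n,k)=\big((n+k)^2\cdot k!\cdot k^2\big)^k\cdot k$. 1. There is an algorithm on the real RAM with exact bisection that, for every instance with $k\ge1$ segments, computes $\alpha^*$ and an optimal choice in $O(B(n,k))$ steps; for every fixed $k\ge1$ its running time is bounded by a polynomial in $n$. 2. There is an algorithm on the real RAM without exact bisection that, for every instance with $k\ge1$ segments and every $\delta>0$, computes a radius $\alpha\in[\alpha^*,\alpha^*+\delta]$ and a choice $p$ with $G_\alpha(p)$ connected in $O\big(B(n,k)\,(1+\log_2(1+D/\delta))\big)$ steps, where $D$ is the diameter of the union of the fixed points and segments. 3. If $(E_1,\dots,E_m)$ supports a critical path of locally longest edges in some minimum solution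 tree, then there is exactly one critical path on $(E_1,\dots,E_m)$. 4. In the situation of 3, the points of this critical path are part of an optimal choice, and indeed of one that carries a minimum solution tree. The constants in the $O$-bounds are absolute. -/

import Mathlib

open scoped Nat

namespace BCU

noncomputable section

/-! ### Instances and the problem -/

/-- The Euclidean plane. -/
abbrev Plane : Type := EuclideanSpace ℝ (Fin 2)

/-- The `n + k` elements of an instance: `n` fixed points and `k` segments. -/
abbrev Elt (n k : ℕ) : Type := Fin n ⊕ Fin k

/-- `n` fixed points and `k` closed segments, the `j`-th one with extremities `a j` and `b j`. -/
structure Instance (n k : ℕ) where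
  site : Fin n → Plane
  a : Fin k → Plane
  b : Fin k → Plane

variable {n k : ℕ}

/-- The uncertainty region of an element. -/
def Instance.region (I : Instance n k) : Elt n k → Set Plane
  | Sum.inl i => {I.site i}
  | Sum.inr j => segment ℝ (I.a j) (I.b j)

/-- General position: no segment is reduced to a point and no two segments are parallel. -/
def Instance.GeneralPosition (I : Instance n k) : Prop :=
  (∀ j, I.a j ≠ I.b j) ∧
    ∀ i j, i ≠ j → LinearIndependent ℝ ![I.b i - I.a i, I.b j - I.a j]

/-- `p` chooses one point in every region. -/
def Instance.IsChoice (I : Instance n k) (p : Elt n k → Plane) : Prop :=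
  ∀ v, p v ∈ I.region v

/-- The connectivity graph of the chosen points: two of them are joined when the closed disks of
radius `α` around them meet, that is, when their distance is at most `2 * α`. -/
def connectivityGraph (p : Elt n k → Plane) (α : ℝ) : SimpleGraph (Elt n k) where
  Adj u v := u ≠ v ∧ dist (p u) (p v) ≤ 2 * α
  symm := ⟨fun _ _ h => ⟨h.1.symm, by rw [dist_comm]; exact h.2⟩⟩
  loopless := ⟨fun _ h => h.1 rfl⟩

/-- `α` is the solution of the BCU problem: the least radius for which some choice of points has a
connected connectivity graph. -/
def Instance.IsOptimalRadius (I : Instance n k) (α : ℝ) : Prop :=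
  IsLeast {β : ℝ | 0 ≤ β ∧ ∃ p, I.IsChoice p ∧ (connectivityGraph p β).Connected} α

/-- `p` is an optimal choice of points. -/
def Instance.IsOptimalChoice (I : Instance n k) (p : Elt n k → Plane) : Prop :=
  I.IsChoice p ∧ ∃ α, I.IsOptimalRadius α ∧ (connectivityGraph p α).Connected

/-! ### Minimum solution trees and critical paths -/

/-- The length of an edge. -/
def edgeLength (p : Elt n k → Plane) : Sym2 (Elt n k) → ℝ :=
  Sym2.lift ⟨fun u v => dist (p u) (p v), fun _ _ => dist_comm _ _⟩

open Classical in
/-- The lengths of all edges of `T`, sorted from longest to shortest. -/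
def edgeLengths (p : Elt n k → Plane) (T : SimpleGraph (Elt n k)) : List ℝ :=
  (T.edgeFinset.val.map (edgeLength p)).sort (· ≥ ·)

/-- `T` is a minimum solution tree with optimal point set `p`: no spanning tree on any choice of
points has a list of edge lengths that is preferred over (lexicographically less than) its list. -/
def Instance.IsMinimumSolutionTree (I : Instance n k) (p : Elt n k → Plane)
    (T : SimpleGraph (Elt n k)) : Prop :=
  I.IsChoice p ∧ T.IsTree ∧
    ∀ q T', I.IsChoice q → T'.IsTree → ¬ List.Lex (· < ·) (edgeLengths q T') (edgeLengths p T)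

/-- `(E₁, …, E_m)`, with `m = r + 2`, is a sequence of distinct elements whose inner members are
segments. -/
def IsSequence {r : ℕ} (E : Fin (r + 2) → Elt n k) : Prop :=
  Function.Injective E ∧ ∀ i, i ≠ 0 → i ≠ Fin.last (r + 1) → ∃ j, E i = Sum.inr j

/-- The points `x i` on `E i` form a critical path: all edges have the same length, and no other
selection of points on the `E i` makes no edge longer and some edge strictly shorter. -/
def Instance.IsCriticalPath (I : Instance n k) {r : ℕ} (E : Fin (r + 2) → Elt n k)
    (x : Fin (r + 2) → Plane) : Prop :=
  (∀ i, x i ∈ I.region (E i)) ∧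
  (∃ l : ℝ, ∀ i : Fin (r + 1), dist (x i.castSucc) (x i.succ) = l) ∧
  ¬ ∃ y : Fin (r + 2) → Plane, (∀ i, y i ∈ I.region (E i)) ∧
      (∀ i : Fin (r + 1), dist (y i.castSucc) (y i.succ) ≤ dist (x i.castSucc) (x i.succ)) ∧
      ∃ i : Fin (r + 1), dist (y i.castSucc) (y i.succ) < dist (x i.castSucc) (x i.succ)

/-- If `u` is a segment, no tree edge at the point of `u` is longer than the edge `uv`.
(The notion only concerns points on segments.) -/
def LocallyLongestAt (p : Elt n k → Plane) (T : SimpleGraph (Elt n k)) (u v : Elt n k) : Prop :=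
  (∃ j, u = Sum.inr j) → ∀ w, T.Adj u w → dist (p u) (p w) ≤ dist (p u) (p v)

/-- The sequence `E` supports a critical path of locally longest edges in the tree `T` on the
points `p`. -/
def Instance.Supports (I : Instance n k) (p : Elt n k → Plane) (T : SimpleGraph (Elt n k))
    {r : ℕ} (E : Fin (r + 2) → Elt n k) : Prop :=
  IsSequence E ∧
  (∀ i : Fin (r + 1), T.Adj (E i.castSucc) (E i.succ) ∧
    LocallyLongestAt p T (E i.castSucc) (E i.succ) ∧
    LocallyLongestAt p T (E i.succ) (E i.castSucc)) ∧
  I.IsCriticalPath E (fun i => p (E i))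

/-! ### The real RAM

A memory of natural numbers and a memory of real numbers, both with indirect addressing, and
structured programs.  Natural numbers can be added, subtracted (truncated at `0`) and compared;
real numbers can be added, subtracted, multiplied, divided and compared, and square roots can be
taken.  There is no conversion between the two sorts, hence no rounding.  Division by zero and
square roots of negative numbers return `0`. -/

/-- A configuration of the memory. -/
structure Mem where
  nat : ℕ → ℕ
  real : ℕ → ℝ

/-- Expressions of sort natural number; `cell e` is the content of the cell with address `e`. -/
inductive NatExp : Type
  | lit (c : ℕ)
  | cell (e : NatExp)
  | add (e f : NatExp)
  | sub (e f : NatExp)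

def NatExp.eval (s : Mem) : NatExp → ℕ
  | lit c => c
  | cell e => s.nat (e.eval s)
  | add e f => e.eval s + f.eval s
  | sub e f => e.eval s - f.eval s

/-- Expressions of sort real number. -/
inductive RealExp : Type
  | lit (c : ℚ)
  | cell (e : NatExp)
  | add (e f : RealExp)
  | sub (e f : RealExp)
  | mul (e f : RealExp)
  | div (e f : RealExp)
  | sqrt (e : RealExp)

def RealExp.eval (s : Mem) : RealExp → ℝ
  | lit c => (c : ℝ)
  | cell e => s.real (e.eval s)
  | add e f => e.eval s + f.eval s
  | sub e f => e.eval s - f.eval s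
  | mul e f => e.eval s * f.eval s
  | div e f => e.eval s / f.eval s
  | sqrt e => Real.sqrt (e.eval s)

/-- Tests. -/
inductive Test : Type
  | natLe (e f : NatExp)
  | realLe (e f : RealExp)
  | not (b : Test)
  | and (b c : Test)

def Test.Holds (s : Mem) : Test → Prop
  | natLe e f => e.eval s ≤ f.eval s
  | realLe e f => e.eval s ≤ f.eval s
  | not b => ¬ b.Holds s
  | and b c => b.Holds s ∧ c.Holds s

/-- Programs.  The command `threshold e body b` is exact bisection, see `Exec`. -/
inductive Prog : Type
  | skip
  | natSet (e f : NatExp)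
  | realSet (e : NatExp) (f : RealExp)
  | seq (c d : Prog)
  | ite (b : Test) (c d : Prog)
  | loop (b : Test) (c : Prog)
  | threshold (e : NatExp) (body : Prog) (b : Test)

/-- The programs of the plain real RAM: those without exact bisection. -/
def Prog.Plain : Prog → Prop
  | skip => True
  | natSet _ _ => True
  | realSet _ _ => True
  | seq c d => c.Plain ∧ d.Plain
  | ite _ c d => c.Plain ∧ d.Plain
  | loop _ c => c.Plain
  | threshold _ _ _ => False

def Mem.setNat (s : Mem) (i v : ℕ) : Mem := { s with nat := Function.update s.nat i v }

def Mem.setReal (s : Mem) (i : ℕ) (v : ℝ) : Mem := { s with real := Function.update s.real i v }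

/-- `Exec c s t s'`: started in `s`, the program `c` halts in `s'`, and `t` steps pay for it.
Assignments and tests cost one step each (a program is fixed, so its expressions have bounded size).

`threshold e body b` looks for the least real number `L` that `body` accepts, acceptance of `x`
meaning that `body`, started with `x` in the real cell `e`, halts in a memory where `b` holds.  It
requires that `body` halts for every `x` within `t` steps and accepts exactly the `x ≥ L`; it ends
as the run of `body` on `L` does, and costs `t + 1` steps: a bisection is charged as one of its
rounds. -/
inductive Exec : Prog → Mem → ℕ → Mem → Prop
  | skip (s : Mem) : Exec .skip s 1 s
  | natSet (e f : NatExp) (s : Mem) :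
      Exec (.natSet e f) s 1 (s.setNat (e.eval s) (f.eval s))
  | realSet (e : NatExp) (f : RealExp) (s : Mem) :
      Exec (.realSet e f) s 1 (s.setReal (e.eval s) (f.eval s))
  | seq {c d : Prog} {s s' s'' : Mem} {t t' : ℕ} :
      Exec c s t s' → Exec d s' t' s'' → Exec (.seq c d) s (t + t') s''
  | iteTrue {b : Test} {c d : Prog} {s s' : Mem} {t : ℕ} :
      b.Holds s → Exec c s t s' → Exec (.ite b c d) s (t + 1) s'
  | iteFalse {b : Test} {c d : Prog} {s s' : Mem} {t : ℕ} :
      ¬ b.Holds s → Exec d s t s' → Exec (.ite b c d) s (t + 1) s'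
  | loopStop {b : Test} {c : Prog} {s : Mem} :
      ¬ b.Holds s → Exec (.loop b c) s 1 s
  | loopStep {b : Test} {c : Prog} {s s' s'' : Mem} {t t' : ℕ} :
      b.Holds s → Exec c s t s' → Exec (.loop b c) s' t' s'' →
      Exec (.loop b c) s (t + t' + 1) s''
  | threshold {e : NatExp} {body : Prog} {b : Test} {s : Mem} (L : ℝ) (t : ℕ)
      (time : ℝ → ℕ) (res : ℝ → Mem) :
      (∀ x, Exec body (s.setReal (e.eval s) x) (time x) (res x)) →
      (∀ x, time x ≤ t) →
      (∀ x, b.Holds (res x) ↔ L ≤ x) →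
      Exec (.threshold e body b) s (t + 1) (res L)

/-- Started in `s`, the program halts after at most `B` steps in a memory satisfying `Q`. -/
def HaltsWithin (c : Prog) (s : Mem) (B : ℝ) (Q : Mem → Prop) : Prop :=
  ∃ t s', Exec c s t s' ∧ (t : ℝ) ≤ B ∧ Q s'

/-! ### Input and output -/

/-- The coordinates of the fixed points, followed by those of the extremities of the segments. -/
def Instance.encode (I : Instance n k) : List ℝ :=
  (List.ofFn fun i => [I.site i 0, I.site i 1]).flatten ++
    (List.ofFn fun j => [I.a j 0, I.a j 1, I.b j 0, I.b j 1]).flatten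

/-- The initial memory: `n` and `k` in the natural-number cells `0` and `1`, the coordinates of
the instance followed by the numbers in `extra` in the real cells `0, 1, 2, …`; all other cells
are `0`. -/
def Instance.input (I : Instance n k) (extra : List ℝ) : Mem where
  nat m := if m = 0 then n else if m = 1 then k else 0
  real m := (I.encode ++ extra).getD m 0

/-- The radius computed by a program is found in the real cell `0`. -/
def Mem.radius (s : Mem) : ℝ := s.real 0

/-- The position computed for segment `j` is found in the real cells `2j + 1` and `2j + 2`. -/
def Instance.choiceOf (I : Instance n k) (s : Mem) : Elt n k → Plane :=
  Sum.elim I.site (fun j : Fin k => !₂[s.real (2 * j + 1), s.real (2 * j + 2)])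

/-- The memory contains an exact solution of the instance: the optimal radius together with points
that attain it. -/
def Instance.SolvedBy (I : Instance n k) (s : Mem) : Prop :=
  I.IsOptimalRadius s.radius ∧ I.IsChoice (I.choiceOf s) ∧
    (connectivityGraph (I.choiceOf s) s.radius).Connected

/-- The memory contains a solution of the instance up to precision `δ`: a radius that exceeds the
optimal one by at most `δ`, together with points that attain it. -/
def Instance.SolvedUpTo (I : Instance n k) (δ : ℝ) (s : Mem) : Prop :=
  (∃ α, I.IsOptimalRadius α ∧ α ≤ s.radius ∧ s.radius ≤ α + δ) ∧ I.IsChoice (I.choiceOf s) ∧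
    (connectivityGraph (I.choiceOf s) s.radius).Connected

/-- The diameter of an instance. -/
def Instance.diameter (I : Instance n k) : ℝ :=
  Metric.diam (⋃ v, I.region v)

/-- `((n + k)² · k! · k²)ᵏ · k`. -/
def timeBound (n k : ℕ) : ℝ :=
  (((n + k) ^ 2 * k ! * k ^ 2) ^ k * k : ℕ)

end

end BCU

namespace BCU

noncomputable section

variable {n k : ℕ}

/-! ### Uniqueness of critical paths. -/

theorem convex_region (I : Instance n k) (v : Elt n k) : Convex ℝ (I.region v) := by
  cases v with
  | inl i => exact convex_singleton _
  | inr j => exact convex_segment _ _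

/-- Points of a segment differ by a multiple of its direction. -/
theorem exists_smul_of_mem_segment {a b x y : Plane} (hx : x ∈ segment ℝ a b)
    (hy : y ∈ segment ℝ a b) : ∃ c : ℝ, y - x = c • (b - a) := by
  rw [segment_eq_image'] at hx hy
  obtain ⟨s, -, rfl⟩ := hx
  obtain ⟨t, -, rfl⟩ := hy
  exact ⟨t - s, by simp only [sub_smul]; abel⟩

/-- A nonzero vector is not a translation between points of two different elements at once. -/
theorem Instance.GeneralPosition.translation_eq_zero {I : Instance n k} (hI : I.GeneralPosition)
    {u v : Elt n k} (huv : u ≠ v) {x y x' y' w : Plane} (hx : x ∈ I.region u)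
    (hx' : x' ∈ I.region u) (hy : y ∈ I.region v) (hy' : y' ∈ I.region v) (hxw : x' - x = w)
    (hyw : y' - y = w) : w = 0 := by
  cases u with
  | inl i =>
    rw [← hxw, Set.mem_singleton_iff.1 hx, Set.mem_singleton_iff.1 hx', sub_self]
  | inr i =>
    cases v with
    | inl j =>
      rw [← hyw, Set.mem_singleton_iff.1 hy, Set.mem_singleton_iff.1 hy', sub_self]
    | inr j =>
      have hij : i ≠ j := fun h => huv (by rw [h])
      obtain ⟨c, hc⟩ := exists_smul_of_mem_segment hx hx'
      obtain ⟨d, hd⟩ := exists_smul_of_mem_segment hy hy'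
      have := LinearIndependent.pair_iff.1 (hI.2 i j hij) c (-d) (by
        rw [neg_smul, ← hc, ← hd, hxw, hyw, add_neg_cancel])
      rw [← hxw, hc, this.1, zero_smul]

/-- All edges of a critical path have one length, so a path of smaller common length would be
shorter on every edge and contradict criticality. -/
theorem Instance.IsCriticalPath.length_le {I : Instance n k} {r : ℕ} {E : Fin (r + 2) → Elt n k}
    {x y : Fin (r + 2) → Plane} (hx : I.IsCriticalPath E x) (hy : I.IsCriticalPath E y)
    (i : Fin (r + 1)) : dist (x i.castSucc) (x i.succ) ≤ dist (y i.castSucc) (y i.succ) := by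
  obtain ⟨-, ⟨l, hl⟩, hxmin⟩ := hx
  obtain ⟨hyr, ⟨m, hm⟩, -⟩ := hy
  by_contra! h
  refine hxmin ⟨y, hyr, fun j => ?_, i, h⟩
  rw [hl, hm] at h ⊢
  exact h.le

/-- The norm is strictly convex: vectors of equal norm have a shorter mean unless they are equal.
Criticality therefore forces equal edge vectors, and general position excludes a nonzero common
translation. -/
theorem Instance.IsCriticalPath.unique {I : Instance n k} (hI : I.GeneralPosition) {r : ℕ}
    {E : Fin (r + 2) → Elt n k} (hE : Function.Injective E) {x y : Fin (r + 2) → Plane}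
    (hx : I.IsCriticalPath E x) (hy : I.IsCriticalPath E y) : x = y := by
  have hlen : ∀ i : Fin (r + 1),
      ‖x i.castSucc - x i.succ‖ = ‖y i.castSucc - y i.succ‖ := fun i => by
    rw [← dist_eq_norm, ← dist_eq_norm]
    exact le_antisymm (hx.length_le hy i) (hy.length_le hx i)
  let z : Fin (r + 2) → Plane := fun i => (1 / 2 : ℝ) • (x i + y i)
  have hz : ∀ i, z i ∈ I.region (E i) := fun i => by
    have := convex_region I (E i) (hx.1 i) (hy.1 i) (a := 1 / 2) (b := 1 / 2)
      (by norm_num) (by norm_num) (by norm_num)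
    rwa [← smul_add] at this
  have hzd : ∀ i : Fin (r + 1), z i.castSucc - z i.succ =
      (1 / 2 : ℝ) • ((x i.castSucc - x i.succ) + (y i.castSucc - y i.succ)) := fun i => by
    simp only [z, ← smul_sub]; congr 1; abel
  have hstep : ∀ i : Fin (r + 1), x i.castSucc - x i.succ = y i.castSucc - y i.succ := by
    by_contra! h
    obtain ⟨i, hi⟩ := h
    refine hx.2.2 ⟨z, hz, fun j => ?_, i, ?_⟩
    · rw [dist_eq_norm, dist_eq_norm, hzd]
      by_cases hj : x j.castSucc - x j.succ = y j.castSucc - y j.succ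
      · rw [← hj, ← two_smul ℝ, smul_smul]; norm_num
      · exact ((norm_midpoint_lt_iff (hlen j)).2 hj).le
    · rw [dist_eq_norm, dist_eq_norm, hzd]
      exact (norm_midpoint_lt_iff (hlen i)).2 hi
  have hconst : ∀ i, y i - x i = y 0 - x 0 := by
    intro i
    induction i using Fin.induction with
    | zero => rfl
    | succ i ih =>
      rw [← ih]
      have := hstep i
      have h2 : y i.succ = y i.castSucc - (x i.castSucc - x i.succ) := by rw [this]; abel
      rw [h2]; abel
  have h0 : y 0 - x 0 = 0 :=
    hI.translation_eq_zero (u := E 0) (v := E 1) (fun h => by simpa using hE h)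
      (hx.1 0) (hy.1 0) (hx.1 1) (hy.1 1) rfl (hconst 1)
  funext i
  have := hconst i
  rw [h0] at this
  exact (sub_eq_zero.1 this).symm

/-! ### Minimum solution trees are optimal. -/

theorem mem_edgeLengths {p : Elt n k → Plane} {T : SimpleGraph (Elt n k)} {l : ℝ} :
    l ∈ edgeLengths p T ↔ ∃ u v, T.Adj u v ∧ dist (p u) (p v) = l := by
  classical
  simp only [edgeLengths, Multiset.mem_sort, Multiset.mem_map, Finset.mem_val]
  constructor
  · rintro ⟨e, he, rfl⟩
    induction e with
    | _ u v => exact ⟨u, v, by simpa using he, rfl⟩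
  · rintro ⟨u, v, h, rfl⟩
    exact ⟨s(u, v), by simpa using h, rfl⟩

/-- The head of the sorted list `l'` is at least `m`, so the comparison is settled at the first
entry, or by `l` being empty. -/
theorem lex_lt_of_forall_lt_head {l l' : List ℝ} {m : ℝ} (hm : m ∈ l') (hs : l'.Pairwise (· ≥ ·))
    (h : ∀ x ∈ l, x < m) : List.Lex (· < ·) l l' := by
  cases l' with
  | nil => simp at hm
  | cons b l' =>
    cases l with
    | nil => exact List.Lex.nil
    | cons a l =>
      refine List.Lex.rel (lt_of_lt_of_le (h a (by simp)) ?_)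
      rcases List.mem_cons.1 hm with rfl | hm
      · exact le_rfl
      · exact (List.pairwise_cons.1 hs).1 m hm

/-- The points of a minimum solution tree with at least one edge are an optimal choice. -/
theorem Instance.IsMinimumSolutionTree.isOptimalChoice {I : Instance n k} {p : Elt n k → Plane}
    {T : SimpleGraph (Elt n k)} (h : I.IsMinimumSolutionTree p T) {u v : Elt n k}
    (huv : T.Adj u v) : I.IsOptimalChoice p := by
  classical
  obtain ⟨hp, hT, hmin⟩ := h
  let S : Finset (Elt n k × Elt n k) := Finset.univ.filter fun e => T.Adj e.1 e.2
  obtain ⟨e, heS, he⟩ := S.exists_max_image (fun e => dist (p e.1) (p e.2))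
    ⟨(u, v), by simpa [S] using huv⟩
  have heT : T.Adj e.1 e.2 := by simpa [S] using heS
  have hle : ∀ a b, T.Adj a b → dist (p a) (p b) ≤ dist (p e.1) (p e.2) := fun a b hab =>
    he (a, b) (by simpa [S] using hab)
  have hcon : (connectivityGraph p (dist (p e.1) (p e.2) / 2)).Connected :=
    hT.connected.mono fun a b hab => ⟨hab.ne, by linarith [hle a b hab]⟩
  refine ⟨hp, _, ⟨⟨by positivity, p, hp, hcon⟩, ?_⟩, hcon⟩
  rintro β ⟨-, q, hq, hqc⟩
  by_contra! hβ
  obtain ⟨T', hT'le, hT'⟩ := hqc.exists_isTree_le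
  -- A spanning tree of the graph for the smaller radius `β` has all edges shorter than the longest
  -- edge of `T`.
  refine hmin q T' hq hT' (lex_lt_of_forall_lt_head (m := dist (p e.1) (p e.2))
    (mem_edgeLengths.2 ⟨_, _, heT, rfl⟩) (Multiset.pairwise_sort _ _) fun x hx => ?_)
  obtain ⟨a, b, hab, rfl⟩ := mem_edgeLengths.1 hx
  linarith [(hT'le hab).2]

/-- The points of the tree themselves witness existence; by uniqueness every critical path is this
one, so the given tree also serves for the last claim. -/
theorem supports_unique_and_optimal (I : Instance n k) (hI : I.GeneralPosition)
    (p : Elt n k → Plane) (T : SimpleGraph (Elt n k)) (hT : I.IsMinimumSolutionTree p T)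
    (r : ℕ) (E : Fin (r + 2) → Elt n k) (hE : I.Supports p T E) :
    (∃! x, I.IsCriticalPath E x) ∧
      ∀ x, I.IsCriticalPath E x →
        ∃ q T', I.IsMinimumSolutionTree q T' ∧ I.IsOptimalChoice q ∧ ∀ i, q (E i) = x i := by
  obtain ⟨hseq, hadj, hcrit⟩ := hE
  refine ⟨⟨_, hcrit, fun y hy => hy.unique hI hseq.1 hcrit⟩, fun x hx => ⟨p, T, hT,
    hT.isOptimalChoice (hadj 0).1, fun i => ?_⟩⟩
  rw [hx.unique hI hseq.1 hcrit]

/-! ### Choices in coordinates -/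

/-- The points with parameters `t` on the segments, together with the fixed points. -/
def Instance.pos (I : Instance n k) (t : Fin k → ℝ) : Elt n k → Plane :=
  Sum.elim I.site fun j => I.a j + t j • (I.b j - I.a j)

/-- The parameters of the points of the segments. -/
def cube (k : ℕ) : Set (Fin k → ℝ) := Set.univ.pi fun _ => Set.Icc 0 1

theorem mem_cube {t : Fin k → ℝ} : t ∈ cube k ↔ ∀ j, t j ∈ Set.Icc (0 : ℝ) 1 := by
  simp only [cube, Set.mem_univ_pi]

theorem isCompact_cube : IsCompact (cube k) := isCompact_univ_pi fun _ => isCompact_Icc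

theorem Instance.isChoice_pos (I : Instance n k) {t : Fin k → ℝ} (ht : t ∈ cube k) :
    I.IsChoice (I.pos t) := by
  rintro (i | j)
  · rfl
  · change _ ∈ segment ℝ (I.a j) (I.b j)
    rw [segment_eq_image']
    exact ⟨t j, mem_cube.1 ht j, rfl⟩

theorem Instance.IsChoice.exists_pos {I : Instance n k} {p : Elt n k → Plane} (hp : I.IsChoice p) :
    ∃ t ∈ cube k, p = I.pos t := by
  have h : ∀ j : Fin k, ∃ t ∈ Set.Icc (0 : ℝ) 1, I.a j + t • (I.b j - I.a j) = p (Sum.inr j) := by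
    intro j
    have := hp (Sum.inr j)
    change _ ∈ segment ℝ (I.a j) (I.b j) at this
    rwa [segment_eq_image'] at this
  choose t ht htp using h
  refine ⟨t, mem_cube.2 ht, funext ?_⟩
  rintro (i | j)
  · exact hp (Sum.inl i)
  · exact (htp j).symm

theorem Instance.continuous_pos (I : Instance n k) (v : Elt n k) :
    Continuous fun t => I.pos t v := by
  cases v with
  | inl i => exact continuous_const
  | inr j => simp only [Instance.pos, Sum.elim_inr]; fun_prop

/-! ### Feasible radii and existence of the optimum. -/

/-- The radius `α` suffices for the instance. -/
def Instance.Feasible (I : Instance n k) (α : ℝ) : Prop :=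
  ∃ p, I.IsChoice p ∧ (connectivityGraph p α).Connected

theorem Instance.Feasible.mono {I : Instance n k} {α β : ℝ} (h : I.Feasible α) (hαβ : α ≤ β) :
    I.Feasible β := by
  obtain ⟨p, hp, hc⟩ := h
  have hle : connectivityGraph p α ≤ connectivityGraph p β := fun u v huv =>
    ⟨huv.1, huv.2.trans (by linarith)⟩
  exact ⟨p, hp, hc.mono hle⟩

/-- For each connected graph the longest edge is a continuous function on the compact cube and
attains its minimum. There are finitely many graphs, so one of them has the least minimum. -/
theorem Instance.exists_isOptimalRadius (I : Instance n k) (hk : 1 ≤ k) :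
    ∃ α, I.IsOptimalRadius α := by
  classical
  have : Nonempty (Elt n k) := ⟨Sum.inr ⟨0, hk⟩⟩
  -- Non-adjacent pairs contribute `0`, which keeps the maximum over a nonempty set and nonnegative
  -- even when the graph has no edge.
  let f : SimpleGraph (Elt n k) → (Fin k → ℝ) → ℝ := fun T t =>
    Finset.univ.sup' Finset.univ_nonempty fun e : Elt n k × Elt n k =>
      if T.Adj e.1 e.2 then dist (I.pos t e.1) (I.pos t e.2) else 0
  have hf : ∀ T, Continuous (f T) := fun T => by
    refine Continuous.finset_sup'_apply _ fun e _ => ?_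
    split_ifs
    · exact (I.continuous_pos _).dist (I.continuous_pos _)
    · exact continuous_const
  have hne : (cube k).Nonempty := ⟨fun _ => 0, mem_cube.2 fun _ => by simp⟩
  have hmin : ∀ T, ∃ t ∈ cube k, ∀ s ∈ cube k, f T t ≤ f T s := fun T =>
    isCompact_cube.exists_isMinOn hne (hf T).continuousOn
  choose t ht htmin using hmin
  obtain ⟨T, hT, hTmin⟩ := (Set.toFinite {T : SimpleGraph (Elt n k) | T.Connected}).exists_minimalFor
    (fun T => f T (t T)) _ ⟨⊤, SimpleGraph.connected_top⟩
  have hTle : ∀ T', T'.Connected → f T (t T) ≤ f T' (t T') := fun T' hT' => by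
    rcases le_total (f T (t T)) (f T' (t T')) with h | h
    · exact h
    · exact hTmin hT' h
  have hle : ∀ T t u v, T.Adj u v → dist (I.pos t u) (I.pos t v) ≤ f T t := fun T t u v huv => by
    have := Finset.le_sup' (fun e : Elt n k × Elt n k =>
      if T.Adj e.1 e.2 then dist (I.pos t e.1) (I.pos t e.2) else 0) (Finset.mem_univ (u, v))
    simpa [huv] using this
  have h0 : ∀ T t, 0 ≤ f T t := fun T t => by
    have := Finset.le_sup' (fun e : Elt n k × Elt n k =>
      if T.Adj e.1 e.2 then dist (I.pos t e.1) (I.pos t e.2) else 0)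
      (Finset.mem_univ (Classical.arbitrary _, Classical.arbitrary _))
    simpa using this
  refine ⟨f T (t T) / 2, ⟨by linarith [h0 T (t T)], _, I.isChoice_pos (ht T),
    SimpleGraph.Connected.mono (fun u v huv => ⟨huv.ne, by linarith [hle T (t T) u v huv]⟩) hT⟩, ?_⟩
  rintro β ⟨hβ, p, hp, hc⟩
  obtain ⟨s, hs, rfl⟩ := hp.exists_pos
  have h1 := hTle _ hc
  have h2 := htmin (connectivityGraph (I.pos s) β) s hs
  have h3 : f (connectivityGraph (I.pos s) β) s ≤ 2 * β := by
    refine Finset.sup'_le _ _ fun e _ => ?_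
    split_ifs with h
    · exact h.2
    · linarith
  linarith

/-- This is the threshold form that bisection requires. The condition `0 ≤ x` cannot be dropped: an
instance with a single element is feasible for negative radii too. -/
theorem Instance.IsOptimalRadius.le_iff {I : Instance n k} {α x : ℝ} (h : I.IsOptimalRadius α) :
    α ≤ x ↔ 0 ≤ x ∧ I.Feasible x :=
  ⟨fun hx => ⟨h.1.1.trans hx, Instance.Feasible.mono h.1.2 hx⟩, fun hx => h.2 hx⟩

theorem isBounded_iUnion_region (I : Instance n k) : Bornology.IsBounded (⋃ v, I.region v) := by
  refine (Bornology.isBounded_iUnion).2 fun v => ?_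
  cases v with
  | inl i => exact Bornology.isBounded_singleton
  | inr j =>
    change Bornology.IsBounded (segment ℝ (I.a j) (I.b j))
    rw [segment_eq_image']
    exact (isCompact_Icc.image (by fun_prop)).isBounded

/-- A crude upper bound that limits the number of doublings in the approximation algorithm. -/
theorem Instance.feasible_diameter (I : Instance n k) (hk : 1 ≤ k) : I.Feasible I.diameter := by
  have : Nonempty (Elt n k) := ⟨Sum.inr ⟨0, hk⟩⟩
  have hc := I.isChoice_pos (t := fun _ => 0) (mem_cube.2 fun _ => by simp)
  refine ⟨_, hc, SimpleGraph.connected_top.mono fun u v huv => ⟨huv, ?_⟩⟩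
  have := Metric.dist_le_diam_of_mem (isBounded_iUnion_region I)
    (Set.mem_iUnion_of_mem u (hc u)) (Set.mem_iUnion_of_mem v (hc v))
  have h0 : 0 ≤ Metric.diam (⋃ v, I.region v) := Metric.diam_nonneg
  rw [Instance.diameter]
  linarith

/-! ### Positions determined by other elements -/

/-- The squared length of the vector from `a` to `b`. -/
def sqLen (a b : Plane) : ℝ := (b 0 - a 0) * (b 0 - a 0) + (b 1 - a 1) * (b 1 - a 1)

/-- The inner product of the vectors from `a` to `c` and from `a` to `b`. -/
def dotAt (a b c : Plane) : ℝ := (c 0 - a 0) * (b 0 - a 0) + (c 1 - a 1) * (b 1 - a 1)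

/-- The determinant of the vectors from `a` to `c` and from `a` to `b`. -/
def crossAt (a b c : Plane) : ℝ := (c 0 - a 0) * (b 1 - a 1) - (c 1 - a 1) * (b 0 - a 0)

/-- The parameters of the points of the line `ab` at distance `ρ` from `c`. -/
def circleParam (σ ρ : ℝ) (a b c : Plane) : ℝ :=
  dotAt a b c / sqLen a b +
    σ * Real.sqrt ((ρ * ρ - crossAt a b c * crossAt a b c / sqLen a b) / sqLen a b)

/-- The parameters of the points of the line `ab` at distance `ρ` from a second line, which is given
by two of its points. -/
def tangentParam (σ ρ : ℝ) (a b a' b' : Plane) : ℝ :=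
  (σ * (ρ * Real.sqrt (sqLen a' b')) - crossAt a' b' a) / (crossAt a' b' b - crossAt a' b' a)

theorem sqLen_pos {a b : Plane} (h : a ≠ b) : 0 < sqLen a b := by
  by_contra! h0
  apply h
  unfold sqLen at h0
  have h1 := mul_self_nonneg (b 0 - a 0)
  have h2 := mul_self_nonneg (b 1 - a 1)
  have h3 : b 0 - a 0 = 0 := mul_self_eq_zero.1 (by linarith)
  have h4 : b 1 - a 1 = 0 := mul_self_eq_zero.1 (by linarith)
  ext i
  fin_cases i <;> simp <;> linarith

theorem dist_mul_dist (x y : Plane) : dist x y * dist x y = sqLen x y := by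
  rw [EuclideanSpace.dist_eq, Real.mul_self_sqrt (by positivity), Fin.sum_univ_two, sqLen,
    Real.dist_eq, Real.dist_eq, sq_abs, sq_abs]
  ring

/-- Pythagoras: `dotAt a b c / sqLen a b` is the parameter of the foot of the perpendicular from
`c`, and the last summand is the squared distance of `c` from the line. -/
theorem dist_line_mul_dist {a b : Plane} (h : a ≠ b) (t : ℝ) (c : Plane) :
    dist (a + t • (b - a)) c * dist (a + t • (b - a)) c =
      sqLen a b * (t - dotAt a b c / sqLen a b) ^ 2 +
        crossAt a b c * crossAt a b c / sqLen a b := by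
  have hq := (sqLen_pos h).ne'
  rw [dist_mul_dist]
  field_simp
  simp only [sqLen, dotAt, crossAt, PiLp.add_apply, PiLp.smul_apply, PiLp.sub_apply, smul_eq_mul]
  ring

theorem eq_circleParam {a b c : Plane} (h : a ≠ b) {t ρ : ℝ}
    (ht : dist (a + t • (b - a)) c = ρ) :
    t = circleParam 1 ρ a b c ∨ t = circleParam (-1) ρ a b c := by
  have hq := sqLen_pos h
  have h1 := dist_line_mul_dist h t c
  rw [ht] at h1
  have h2 : (ρ * ρ - crossAt a b c * crossAt a b c / sqLen a b) / sqLen a b =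
      (t - dotAt a b c / sqLen a b) ^ 2 := by
    rw [h1, add_sub_cancel_right, mul_div_cancel_left₀ _ hq.ne']
  unfold circleParam
  rw [h2, Real.sqrt_sq_eq_abs]
  rcases abs_cases (t - dotAt a b c / sqLen a b) with h | h
  · left; rw [h.1]; ring
  · right; rw [h.1]; ring

/-- When `s` is the parameter of the foot of the perpendicular, `ρ` is the distance to the line
`a'b'`. The determinant `crossAt a' b'` is affine in `t` and equals that distance times the length
of `a'b'`, up to sign; this is a linear equation for `t`. -/
theorem eq_tangentParam {a b a' b' : Plane} (hcr : crossAt a' b' b - crossAt a' b' a ≠ 0)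
    (h' : a' ≠ b') {t s ρ : ℝ}
    (hs : s = dotAt a' b' (a + t • (b - a)) / sqLen a' b')
    (ht : dist (a' + s • (b' - a')) (a + t • (b - a)) = ρ) :
    t = tangentParam 1 ρ a b a' b' ∨ t = tangentParam (-1) ρ a b a' b' := by
  have hq := sqLen_pos h'
  have h1 := dist_line_mul_dist h' s (a + t • (b - a))
  have hρ : 0 ≤ ρ := ht ▸ dist_nonneg
  rw [ht, ← hs, sub_self] at h1
  set e := crossAt a' b' (a + t • (b - a)) with he
  have h2 : (ρ * Real.sqrt (sqLen a' b')) ^ 2 = e ^ 2 := by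
    rw [mul_pow, Real.sq_sqrt hq.le, pow_two ρ, h1]
    field_simp
    ring
  have h3 : e = crossAt a' b' a + t * (crossAt a' b' b - crossAt a' b' a) := by
    rw [he]
    simp only [crossAt, PiLp.add_apply, PiLp.smul_apply, PiLp.sub_apply, smul_eq_mul]
    ring
  unfold tangentParam
  rcases sq_eq_sq_iff_eq_or_eq_neg.1 h2 with h | h
  · left; rw [eq_div_iff hcr, h, h3]; ring
  · right; rw [eq_div_iff hcr, h, h3]; ring

/-- The difference is the determinant of the two directions. If it vanished, both coordinates of the
second direction would appear as coefficients of linear relations and hence be zero. -/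
theorem Instance.GeneralPosition.cross_ne_zero {I : Instance n k} (hI : I.GeneralPosition)
    {i j : Fin k} (hij : i ≠ j) :
    crossAt (I.a j) (I.b j) (I.b i) - crossAt (I.a j) (I.b j) (I.a i) ≠ 0 := by
  intro h
  have hlin := LinearIndependent.pair_iff.1 (hI.2 i j hij)
  set d := I.b i - I.a i with hd
  set e := I.b j - I.a j with he
  have h' : d 0 * e 1 - d 1 * e 0 = 0 := by
    rw [← h]; simp only [crossAt, hd, he, PiLp.sub_apply]; ring
  have h0 := hlin (e 0) (-d 0) (by
    ext l; fin_cases l <;> simp <;> linarith)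
  have h1 := hlin (e 1) (-d 1) (by
    ext l; fin_cases l <;> simp <;> linarith)
  apply hI.1 j
  ext l
  have e0 : e 0 = 0 := h0.1
  have e1 : e 1 = 0 := h1.1
  simp only [he, PiLp.sub_apply] at e0 e1
  fin_cases l <;> simp <;> linarith

/-- The ways in which the point on a segment is determined: it is an extremity, it is at distance
`ρ` from the point of another element, or it is at distance `ρ` from the line of another segment. -/
inductive Rule (n k : ℕ) : Type
  | source
  | target
  | circle (s : Bool) (v : Elt n k)
  | tangent (s : Bool) (c : Fin k)

/-- The sign encoded by a Boolean. -/
def boolSign (s : Bool) : ℝ := if s then 1 else -1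

def Rule.value (I : Instance n k) (ρ : ℝ) (p : Elt n k → Plane) (j : Fin k) : Rule n k → ℝ
  | source => 0
  | target => 1
  | circle s v => circleParam (boolSign s) ρ (I.a j) (I.b j) (p v)
  | tangent s c => tangentParam (boolSign s) ρ (I.a j) (I.b j) (I.a c) (I.b c)

/-- The segments whose points a rule refers to. -/
def Rule.DependsOn : Rule n k → Fin k → Prop
  | circle _ (Sum.inr c), c' => c = c'
  | _, _ => False

/-- A tangent rule refers only to the line of the other segment, not to the point chosen on it; only
circles around segment points create dependencies. -/
theorem Rule.value_congr (I : Instance n k) (ρ : ℝ) {t t' : Fin k → ℝ} (j : Fin k) (R : Rule n k)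
    (h : ∀ c, R.DependsOn c → t c = t' c) :
    R.value I ρ (I.pos t) j = R.value I ρ (I.pos t') j := by
  rcases R with _ | _ | ⟨s, i | c⟩ | ⟨s, c⟩
  · rfl
  · rfl
  · rfl
  · simp only [Rule.value, Instance.pos, Sum.elim_inr, h c rfl]
  · rfl

/-- The parameters with index in `S` are determined, one after the other. -/
def Instance.DeterminedOn (I : Instance n k) (ρ : ℝ) (t : Fin k → ℝ) (S : Finset (Fin k)) : Prop :=
  ∃ (rank : Fin k → ℕ) (rule : Fin k → Rule n k), ∀ j ∈ S, rank j < S.card ∧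
    t j = (rule j).value I ρ (I.pos t) j ∧ ∀ c, (rule j).DependsOn c → c ∈ S ∧ rank c < rank j

theorem Instance.DeterminedOn.congr {I : Instance n k} {ρ : ℝ} {t t' : Fin k → ℝ}
    {S : Finset (Fin k)} (h : I.DeterminedOn ρ t S) (ht : ∀ j ∈ S, t' j = t j) :
    I.DeterminedOn ρ t' S := by
  obtain ⟨rank, rule, h⟩ := h
  refine ⟨rank, rule, fun j hj => ⟨(h j hj).1, ?_, (h j hj).2.2⟩⟩
  rw [ht j hj, (h j hj).2.1]
  exact Rule.value_congr I ρ j _ fun c hc => (ht c ((h j hj).2.2 c hc).1).symm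

/-- The new segment receives the rank `S.card`, above all ranks in use, so the dependencies stay
well-founded and ranks stay below the cardinality. -/
theorem Instance.DeterminedOn.insert_rule {I : Instance n k} {ρ : ℝ} {t : Fin k → ℝ}
    {S : Finset (Fin k)} (h : I.DeterminedOn ρ t S) {j : Fin k} (hj : j ∉ S) (R : Rule n k)
    (hR : t j = R.value I ρ (I.pos t) j) (hdep : ∀ c, R.DependsOn c → c ∈ S) :
    I.DeterminedOn ρ t (insert j S) := by
  obtain ⟨rank, rule, h⟩ := h
  have hne : ∀ i ∈ S, i ≠ j := fun i hi hij => hj (hij ▸ hi)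
  refine ⟨Function.update rank j S.card, Function.update rule j R, fun i hi => ?_⟩
  rw [Finset.card_insert_of_notMem hj]
  rcases Finset.mem_insert.1 hi with rfl | hi
  · simp only [Function.update_self]
    refine ⟨Nat.lt_succ_self _, hR, fun c hc => ⟨Finset.mem_insert_of_mem (hdep c hc), ?_⟩⟩
    rw [Function.update_of_ne (hne c (hdep c hc))]
    exact (h c (hdep c hc)).1
  · rw [Function.update_of_ne (hne i hi), Function.update_of_ne (hne i hi)]
    refine ⟨(h i hi).1.trans (Nat.lt_succ_self _), (h i hi).2.1, fun c hc => ?_⟩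
    have := (h i hi).2.2 c hc
    rw [Function.update_of_ne (hne c this.1)]
    exact ⟨Finset.mem_insert_of_mem this.1, this.2⟩

/-- In a tree, the neighbour of a vertex which is closer to the root is unique. -/
theorem isTree_eq_of_dist_lt {V : Type*} {T : SimpleGraph V} (hT : T.IsTree) {r c v w : V}
    (hv : T.Adj v c) (hw : T.Adj w c) (hvd : T.dist r v < T.dist r c)
    (hwd : T.dist r w < T.dist r c) : v = w := by
  classical
  have key : ∀ x, T.Adj x c → T.dist r x < T.dist r c →
      ∃ p : T.Walk r c, p.IsPath ∧ p.penultimate = x := by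
    intro x hx hxd
    obtain ⟨p, hp, hlen⟩ := hT.connected.exists_path_of_dist r x
    -- A shortest walk to `x` avoids `c`, which is farther from `r`; extended by the edge to `c` it
    -- is the path from `r` to `c`, unique in a tree.
    refine ⟨p.concat hx, hp.concat (fun hmem => ?_) hx, p.penultimate_concat hx⟩
    have h1 : T.dist r c ≤ (p.takeUntil c hmem).length := SimpleGraph.dist_le _
    have h2 := p.length_takeUntil_le_length hmem
    omega
  obtain ⟨p, hp, rfl⟩ := key v hv hvd
  obtain ⟨q, hq, rfl⟩ := key w hw hwd
  have := (hT.isAcyclic.subsingleton_path r c).elim ⟨p, hp⟩ ⟨q, hq⟩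
  rw [Subtype.mk.injEq] at this
  rw [this]

/-! ### Moving points until all of them are determined. -/

/-- Parameters of points for which no edge of `T` is longer than `ρ`. -/
def Instance.Admissible (I : Instance n k) (T : SimpleGraph (Elt n k)) (ρ : ℝ) :
    Set (Fin k → ℝ) :=
  {t | t ∈ cube k ∧ ∀ u v, T.Adj u v → dist (I.pos t u) (I.pos t v) ≤ ρ}

theorem Instance.isCompact_admissible (I : Instance n k) (T : SimpleGraph (Elt n k)) (ρ : ℝ) :
    IsCompact (I.Admissible T ρ) := by
  refine isCompact_cube.inter_right (t := {t | ∀ u v, T.Adj u v →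
    dist (I.pos t u) (I.pos t v) ≤ ρ}) ?_
  simp only [Set.ofPred_forall]
  exact isClosed_iInter fun u => isClosed_iInter fun v => isClosed_iInter fun _ =>
    isClosed_le ((I.continuous_pos u).dist (I.continuous_pos v)) continuous_const

theorem Instance.pos_update_of_ne (I : Instance n k) (t : Fin k → ℝ) (c : Fin k) (τ : ℝ)
    {v : Elt n k} (hv : v ≠ Sum.inr c) : I.pos (Function.update t c τ) v = I.pos t v := by
  rcases v with i | j
  · rfl
  · have : j ≠ c := fun h => hv (by rw [h])
    simp [Instance.pos, Function.update_of_ne this]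

theorem Instance.pos_update_self (I : Instance n k) (t : Fin k → ℝ) (c : Fin k) (τ : ℝ) :
    I.pos (Function.update t c τ) (Sum.inr c) = I.a c + τ • (I.b c - I.a c) := by
  simp [Instance.pos]

/-- Small changes of a parameter keep the short edges short. -/
theorem Instance.eventually_update (I : Instance n k) {T : SimpleGraph (Elt n k)} {ρ : ℝ}
    {t : Fin k → ℝ} (ht : t ∈ I.Admissible T ρ) {c : Fin k} (hc : t c ∈ Set.Ioo (0 : ℝ) 1) :
    ∀ᶠ τ in nhds (t c), Function.update t c τ ∈ cube k ∧ ∀ w, T.Adj (Sum.inr c) w →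
      dist (I.pos t (Sum.inr c)) (I.pos t w) < ρ →
      dist (I.pos (Function.update t c τ) (Sum.inr c)) (I.pos (Function.update t c τ) w) < ρ := by
  refine Filter.Eventually.and ?_ ?_
  · filter_upwards [isOpen_Ioo.mem_nhds hc] with τ hτ
    refine mem_cube.2 fun j => ?_
    rcases eq_or_ne j c with rfl | hj
    · simpa using ⟨hτ.1.le, hτ.2.le⟩
    · rw [Function.update_of_ne hj]
      exact mem_cube.1 ht.1 j
  · refine Filter.eventually_all.2 fun w => ?_
    by_cases hw : T.Adj (Sum.inr c) w
    swap
    · exact Filter.Eventually.of_forall fun τ h => absurd h hw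
    by_cases hlt : dist (I.pos t (Sum.inr c)) (I.pos t w) < ρ
    swap
    · exact Filter.Eventually.of_forall fun τ _ h => absurd h hlt
    have hcont : Continuous fun τ : ℝ => dist (I.a c + τ • (I.b c - I.a c)) (I.pos t w) := by fun_prop
    have h := hcont.continuousAt.eventually_lt (x₀ := t c) continuousAt_const hlt
    filter_upwards [h] with τ hτ _ _
    rw [I.pos_update_self, I.pos_update_of_ne t c τ hw.ne']
    exact hτ

/-- Away from the foot of the perpendicular, a point of a line can be moved a little so as to
come closer to a given point. -/
theorem frequently_dist_line_lt {a b c : Plane} (h : a ≠ b) {t : ℝ}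
    (ht : t ≠ dotAt a b c / sqLen a b) :
    ∃ᶠ τ in nhds t, dist (a + τ • (b - a)) c < dist (a + t • (b - a)) c := by
  set m := dotAt a b c / sqLen a b
  -- Parameters approaching `t` from the side of the foot `m`: the offset from the foot shrinks by
  -- the factor `1 - s`.
  have hlim : Filter.Tendsto (fun s : ℝ => t + s * (m - t)) (nhdsWithin 0 (Set.Ioi 0))
      (nhds t) := by
    have : Continuous fun s : ℝ => t + s * (m - t) := by fun_prop
    simpa using (this.tendsto 0).mono_left nhdsWithin_le_nhds
  refine hlim.frequently (Filter.Eventually.frequently ?_)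
  filter_upwards [Ioo_mem_nhdsGT (zero_lt_one' ℝ)] with s hs
  refine lt_of_mul_self_lt_mul_self₀ dist_nonneg ?_
  rw [dist_line_mul_dist h, dist_line_mul_dist h]
  have hq := sqLen_pos h
  have h1 : t + s * (m - t) - m = (1 - s) * (t - m) := by ring
  have h2 : 0 < (t - m) ^ 2 := by have := sub_ne_zero.2 ht; positivity
  have h3 : (1 - s) ^ 2 < 1 := by nlinarith [hs.1, hs.2]
  change sqLen a b * (t + s * (m - t) - m) ^ 2 + _ < sqLen a b * (t - m) ^ 2 + _
  rw [h1, mul_pow]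
  gcongr
  nlinarith

/-- As long as not all parameters are determined, one more parameter can be determined after a
change of those which are not. -/
theorem Instance.DeterminedOn.extend {I : Instance n k} (hI : I.GeneralPosition)
    {T : SimpleGraph (Elt n k)} (hT : T.IsTree) {ρ : ℝ} {t : Fin k → ℝ}
    (ht : t ∈ I.Admissible T ρ) {S : Finset (Fin k)} (hS : I.DeterminedOn ρ t S) {u : Fin k}
    (hu : u ∉ S) :
    ∃ t' ∈ I.Admissible T ρ, ∃ j ∉ S, I.DeterminedOn ρ t' (insert j S) := by
  classical
  by_contra! hno
  let K : Set (Fin k → ℝ) := I.Admissible T ρ ∩ {t' | ∀ j ∈ S, t' j = t j}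
  have hK : IsCompact K := by
    refine (I.isCompact_admissible T ρ).inter_right ?_
    simp only [Set.ofPred_forall]
    exact isClosed_iInter fun j => isClosed_iInter fun _ =>
      isClosed_eq (continuous_apply j) continuous_const
  -- If a member of `K` satisfied a rule at an undetermined segment, with dependencies in `S`, that
  -- segment could be added to `S`. The facts `hmid`, `hcircle` and `hfoot` are the resulting
  -- exclusions for extremities, circles and tangents.
  have hrule : ∀ t' ∈ K, ∀ j ∉ S, ∀ R : Rule n k, (∀ c, R.DependsOn c → c ∈ S) →
      t' j ≠ R.value I ρ (I.pos t') j := fun t' ht' j hj R hR heq =>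
    hno t' ht'.1 j hj ((hS.congr ht'.2).insert_rule hj R heq hR)
  have hmid : ∀ t' ∈ K, ∀ j ∉ S, t' j ∈ Set.Ioo (0 : ℝ) 1 := fun t' ht' j hj =>
    ⟨lt_of_le_of_ne (mem_cube.1 ht'.1.1 j).1 (hrule t' ht' j hj .source (fun _ h => h.elim)).symm,
      lt_of_le_of_ne (mem_cube.1 ht'.1.1 j).2 (hrule t' ht' j hj .target (fun _ h => h.elim))⟩
  have hcircle : ∀ t' ∈ K, ∀ j ∉ S, ∀ v : Elt n k, (∀ c, v = Sum.inr c → c ∈ S) →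
      dist (I.pos t' (Sum.inr j)) (I.pos t' v) ≠ ρ := fun t' ht' j hj v hv heq => by
    have hdep : ∀ s, ∀ c, (Rule.circle s v).DependsOn c → c ∈ S := by
      rintro s c hc
      rcases v with i | c'
      · exact hc.elim
      · exact hv c (congrArg _ hc)
    rcases eq_circleParam (hI.1 j) heq with h | h
    · exact hrule t' ht' j hj (.circle true v) (hdep _) h
    · exact hrule t' ht' j hj (.circle false v) (hdep _) h
  -- If `c` sat at the foot of the perpendicular from the point of `j`, then that point would be at
  -- distance `ρ` from the line of `c`, and a tangent rule would determine `j`.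
  have hfoot : ∀ t' ∈ K, ∀ j ∉ S, ∀ c ≠ j,
      dist (I.pos t' (Sum.inr c)) (I.pos t' (Sum.inr j)) = ρ →
      t' c ≠ dotAt (I.a c) (I.b c) (I.pos t' (Sum.inr j)) / sqLen (I.a c) (I.b c) :=
    fun t' ht' j hj c hc heq hfe => by
      rcases eq_tangentParam (hI.cross_ne_zero hc.symm) (hI.1 c) hfe heq with h | h
      · exact hrule t' ht' j hj (.tangent true c) (fun _ h => h.elim) h
      · exact hrule t' ht' j hj (.tangent false c) (fun _ h => h.elim) h
  -- Two nested minimisations: `t₀` has the least parameter of `u`, and `t₁` has the fewest tight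
  -- edges among the points of `K` with that parameter.
  obtain ⟨t₀, ht₀K, ht₀⟩ := hK.exists_isMinOn ⟨t, ht, fun _ _ => rfl⟩
    (continuous_apply u).continuousOn
  let tight : (Fin k → ℝ) → Finset (Elt n k × Elt n k) := fun t' =>
    Finset.univ.filter fun e => T.Adj e.1 e.2 ∧ dist (I.pos t' e.1) (I.pos t' e.2) = ρ
  let K₀ : Set (Fin k → ℝ) := {t' ∈ K | t' u = t₀ u}
  have hK₀ : K₀.Nonempty := ⟨t₀, ht₀K, rfl⟩
  let t₁ := Function.argminOn (fun t' => (tight t').card) K₀ hK₀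
  have ht₁ : t₁ ∈ K₀ := Function.argminOn_mem _ _ _
  have hmin : ∀ t' ∈ K₀, (tight t₁).card ≤ (tight t').card := fun t' ht' =>
    Function.argminOn_le (fun t' => (tight t').card) K₀ ht'
  have ht₁K : t₁ ∈ K := ht₁.1
  -- changing one undetermined parameter
  have hadm : ∀ c ∉ S, ∀ τ, Function.update t₁ c τ ∈ cube k →
      (∀ w, T.Adj (Sum.inr c) w → dist (I.pos (Function.update t₁ c τ) (Sum.inr c))
        (I.pos (Function.update t₁ c τ) w) ≤ ρ) → Function.update t₁ c τ ∈ K := by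
    refine fun c hc τ hcube hle => ⟨⟨hcube, fun v w hvw => ?_⟩, fun j hj => ?_⟩
    · rcases eq_or_ne v (Sum.inr c) with rfl | hv
      · exact hle w hvw
      rcases eq_or_ne w (Sum.inr c) with rfl | hw
      · rw [dist_comm]; exact hle v hvw.symm
      rw [I.pos_update_of_ne _ _ _ hv, I.pos_update_of_ne _ _ _ hw]
      exact ht₁K.1.2 v w hvw
    · rw [Function.update_of_ne (fun h : j = c => hc (h ▸ hj))]
      exact ht₁K.2 j hj
  have htightS : ∀ e ∈ tight t₁, ∀ j, e.1 = Sum.inr j → j ∉ S →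
      ∃ c, e.2 = Sum.inr c ∧ c ∉ S := by
    rintro ⟨v, w⟩ he j rfl hj
    simp only [tight, Finset.mem_filter, Finset.mem_univ, true_and] at he
    by_contra! h
    exact hcircle t₁ ht₁K j hj w (fun c hc => by simpa using h c hc) he.2
  have hcont : ∀ w, T.Adj (Sum.inr u) w →
      dist (I.pos t₁ (Sum.inr u)) (I.pos t₁ w) < ρ := by
    by_contra! hw
    obtain ⟨w, hw, hwρ⟩ := hw
    have hwρ := le_antisymm (ht₁K.1.2 _ _ hw) hwρ
    -- a tight edge between undetermined segments farthest from `u`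
    let F : Finset (Elt n k × Elt n k) := (tight t₁).filter fun e =>
      (∃ j, e.1 = Sum.inr j ∧ j ∉ S) ∧ T.dist (Sum.inr u) e.1 < T.dist (Sum.inr u) e.2
    have huF : (Sum.inr u, w) ∈ F := by
      simp only [F, tight, Finset.mem_filter, Finset.mem_univ, true_and]
      refine ⟨⟨hw, hwρ⟩, ⟨u, rfl, hu⟩, ?_⟩
      rw [SimpleGraph.dist_self]
      exact hT.connected.pos_dist_of_ne hw.ne
    obtain ⟨⟨v, c'⟩, heF, hemax⟩ := F.exists_max_image (fun e => T.dist (Sum.inr u) e.2) ⟨_, huF⟩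
    obtain ⟨hetight, ⟨j, hj, hjS⟩, hlt⟩ := Finset.mem_filter.1 heF
    obtain ⟨c, hc, hcS⟩ := htightS _ hetight j hj hjS
    simp only at hj hc hlt hemax
    subst hj hc
    obtain ⟨-, hadj, hρ⟩ := Finset.mem_filter.1 hetight
    simp only at hadj hρ
    have hcu : c ≠ u := by
      rintro rfl
      simp at hlt
    have hcj : c ≠ j := fun h => hadj.ne (by rw [h])
    -- the only tight edge at `c`
    have honly : ∀ w, T.Adj (Sum.inr c) w → w ≠ Sum.inr j →
        dist (I.pos t₁ (Sum.inr c)) (I.pos t₁ w) < ρ := by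
      intro w hw hwj
      refine lt_of_le_of_ne (ht₁K.1.2 _ _ hw) fun heq => ?_
      have hct : (Sum.inr c, w) ∈ tight t₁ := by
        simp only [tight, Finset.mem_filter, Finset.mem_univ, true_and]
        exact ⟨hw, heq⟩
      rcases lt_or_ge (T.dist (Sum.inr u) w) (T.dist (Sum.inr u) (Sum.inr c)) with hd | hd
      -- A second tight edge at `c` leading back towards `u` would give `c` two neighbours closer to
      -- `u`; one leading away from `u` would contradict the choice of a farthest edge.
      · exact hwj (isTree_eq_of_dist_lt hT hw.symm hadj hd hlt)
      · have hd' := lt_of_le_of_ne hd (hT.dist_ne_of_adj (Sum.inr u) hw)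
        have := hemax (Sum.inr c, w) (by
          simp only [F, Finset.mem_filter]
          exact ⟨hct, ⟨c, rfl, hcS⟩, hd'⟩)
        simp only at this
        omega
    have hne := hfoot t₁ ht₁K j hjS c hcj (by rw [dist_comm]; exact hρ)
    -- A small move of `c` towards the foot shortens its only tight edge and keeps the slack edges
    -- slack. The parameter of `u` is untouched, so the number of tight edges drops within `K₀`.
    obtain ⟨τ, hτ, hτcube, hτlt⟩ := ((frequently_dist_line_lt (hI.1 c) hne).and_eventually
      (I.eventually_update ht₁K.1 (hmid t₁ ht₁K c hcS))).exists
    have hτj : dist (I.pos (Function.update t₁ c τ) (Sum.inr c))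
        (I.pos (Function.update t₁ c τ) (Sum.inr j)) < ρ := by
      rw [I.pos_update_self, I.pos_update_of_ne _ _ _ (by simpa using hcj.symm)]
      refine hτ.trans_eq ?_
      rw [← hρ, dist_comm]
      rfl
    have hall : ∀ w, T.Adj (Sum.inr c) w → dist (I.pos (Function.update t₁ c τ) (Sum.inr c))
        (I.pos (Function.update t₁ c τ) w) < ρ := by
      intro w hw
      rcases eq_or_ne w (Sum.inr j) with rfl | hwj
      · exact hτj
      · exact hτlt w hw (honly w hw hwj)
    have hmem : Function.update t₁ c τ ∈ K₀ :=
      ⟨hadm c hcS τ hτcube fun w hw => (hall w hw).le, by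
        rw [Function.update_of_ne hcu.symm]; exact ht₁.2⟩
    refine absurd (hmin _ hmem) (not_le.2 (Finset.card_lt_card ?_))
    refine Finset.ssubset_iff_of_subset (fun e he => ?_) |>.2 ⟨_, hetight, fun he => ?_⟩
    · obtain ⟨-, h1, h2⟩ := Finset.mem_filter.1 he
      have hv : e.1 ≠ Sum.inr c := fun h => by
        rw [h] at h1 h2
        exact (hall _ h1).ne h2
      have hw : e.2 ≠ Sum.inr c := fun h => by
        rw [h] at h1 h2
        rw [dist_comm] at h2
        exact (hall _ h1.symm).ne h2
      rw [I.pos_update_of_ne _ _ _ hv, I.pos_update_of_ne _ _ _ hw] at h2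
      exact Finset.mem_filter.2 ⟨Finset.mem_univ _, h1, h2⟩
    · obtain ⟨-, -, h2⟩ := Finset.mem_filter.1 he
      rw [dist_comm] at h2
      exact hτj.ne h2
  -- Now all edges at `u` are slack, and its parameter can be decreased slightly, against the choice
  -- of `t₀`.
  obtain ⟨τ, hτ, hτcube, hτlt⟩ := ((frequently_lt_nhds (t₁ u)).and_eventually
    (I.eventually_update ht₁K.1 (hmid t₁ ht₁K u hu))).exists
  have hmem := hadm u hu τ hτcube fun w hw => (hτlt w hw (hcont w hw)).le
  have h1 : t₀ u ≤ Function.update t₁ u τ u := ht₀ hmem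
  rw [Function.update_self, ← ht₁.2] at h1
  exact absurd hτ (not_lt.2 h1)

/-- If a radius is feasible, it is feasible for points all of which are determined by rules. -/
theorem Instance.Feasible.exists_determined {I : Instance n k} (hI : I.GeneralPosition) {α : ℝ}
    (h : I.Feasible α) :
    ∃ t ∈ cube k, (connectivityGraph (I.pos t) α).Connected ∧
      I.DeterminedOn (2 * α) t Finset.univ := by
  classical
  obtain ⟨p, hp, hc⟩ := h
  obtain ⟨t, ht, rfl⟩ := hp.exists_pos
  obtain ⟨T, hTle, hT⟩ := hc.exists_isTree_le
  -- Induction on the number of determined segments; the tree stays fixed while the points move.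
  have key : ∀ m ≤ k, ∃ t ∈ I.Admissible T (2 * α), ∃ S : Finset (Fin k), S.card = m ∧
      I.DeterminedOn (2 * α) t S := by
    intro m
    induction m with
    | zero =>
      exact fun _ => ⟨t, ⟨ht, fun u v huv => (hTle huv).2⟩, ∅, rfl, fun _ => 0, fun _ => .source,
        fun j hj => absurd hj (Finset.notMem_empty j)⟩
    | succ m ih =>
      intro hm
      obtain ⟨t, ht, S, hcard, hS⟩ := ih (by omega)
      obtain ⟨u, hu⟩ : ∃ u, u ∉ S := by
        by_contra! hall
        have := Finset.card_eq_of_equiv_fin ((Equiv.subtypeUnivEquiv hall).trans (Equiv.refl _))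
        omega
      obtain ⟨t', ht', j, hj, hd⟩ := hS.extend hI hT ht hu
      exact ⟨t', ht', _, by rw [Finset.card_insert_of_notMem hj, hcard], hd⟩
  obtain ⟨t, ht, S, hcard, hS⟩ := key k le_rfl
  have hSu : S = Finset.univ := Finset.card_eq_iff_eq_univ S |>.1 (by simpa using hcard)
  subst hSu
  exact ⟨t, ht.1, SimpleGraph.Connected.mono (fun u v huv => ⟨huv.ne, ht.2 u v huv⟩)
    hT.connected, hS⟩

/-! ### Reasoning about programs -/

/-- Started in `s`, the program halts within `B` steps in a memory satisfying `Q`. -/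
def HaltsIn (c : Prog) (s : Mem) (B : ℕ) (Q : Mem → Prop) : Prop :=
  ∃ t s', Exec c s t s' ∧ t ≤ B ∧ Q s'

theorem HaltsIn.mono {c : Prog} {s : Mem} {B B' : ℕ} {Q Q' : Mem → Prop} (h : HaltsIn c s B Q)
    (hB : B ≤ B') (hQ : ∀ s', Q s' → Q' s') : HaltsIn c s B' Q' := by
  obtain ⟨t, s', he, ht, hs⟩ := h
  exact ⟨t, s', he, ht.trans hB, hQ s' hs⟩

theorem HaltsIn.seq {c d : Prog} {s : Mem} {B B' : ℕ} {Q : Mem → Prop}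
    (h : HaltsIn c s B fun s' => HaltsIn d s' B' Q) : HaltsIn (.seq c d) s (B + B') Q := by
  obtain ⟨t, s', he, ht, t', s'', he', ht', hq⟩ := h
  exact ⟨_, _, .seq he he', by omega, hq⟩

theorem HaltsIn.ite {b : Test} {c d : Prog} {s : Mem} {B : ℕ} {Q : Mem → Prop}
    (h : b.Holds s → HaltsIn c s B Q) (h' : ¬ b.Holds s → HaltsIn d s B Q) :
    HaltsIn (.ite b c d) s (B + 1) Q := by
  by_cases hb : b.Holds s
  · obtain ⟨t, s', he, ht, hq⟩ := h hb
    exact ⟨_, _, .iteTrue hb he, by omega, hq⟩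
  · obtain ⟨t, s', he, ht, hq⟩ := h' hb
    exact ⟨_, _, .iteFalse hb he, by omega, hq⟩

/-- The index of the invariant `J` bounds the number of rounds still to come. The hypothesis makes
it a successor whenever the test holds, so `J 0` forces the exit. -/
theorem HaltsIn.loop {b : Test} {c : Prog} {B : ℕ} (J : ℕ → Mem → Prop)
    (hstep : ∀ m s, J m s → b.Holds s → ∃ m', m = m' + 1 ∧ HaltsIn c s B (J m')) :
    ∀ m s, J m s →
      HaltsIn (.loop b c) s (m * (B + 1) + 1) fun s' => ¬ b.Holds s' ∧ ∃ m', J m' s' := by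
  intro m
  induction m with
  | zero =>
    intro s hs
    by_cases hb : b.Holds s
    · obtain ⟨m', hm', -⟩ := hstep 0 s hs hb
      omega
    · exact ⟨1, s, .loopStop hb, by omega, hb, 0, hs⟩
  | succ m ih =>
    intro s hs
    by_cases hb : b.Holds s
    · obtain ⟨m', hm', t, s', he, ht, hJ⟩ := hstep _ s hs hb
      obtain rfl : m = m' := by omega
      obtain ⟨t', s'', he', ht', hq⟩ := ih s' hJ
      exact ⟨_, _, .loopStep hb he he', by rw [add_mul]; omega, hq⟩
    · exact ⟨1, s, .loopStop hb, by omega, hb, _, hs⟩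

/-- Programs without loops and without exact bisection. -/
def Prog.LoopFree : Prog → Prop
  | skip => True
  | natSet _ _ => True
  | realSet _ _ => True
  | seq c d => c.LoopFree ∧ d.LoopFree
  | ite _ c d => c.LoopFree ∧ d.LoopFree
  | loop _ _ => False
  | threshold _ _ _ => False

open Classical in
/-- The effect of a program without loops. -/
def Prog.run : Prog → Mem → Mem
  | skip, s => s
  | natSet e f, s => s.setNat (e.eval s) (f.eval s)
  | realSet e f, s => s.setReal (e.eval s) (f.eval s)
  | seq c d, s => d.run (c.run s)
  | ite b c d, s => if b.Holds s then c.run s else d.run s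
  | loop _ _, s => s
  | threshold _ _ _, s => s

/-- A bound for the number of steps of a program without loops. -/
def Prog.cost : Prog → ℕ
  | skip => 1
  | natSet _ _ => 1
  | realSet _ _ => 1
  | seq c d => c.cost + d.cost
  | ite _ c d => max c.cost d.cost + 1
  | loop _ _ => 0
  | threshold _ _ _ => 0

theorem Prog.LoopFree.haltsIn_eq {c : Prog} (hc : c.LoopFree) (s : Mem) :
    HaltsIn c s c.cost (· = c.run s) := by
  induction c generalizing s with
  | skip => exact ⟨1, _, .skip s, le_rfl, rfl⟩
  | natSet e f => exact ⟨1, _, .natSet e f s, le_rfl, rfl⟩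
  | realSet e f => exact ⟨1, _, .realSet e f s, le_rfl, rfl⟩
  | seq c d ihc ihd =>
    refine HaltsIn.seq ((ihc hc.1 s).mono le_rfl fun s' hs' => ?_)
    subst hs'
    exact ihd hc.2 _
  | ite b c d ihc ihd =>
    refine HaltsIn.ite (fun hb => (ihc hc.1 s).mono (le_max_left _ _) fun s' hs' => ?_)
      (fun hb => (ihd hc.2 s).mono (le_max_right _ _) fun s' hs' => ?_)
    · rw [hs', Prog.run, if_pos hb]
    · rw [hs', Prog.run, if_neg hb]
  | loop => exact hc.elim
  | threshold => exact hc.elim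

/-- Reduces straight-line code to the computation of `run`; the values of `run` and `cost` on loops
are dummies and never used. -/
theorem Prog.LoopFree.haltsIn {c : Prog} (hc : c.LoopFree) {s : Mem} {B : ℕ} {Q : Mem → Prop}
    (hB : c.cost ≤ B) (h : Q (c.run s)) : HaltsIn c s B Q :=
  (hc.haltsIn_eq s).mono hB fun _ hs => hs ▸ h

@[simp] theorem Mem.setNat_real (s : Mem) (i v : ℕ) : (s.setNat i v).real = s.real := rfl

@[simp] theorem Mem.setReal_nat (s : Mem) (i : ℕ) (v : ℝ) : (s.setReal i v).nat = s.nat := rfl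

theorem Mem.setNat_nat (s : Mem) (i v m : ℕ) :
    (s.setNat i v).nat m = if m = i then v else s.nat m := by
  simp [Mem.setNat, Function.update_apply]

theorem Mem.setReal_real (s : Mem) (i : ℕ) (v : ℝ) (m : ℕ) :
    (s.setReal i v).real m = if m = i then v else s.real m := by
  simp [Mem.setReal, Function.update_apply]

/-- The content of the natural-number cell `i`. -/
abbrev natCell (i : ℕ) : NatExp := .cell (.lit i)

/-- `natSet` for the cell with address `i`. -/
abbrev assign (i : ℕ) (e : NatExp) : Prog := .natSet (.lit i) e

/-- Run `body` for the values of the cell `i` up to the content of the cell `b`. -/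
def forLoop (i b : ℕ) (body : Prog) : Prog :=
  .loop (.not (.natLe (natCell b) (natCell i)))
    (.seq body (assign i (.add (natCell i) (.lit 1))))

/-- Besides the body, a round pays for one test and one increment, hence `B + 2`. The invariant is
demanded for the memory after the increment. -/
theorem HaltsIn.forLoop {i b : ℕ} {body : Prog} {s : Mem} {B hi : ℕ} (J : ℕ → Mem → Prop)
    (hb : s.nat b = hi) (hle : s.nat i ≤ hi) (h0 : J (s.nat i) s)
    (hstep : ∀ m s', m < hi → s'.nat i = m → s'.nat b = hi → J m s' →
      HaltsIn body s' B fun s'' => s''.nat i = m ∧ (s''.setNat i (m + 1)).nat b = hi ∧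
        J (m + 1) (s''.setNat i (m + 1))) :
    HaltsIn (forLoop i b body) s ((hi - s.nat i) * (B + 2) + 1)
      fun s' => s'.nat i = hi ∧ s'.nat b = hi ∧ J hi s' := by
  have h := HaltsIn.loop (b := .not (.natLe (natCell b) (natCell i)))
    (c := .seq body (assign i (.add (natCell i) (.lit 1)))) (B := B + 1)
    (fun m s' => s'.nat i + m = hi ∧ s'.nat b = hi ∧ J (s'.nat i) s')
    (by
      rintro m s' ⟨hm, hb', hJ⟩ ht
      simp only [Test.Holds, NatExp.eval, hb'] at ht
      refine ⟨m - 1, by omega, HaltsIn.seq ((hstep (s'.nat i) s' (by omega) rfl hb' hJ).mono le_rfl ?_)⟩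
      rintro s'' ⟨h1, h2, h3⟩
      refine Prog.LoopFree.haltsIn (by trivial) le_rfl ?_
      simp only [Prog.run, NatExp.eval, h1]
      refine ⟨?_, h2, ?_⟩
      · rw [Mem.setNat_nat, if_pos rfl]; omega
      · rw [Mem.setNat_nat, if_pos rfl]; exact h3)
    (hi - s.nat i) s ⟨by omega, hb, h0⟩
  refine h.mono le_rfl ?_
  rintro s' ⟨hn, m, hm, hb', hJ⟩
  simp only [Test.Holds, NatExp.eval, hb', not_not] at hn
  have : s'.nat i = hi := by omega
  exact ⟨this, hb', this ▸ hJ⟩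

/-! ### Arrays -/

/-- The address of entry `e` of the array of natural numbers with base `c`, `32 ≤ c < 36`. -/
def arr (c : ℕ) (e : NatExp) : NatExp := .add (.lit c) (.add (.add e e) (.add e e))

theorem eval_arr (c : ℕ) (e : NatExp) (s : Mem) : (arr c e).eval s = c + 4 * e.eval s := by
  simp only [arr, NatExp.eval]; omega

/-- The address of the real variable `c`. -/
def var (c : ℕ) : NatExp := .add (natCell 2) (.lit c)

theorem eval_var (c : ℕ) (s : Mem) : (var c).eval s = s.nat 2 + c := rfl

/-- The content of the real variable `c`. -/
abbrev rv (c : ℕ) : RealExp := .cell (var c)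

/-- The address of the first coordinate of the current point of the element with index `e`. -/
def ptX (e : NatExp) : NatExp := .add (.add (natCell 2) (.lit 32)) (.add e e)

/-- The address of the second coordinate of the current point of the element with index `e`. -/
def ptY (e : NatExp) : NatExp := .add (.add (natCell 2) (.lit 33)) (.add e e)

theorem eval_ptX (e : NatExp) (s : Mem) : (ptX e).eval s = s.nat 2 + 32 + 2 * e.eval s := by
  simp only [ptX, NatExp.eval]; omega

theorem eval_ptY (e : NatExp) (s : Mem) : (ptY e).eval s = s.nat 2 + 33 + 2 * e.eval s := by
  simp only [ptY, NatExp.eval]; omega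

/-- The current point of the element with index `v`. -/
def Mem.pt (s : Mem) (v : ℕ) : Plane :=
  !₂[s.real (s.nat 2 + 32 + 2 * v), s.real (s.nat 2 + 33 + 2 * v)]

/-- The current threshold for the distances. -/
def Mem.rho (s : Mem) : ℝ := s.real (s.nat 2 + 1)

/-- The four arrays of unbounded length are interleaved from address `32` on and distinguished by
the residue modulo `4`; smaller addresses hold scalars. Frame conditions are therefore stated by
residues. -/
def Mem.lab (s : Mem) (u : ℕ) : ℕ := s.nat (32 + 4 * u)
def Mem.savedLab (s : Mem) (u : ℕ) : ℕ := s.nat (33 + 4 * u)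
def Mem.mark (s : Mem) (u : ℕ) : ℕ := s.nat (34 + 4 * u)
def Mem.dig (s : Mem) (u : ℕ) : ℕ := s.nat (35 + 4 * u)

/-- Adjacency of the current points. -/
def Mem.Near (s : Mem) (u v : ℕ) : Prop := dist (s.pt u) (s.pt v) ≤ s.rho

theorem Mem.Near.symm {s : Mem} {u v : ℕ} (h : s.Near u v) : s.Near v u := by
  unfold Mem.Near at *; rwa [dist_comm]

/-- The distance of the current points of the elements with indices `e` and `f`. -/
def distExp (e f : NatExp) : RealExp :=
  .sqrt (.add
    (.mul (.sub (.cell (ptX e)) (.cell (ptX f))) (.sub (.cell (ptX e)) (.cell (ptX f))))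
    (.mul (.sub (.cell (ptY e)) (.cell (ptY f))) (.sub (.cell (ptY e)) (.cell (ptY f)))))

theorem eval_distExp (s : Mem) (e f : NatExp) :
    (distExp e f).eval s = dist (s.pt (e.eval s)) (s.pt (f.eval s)) := by
  rw [EuclideanSpace.dist_eq, Fin.sum_univ_two, Real.dist_eq, Real.dist_eq, sq_abs, sq_abs]
  simp only [distExp, RealExp.eval, eval_ptX, eval_ptY, Mem.pt, sq]
  simp

/-! ### Connected components -/

/-- `lab` labels the connected components of the vertices below `v`, and the vertices below `N`
that are marked by `mark` are not in use as labels. -/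
structure IsLabeling (N : ℕ) (adj : ℕ → ℕ → Prop) (v : ℕ) (lab mark : ℕ → ℕ) : Prop where
  lt : ∀ u < v, lab u < v
  complete : ∀ u < v, ∀ u' < v, adj u u' → lab u = lab u'
  sound : ∀ u < v, ∀ u' < v, lab u = lab u' →
    Relation.ReflTransGen (fun a b => a < v ∧ b < v ∧ adj a b) u u'
  unmarked : ∀ u < v, mark (lab u) = 0
  fresh : ∀ l, v ≤ l → l < N → mark l = 0

/-- The new vertex absorbs the components of its neighbours under the label `v`; other components
remain. Marks need not be erased between insertions: a marked label goes out of use at once, and `v`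
itself is unmarked because all labels in use before are smaller. -/
theorem IsLabeling.insert {N : ℕ} {adj : ℕ → ℕ → Prop} (hsymm : ∀ u v, adj u v → adj v u) {v : ℕ}
    {lab mark lab' mark' : ℕ → ℕ} (h : IsLabeling N adj v lab mark) (hv : v < N)
    (hmark : ∀ l, 1 ≤ mark' l ↔ 1 ≤ mark l ∨ ∃ u < v, adj u v ∧ lab u = l)
    (hlab : ∀ u < v, lab' u = if 1 ≤ mark' (lab u) then v else lab u) (hlabv : lab' v = v) :
    IsLabeling N adj (v + 1) lab' mark' := by
  have hm : ∀ u < v, 1 ≤ mark' (lab u) ↔ ∃ w < v, adj w v ∧ lab w = lab u := fun u hu => by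
    rw [hmark, h.unmarked u hu]; simp
  have hlab' : ∀ u < v, lab' u < v + 1 := fun u hu => by
    rw [hlab u hu]; have := h.lt u hu; split_ifs <;> omega
  -- Either `u` belongs to the component of `v`, or its old component has no neighbour of `v` and
  -- keeps its label.
  have hcase : ∀ u < v + 1, (lab' u = v ∧ (u = v ∨ u < v ∧ ∃ w < v, adj w v ∧ lab w = lab u)) ∨
      (u < v ∧ lab' u = lab u ∧ lab u < v ∧ ¬ ∃ w < v, adj w v ∧ lab w = lab u) := by
    intro u hu
    rcases Nat.lt_succ_iff_lt_or_eq.1 hu with hu | rfl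
    · by_cases hw : ∃ w < v, adj w v ∧ lab w = lab u
      · left; exact ⟨by rw [hlab u hu, if_pos ((hm u hu).2 hw)], Or.inr ⟨hu, hw⟩⟩
      · right; exact ⟨hu, by rw [hlab u hu, if_neg (fun h => hw ((hm u hu).1 h))], h.lt u hu, hw⟩
    · exact Or.inl ⟨hlabv, Or.inl rfl⟩
  have hmono : ∀ a b, Relation.ReflTransGen (fun a b => a < v ∧ b < v ∧ adj a b) a b →
      Relation.ReflTransGen (fun a b => a < v + 1 ∧ b < v + 1 ∧ adj a b) a b := fun a b hab =>
    Relation.ReflTransGen.mono (fun a b h => ⟨by omega, by omega, h.2.2⟩) _ _ hab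
  have hsym : ∀ a b, Relation.ReflTransGen (fun a b => a < v + 1 ∧ b < v + 1 ∧ adj a b) a b →
      Relation.ReflTransGen (fun a b => a < v + 1 ∧ b < v + 1 ∧ adj a b) b a := fun a b hab =>
    have : Std.Symm fun a b => a < v + 1 ∧ b < v + 1 ∧ adj a b :=
      ⟨fun a b h => ⟨h.2.1, h.1, hsymm _ _ h.2.2⟩⟩
    Relation.ReflTransGen.stdSymm.symm _ _ hab
  have hto : ∀ u, (u = v ∨ u < v ∧ ∃ w < v, adj w v ∧ lab w = lab u) →
      Relation.ReflTransGen (fun a b => a < v + 1 ∧ b < v + 1 ∧ adj a b) u v := by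
    rintro u (rfl | ⟨hu, w, hw, hwv, hl⟩)
    · exact .refl
    · exact (hmono _ _ (h.sound u hu w hw hl.symm)).tail ⟨by omega, by omega, hwv⟩
  refine ⟨fun u hu => ?_, fun u hu u' hu' hadj => ?_, fun u hu u' hu' heq => ?_, fun u hu => ?_,
    fun l hl hlN => ?_⟩
  · rcases hcase u hu with h | h <;> omega
  · rcases hcase u hu with ⟨h1, h2⟩ | ⟨h1, h2, h3, h4⟩ <;>
      rcases hcase u' hu' with ⟨h1', h2'⟩ | ⟨h1', h2', h3', h4'⟩
    · omega
    · exfalso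
      rcases h2 with rfl | ⟨hu, w, hw, hwv, hl⟩
      · exact h4' ⟨u', h1', hsymm _ _ hadj, rfl⟩
      · exact h4' ⟨w, hw, hwv, hl.trans (h.complete u hu u' h1' hadj)⟩
    · exfalso
      rcases h2' with rfl | ⟨hu, w, hw, hwv, hl⟩
      · exact h4 ⟨u, h1, hadj, rfl⟩
      · exact h4 ⟨w, hw, hwv, hl.trans (h.complete u h1 u' hu hadj).symm⟩
    · rw [h2, h2']; exact h.complete u h1 u' h1' hadj
  · rcases hcase u hu with ⟨h1, h2⟩ | ⟨h1, h2, h3, h4⟩ <;>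
      rcases hcase u' hu' with ⟨h1', h2'⟩ | ⟨h1', h2', h3', h4'⟩
    · exact (hto u h2).trans (hsym _ _ (hto u' h2'))
    · omega
    · omega
    · exact hmono _ _ (h.sound u h1 u' h1' (by omega))
  · rcases hcase u hu with ⟨h1, h2⟩ | ⟨h1, h2, h3, h4⟩
    · rw [h1]
      by_contra hne
      rcases (hmark v).1 (by omega) with h5 | ⟨w, hw, -, hl⟩
      · have := h.fresh v le_rfl hv; omega
      · have := h.lt w hw; omega
    · rw [h2]
      by_contra hne
      exact h4 ((hm u h1).1 (by omega))
  · by_contra hne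
    rcases (hmark l).1 (by omega) with h5 | ⟨w, hw, -, h6⟩
    · have := h.fresh l (by omega) hlN; omega
    · have := h.lt w hw; omega

/-- Mark the labels of the predecessors near the element with index in cell `5`. -/
def markBody : Prog :=
  .ite (.realLe (distExp (natCell 6) (natCell 5)) (rv 1))
    (.natSet (arr 34 (.cell (arr 32 (natCell 6)))) (.lit 1)) .skip

/-- Replace marked labels by the content of cell `5`. -/
def relabelBody : Prog :=
  .ite (.natLe (.lit 1) (.cell (arr 34 (.cell (arr 32 (natCell 6))))))
    (.natSet (arr 32 (natCell 6)) (natCell 5)) .skip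

theorem haltsIn_markLoop (s : Mem) {v : ℕ} (hv : s.nat 5 = v) (hu : s.nat 6 = 0) :
    HaltsIn (forLoop 6 5 markBody) s (4 * v + 1) fun s' => s'.real = s.real ∧
      (∀ m, m ≠ 6 → (m < 32 ∨ m % 4 ≠ 2) → s'.nat m = s.nat m) ∧
      (∀ l, 1 ≤ s'.mark l ↔ 1 ≤ s.mark l ∨ ∃ u < v, s.Near u v ∧ s.lab u = l) := by
  have h := HaltsIn.forLoop (i := 6) (b := 5) (body := markBody) (B := 2) (s := s)
    (fun i s' => s'.real = s.real ∧
      (∀ m, m ≠ 6 → (m < 32 ∨ m % 4 ≠ 2) → s'.nat m = s.nat m) ∧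
      (∀ l, 1 ≤ s'.mark l ↔ 1 ≤ s.mark l ∨ ∃ u < i, s.Near u v ∧ s.lab u = l))
    hv (by omega) ⟨rfl, fun _ _ _ => rfl, fun l => by simp [hu]⟩ (by
      rintro i s' hi hi6 hi5 ⟨hr, hf, hm⟩
      have h2 : s'.nat 2 = s.nat 2 := hf 2 (by omega) (by omega)
      have hlab : s'.nat (32 + 4 * i) = s.lab i := hf _ (by omega) (by omega)
      have hpt : ∀ x, s'.pt x = s.pt x := fun x => by simp only [Mem.pt, h2, hr]
      have hcond : (Test.realLe (distExp (natCell 6) (natCell 5)) (rv 1)).Holds s' ↔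
          s.Near i v := by
        simp only [Test.Holds, eval_distExp, NatExp.eval, RealExp.eval, eval_var, hi6, hi5, h2, hr, hpt,
          Mem.Near, Mem.rho]
      refine HaltsIn.ite (fun hb => ?_) (fun hb => ?_) <;>
        refine Prog.LoopFree.haltsIn (by trivial) le_rfl ?_ <;> rw [hcond] at hb
      · have ha : (arr 34 (.cell (arr 32 (natCell 6)))).eval s' = 34 + 4 * s.lab i := by
          simp only [eval_arr, NatExp.eval, hi6, hlab]
        simp only [Prog.run, ha]
        refine ⟨by rw [Mem.setNat_nat, if_neg (by omega), hi6],
          by rw [Mem.setNat_nat, Mem.setNat_nat, if_neg (by omega), if_neg (by omega), hi5],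
          hr, fun m h6 hm4 => ?_, fun l => ?_⟩
        · rw [Mem.setNat_nat, Mem.setNat_nat, if_neg (by omega), if_neg (by omega), hf m h6 hm4]
        · rw [Mem.mark, Mem.setNat_nat, Mem.setNat_nat, if_neg (by omega)]
          have := hm l
          simp only [Mem.mark, NatExp.eval] at this ⊢
          split_ifs with hl
          · simp only [le_refl, true_iff]
            exact Or.inr ⟨i, by omega, hb, by omega⟩
          · rw [this]
            refine or_congr Iff.rfl ⟨fun ⟨u, h1, h2⟩ => ⟨u, by omega, h2⟩, fun ⟨u, h1, h2⟩ => ?_⟩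
            rcases Nat.lt_succ_iff_lt_or_eq.1 h1 with h1 | rfl
            · exact ⟨u, h1, h2⟩
            · omega
      · simp only [Prog.run]
        refine ⟨hi6, by rw [Mem.setNat_nat, if_neg (by omega), hi5], hr, fun m h6 hm4 => ?_,
          fun l => ?_⟩
        · rw [Mem.setNat_nat, if_neg h6, hf m h6 hm4]
        · rw [Mem.mark, Mem.setNat_nat, if_neg (by omega)]
          refine (hm l).trans (or_congr Iff.rfl ⟨fun ⟨u, h1, h2⟩ => ⟨u, by omega, h2⟩,
            fun ⟨u, h1, h2⟩ => ?_⟩)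
          rcases Nat.lt_succ_iff_lt_or_eq.1 h1 with h1 | rfl
          · exact ⟨u, h1, h2⟩
          · exact absurd h2.1 hb)
  exact h.mono (by omega) fun s' hs' => hs'.2.2

theorem haltsIn_relabelLoop (s : Mem) {v : ℕ} (hv : s.nat 5 = v) (hu : s.nat 6 = 0) :
    HaltsIn (forLoop 6 5 relabelBody) s (4 * v + 1) fun s' => s'.real = s.real ∧
      (∀ m, m ≠ 6 → (m < 32 ∨ m % 4 ≠ 0) → s'.nat m = s.nat m) ∧
      (∀ u, s'.lab u = if u < v ∧ 1 ≤ s.mark (s.lab u) then v else s.lab u) := by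
  have h := HaltsIn.forLoop (i := 6) (b := 5) (body := relabelBody) (B := 2) (s := s)
    (fun i s' => s'.real = s.real ∧
      (∀ m, m ≠ 6 → (m < 32 ∨ m % 4 ≠ 0) → s'.nat m = s.nat m) ∧
      (∀ u, s'.lab u = if u < i ∧ 1 ≤ s.mark (s.lab u) then v else s.lab u))
    hv (by omega) ⟨rfl, fun _ _ _ => rfl, fun l => by simp [hu]⟩ (by
      rintro i s' hi hi6 hi5 ⟨hr, hf, hm⟩
      have hlab : s'.nat (32 + 4 * i) = s.lab i := by have := hm i; simpa [Mem.lab] using this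
      have hmk : ∀ l, s'.nat (34 + 4 * l) = s.mark l := fun l => hf _ (by omega) (by omega)
      have hcond : (Test.natLe (.lit 1) (.cell (arr 34 (.cell (arr 32 (natCell 6)))))).Holds s' ↔
          1 ≤ s.mark (s.lab i) := by
        simp only [Test.Holds, NatExp.eval, eval_arr, hi6, hlab, hmk]
      refine HaltsIn.ite (fun hb => ?_) (fun hb => ?_) <;>
        refine Prog.LoopFree.haltsIn (by trivial) le_rfl ?_ <;> rw [hcond] at hb
      · have ha : (arr 32 (natCell 6)).eval s' = 32 + 4 * i := by
          simp only [eval_arr, NatExp.eval, hi6]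
        simp only [Prog.run, ha, NatExp.eval, hi5]
        refine ⟨by rw [Mem.setNat_nat, if_neg (by omega), hi6],
          by rw [Mem.setNat_nat, Mem.setNat_nat, if_neg (by omega), if_neg (by omega), hi5],
          hr, fun m h6 hm4 => ?_, fun u => ?_⟩
        · rw [Mem.setNat_nat, Mem.setNat_nat, if_neg (by omega), if_neg (by omega), hf m h6 hm4]
        · rw [Mem.lab, Mem.setNat_nat, Mem.setNat_nat, if_neg (by omega)]
          by_cases hui : u = i
          · subst hui; simp [hb]
          · rw [if_neg (by omega)]
            refine (hm u).trans (if_congr (and_congr_left fun _ => by omega) rfl rfl)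
      · simp only [Prog.run]
        refine ⟨hi6, by rw [Mem.setNat_nat, if_neg (by omega), hi5], hr, fun m h6 hm4 => ?_,
          fun u => ?_⟩
        · rw [Mem.setNat_nat, if_neg h6, hf m h6 hm4]
        · rw [Mem.lab, Mem.setNat_nat, if_neg (by omega)]
          by_cases hui : u = i
          · subst hui
            rw [if_neg (by tauto), hlab]
          · exact (hm u).trans (if_congr (and_congr_left fun _ => by omega) rfl rfl))
  exact h.mono (by omega) fun s' hs' => hs'.2.2

/-- Insert the element with index in cell `5` into the labelling of its predecessors. -/
def insertProg : Prog :=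
  .seq (.seq (.natSet (arr 32 (natCell 5)) (natCell 5)) (assign 6 (.lit 0))) <|
  .seq (forLoop 6 5 markBody) <|
  .seq (assign 6 (.lit 0)) <|
  forLoop 6 5 relabelBody

theorem haltsIn_insertProg (s : Mem) {v : ℕ} (hv : s.nat 5 = v) :
    HaltsIn insertProg s (8 * v + 5) fun s' => s'.real = s.real ∧
      (∀ m, m ≠ 6 → (m < 32 ∨ m % 4 = 1 ∨ m % 4 = 3) → s'.nat m = s.nat m) ∧
      (∀ l, 1 ≤ s'.mark l ↔ 1 ≤ s.mark l ∨ ∃ u < v, s.Near u v ∧ s.lab u = l) ∧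
      (∀ u < v, s'.lab u = if 1 ≤ s'.mark (s.lab u) then v else s.lab u) ∧ s'.lab v = v := by
  have key : HaltsIn insertProg s (2 + ((4 * v + 1) + (1 + (4 * v + 1)))) fun s' =>
      s'.real = s.real ∧
      (∀ m, m ≠ 6 → (m < 32 ∨ m % 4 = 1 ∨ m % 4 = 3) → s'.nat m = s.nat m) ∧
      (∀ l, 1 ≤ s'.mark l ↔ 1 ≤ s.mark l ∨ ∃ u < v, s.Near u v ∧ s.lab u = l) ∧
      (∀ u < v, s'.lab u = if 1 ≤ s'.mark (s.lab u) then v else s.lab u) ∧ s'.lab v = v := by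
    refine HaltsIn.seq (Prog.LoopFree.haltsIn (by exact ⟨trivial, trivial⟩) le_rfl ?_)
    have ha : (arr 32 (natCell 5)).eval s = 32 + 4 * v := by
      simp only [eval_arr, NatExp.eval, hv]
    simp only [Prog.run, ha, NatExp.eval, hv]
    set s₁ := (s.setNat (32 + 4 * v) v).setNat 6 0 with hs₁
    have hn₁ : ∀ m, s₁.nat m = if m = 6 then 0 else if m = 32 + 4 * v then v else s.nat m :=
      fun m => by rw [hs₁, Mem.setNat_nat, Mem.setNat_nat]
    refine HaltsIn.seq ((haltsIn_markLoop s₁ (v := v) (by rw [hn₁]; simp [hv])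
      (by rw [hn₁]; simp)).mono le_rfl ?_)
    rintro s₂ ⟨hr₂, hf₂, hm₂⟩
    refine HaltsIn.seq (Prog.LoopFree.haltsIn (by trivial) le_rfl ?_)
    simp only [Prog.run, NatExp.eval]
    set s₃ := s₂.setNat 6 0 with hs₃
    have hn₃ : ∀ m, s₃.nat m = if m = 6 then 0 else s₂.nat m := fun m => by
      rw [hs₃, Mem.setNat_nat]
    have h5 : s₃.nat 5 = v := by
      rw [hn₃, if_neg (by omega), hf₂ 5 (by omega) (by omega), hn₁, if_neg (by omega),
        if_neg (by omega), hv]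
    refine (haltsIn_relabelLoop s₃ h5 (by rw [hn₃]; simp)).mono le_rfl ?_
    rintro s₄ ⟨hr₄, hf₄, hl₄⟩
    have hnear : ∀ u, s₁.Near u v ↔ s.Near u v := fun u => by
      have h2 : s₁.nat 2 = s.nat 2 := by rw [hn₁, if_neg (by omega), if_neg (by omega)]
      have hr : s₁.real = s.real := rfl
      simp only [Mem.Near, Mem.pt, Mem.rho, h2, hr]
    have hlab₁ : ∀ u, s₁.lab u = if u = v then v else s.lab u := fun u => by
      rw [Mem.lab, hn₁, if_neg (by omega)]
      exact if_congr (by omega) rfl rfl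
    have hmark : ∀ l, s₄.mark l = s₂.mark l := fun l => by
      rw [Mem.mark, hf₄ _ (by omega) (by omega), hn₃, if_neg (by omega)]; rfl
    have hmark₃ : ∀ l, s₃.mark l = s₂.mark l := fun l => by
      rw [Mem.mark, hn₃, if_neg (by omega)]; rfl
    have hlab₃ : ∀ u, s₃.lab u = if u = v then v else s.lab u := fun u => by
      rw [Mem.lab, hn₃, if_neg (by omega), hf₂ _ (by omega) (by omega)]
      exact hlab₁ u
    refine ⟨by rw [hr₄]; exact hr₂, fun m h6 hm => ?_, fun l => ?_, fun u hu => ?_, ?_⟩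
    · rw [hf₄ m h6 (by omega), hn₃, if_neg h6, hf₂ m h6 (by omega), hn₁, if_neg h6,
        if_neg (by omega)]
    · rw [hmark, hm₂]
      have : s₁.mark l = s.mark l := by
        rw [Mem.mark, hn₁, if_neg (by omega), if_neg (by omega)]; rfl
      rw [this]
      refine or_congr Iff.rfl (exists_congr fun u => and_congr_right fun hu => ?_)
      rw [hnear, hlab₁, if_neg (by omega)]
    · rw [hl₄, hlab₃, hmark₃, hmark]
      simp [hu, hu.ne]
    · rw [hl₄, hlab₃]; simp
  exact key.mono (by omega) fun _ h => h

theorem IsLabeling.congr {N v : ℕ} {adj adj' : ℕ → ℕ → Prop} {lab mark : ℕ → ℕ}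
    (h : IsLabeling N adj v lab mark) (hadj : ∀ u < v, ∀ u' < v, adj u u' ↔ adj' u u') :
    IsLabeling N adj' v lab mark :=
  ⟨h.lt, fun u hu u' hu' ha => h.complete u hu u' hu' ((hadj u hu u' hu').2 ha),
    fun u hu u' hu' he => Relation.ReflTransGen.mono
      (fun a b hab => ⟨hab.1, hab.2.1, (hadj a hab.1 b hab.2.1).1 hab.2.2⟩) _ _
      (h.sound u hu u' hu' he), h.unmarked, h.fresh⟩

/-- Only the labels of the vertices below `v` matter, so a saved copy together with erased marks is
again a labelling, for any range `N'` of future labels. -/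
theorem IsLabeling.reset {N N' v : ℕ} {adj : ℕ → ℕ → Prop} {lab mark lab' mark' : ℕ → ℕ}
    (h : IsLabeling N adj v lab mark) (hv : v ≤ N') (hlab : ∀ u < v, lab' u = lab u)
    (hmark : ∀ l < N', mark' l = 0) : IsLabeling N' adj v lab' mark' := by
  refine ⟨fun u hu => ?_, fun u hu u' hu' ha => ?_, fun u hu u' hu' he => ?_, fun u hu => ?_,
    fun l _ hl => hmark l hl⟩
  · rw [hlab u hu]; exact h.lt u hu
  · rw [hlab u hu, hlab u' hu']; exact h.complete u hu u' hu' ha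
  · rw [hlab u hu, hlab u' hu'] at he; exact h.sound u hu u' hu' he
  · rw [hlab u hu]; exact hmark _ ((h.lt u hu).trans_le hv)

theorem Mem.near_congr {s s' : Mem} (h2 : s'.nat 2 = s.nat 2) (hr : s'.real = s.real) :
    s'.Near = s.Near := by
  funext u v
  simp only [Mem.Near, Mem.pt, Mem.rho, h2, hr]

/-- The loop may start from a partial labelling: from `0` for the fixed points, and from `n` for the
segment points. The cost is linear in `hi` per inserted vertex. -/
theorem haltsIn_labelLoop (s : Mem) {N b hi : ℕ} (hb : b < 5) (hbs : s.nat b = hi) (hN : hi ≤ N)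
    (h5 : s.nat 5 ≤ hi) (hlab : IsLabeling N s.Near (s.nat 5) s.lab s.mark) :
    HaltsIn (forLoop 5 b insertProg) s ((hi - s.nat 5) * (8 * hi + 7) + 1) fun s' =>
      s'.real = s.real ∧
      (∀ m, m ≠ 5 → m ≠ 6 → (m < 32 ∨ m % 4 = 1 ∨ m % 4 = 3) → s'.nat m = s.nat m) ∧
      IsLabeling N s.Near hi s'.lab s'.mark := by
  refine (HaltsIn.forLoop (i := 5) (b := b) (body := insertProg) (B := 8 * hi + 5) (s := s)
    (fun i s' => s'.real = s.real ∧
      (∀ m, m ≠ 5 → m ≠ 6 → (m < 32 ∨ m % 4 = 1 ∨ m % 4 = 3) → s'.nat m = s.nat m) ∧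
      IsLabeling N s.Near i s'.lab s'.mark) hbs h5 ⟨rfl, fun _ _ _ _ => rfl, hlab⟩ ?_).mono le_rfl
    fun s' hs' => hs'.2.2
  rintro i s' hi' h5' hb' ⟨hr, hf, hl⟩
  refine (haltsIn_insertProg s' h5').mono (by omega) ?_
  rintro s'' ⟨hr', hf', hm, hl', hv⟩
  have h2 : s'.nat 2 = s.nat 2 := hf 2 (by omega) (by omega) (by omega)
  have hnear := Mem.near_congr h2 hr
  refine ⟨by rw [hf' 5 (by omega) (by omega), h5'], ?_, by rw [Mem.setNat_real, hr', hr], ?_, ?_⟩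
  · rw [Mem.setNat_nat, if_neg (by omega), hf' b (by omega) (by omega), hb']
  · intro m hm5 hm6 hm4
    rw [Mem.setNat_nat, if_neg hm5, hf' m hm6 hm4, hf m hm5 hm6 hm4]
  · have e1 : (s''.setNat 5 (i + 1)).lab = s''.lab := by
      funext u; rw [Mem.lab, Mem.setNat_nat, if_neg (by omega)]; rfl
    have e2 : (s''.setNat 5 (i + 1)).mark = s''.mark := by
      funext u; rw [Mem.mark, Mem.setNat_nat, if_neg (by omega)]; rfl
    rw [e1, e2]
    refine hl.insert (fun u v h => h.symm) (by omega) ?_ hl' hv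
    rw [← hnear]; exact hm

/-! ### The memory during the computation -/

/-- The constants of the computation and the coordinates of the instance. -/
structure Instance.Loaded (I : Instance n k) (s : Mem) : Prop where
  cell_n : s.nat 0 = n
  cell_k : s.nat 1 = k
  -- The work area starts after the `2n + 4k` coordinates and one further cell, which holds the
  -- precision in the approximation algorithm.
  cell_base : s.nat 2 = 2 * n + 4 * k + 1
  cell_card : s.nat 3 = n + k
  cell_radix : s.nat 4 = 6 * (n + k) - 1
  site_fst : ∀ i : Fin n, s.real (2 * i) = I.site i 0
  site_snd : ∀ i : Fin n, s.real (2 * i + 1) = I.site i 1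
  a_fst : ∀ j : Fin k, s.real (2 * n + 4 * j) = I.a j 0
  a_snd : ∀ j : Fin k, s.real (2 * n + 1 + 4 * j) = I.a j 1
  b_fst : ∀ j : Fin k, s.real (2 * n + 2 + 4 * j) = I.b j 0
  b_snd : ∀ j : Fin k, s.real (2 * n + 3 + 4 * j) = I.b j 1

theorem Instance.Loaded.congr {I : Instance n k} {s s' : Mem} (h : I.Loaded s)
    (hn : ∀ m < 5, s'.nat m = s.nat m) (hr : ∀ m < 2 * n + 4 * k, s'.real m = s.real m) :
    I.Loaded s' where
  cell_n := by rw [hn _ (by omega), h.cell_n]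
  cell_k := by rw [hn _ (by omega), h.cell_k]
  cell_base := by rw [hn _ (by omega), h.cell_base]
  cell_card := by rw [hn _ (by omega), h.cell_card]
  cell_radix := by rw [hn _ (by omega), h.cell_radix]
  site_fst i := by rw [hr _ (by omega), h.site_fst]
  site_snd i := by rw [hr _ (by omega), h.site_snd]
  a_fst j := by rw [hr _ (by omega), h.a_fst]
  a_snd j := by rw [hr _ (by omega), h.a_snd]
  b_fst j := by rw [hr _ (by omega), h.b_fst]
  b_snd j := by rw [hr _ (by omega), h.b_snd]

/-- The index of an element. -/
def idx : Elt n k → ℕ := Sum.elim (fun i => i) (fun j => n + j)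

theorem idx_lt (v : Elt n k) : idx v < n + k := by
  rcases v with i | j <;> simp [idx]; omega

theorem exists_idx {u : ℕ} (hu : u < n + k) : ∃ v : Elt n k, idx v = u := by
  by_cases h : u < n
  · exact ⟨Sum.inl ⟨u, h⟩, rfl⟩
  · exact ⟨Sum.inr ⟨u - n, by omega⟩, by simp [idx]; omega⟩

theorem idx_injective : Function.Injective (idx : Elt n k → ℕ) := by
  rintro (i | i) (j | j) h <;> simp [idx] at h
  · rw [Fin.ext h]
  · omega
  · omega
  · rw [Fin.ext h]

/-- The current points. -/
def Mem.points (n k : ℕ) (s : Mem) : Elt n k → Plane := fun v => s.pt (idx v)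

/-- The kind includes the sign, so there are six kinds; together with an argument below `n + k` this
gives digits in base `6(n+k)`. Digits that code no rule exist and do no harm. -/
def Rule.kind : Rule n k → ℕ
  | source => 0
  | target => 1
  | circle s _ => if s then 2 else 3
  | tangent s _ => if s then 4 else 5

def Rule.arg : Rule n k → ℕ
  | source => 0
  | target => 0
  | circle _ v => idx v
  | tangent _ c => n + c

/-- The digit that stands for a rule. -/
def Rule.code (R : Rule n k) : ℕ := R.kind * (n + k) + R.arg

theorem Rule.kind_le (R : Rule n k) : R.kind ≤ 5 := by
  rcases R with _ | _ | ⟨_ | _, v⟩ | ⟨_ | _, c⟩ <;> simp [Rule.kind]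

theorem Rule.arg_lt (hk : 1 ≤ k) (R : Rule n k) : R.arg < n + k := by
  rcases R with _ | _ | ⟨s, v⟩ | ⟨s, c⟩ <;> simp only [Rule.arg]
  · omega
  · omega
  · exact idx_lt v
  · omega

theorem Rule.code_lt (hk : 1 ≤ k) (R : Rule n k) : R.code < 6 * (n + k) := by
  have h1 := R.arg_lt hk
  have h2 := Nat.mul_le_mul_right (n + k) R.kind_le
  unfold Rule.code
  omega

theorem Rule.kind_arg_of_code (hk : 1 ≤ k) (R : Rule n k) {a b : ℕ} (hb : b < n + k)
    (h : a * (n + k) + b = R.code) : a = R.kind ∧ b = R.arg := by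
  have h1 := R.arg_lt hk
  unfold Rule.code at h
  have hdiv := congrArg (· / (n + k)) h
  simp only [mul_comm _ (n + k)] at hdiv
  rw [Nat.mul_add_div (by omega), Nat.mul_add_div (by omega), Nat.div_eq_of_lt hb,
    Nat.div_eq_of_lt h1] at hdiv
  have : a = R.kind := by simpa using hdiv
  subst this
  exact ⟨rfl, by omega⟩

/-! ### Evaluation of a rule -/

/-- Split the digit of the segment in cell `7` into kind (cell `12`) and argument (cell `11`). -/
def decodeProg : Prog :=
  .seq (.seq (assign 11 (.cell (arr 35 (natCell 7)))) (assign 12 (.lit 0)))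
    (.loop (.natLe (natCell 3) (natCell 11))
      (.seq (assign 11 (.sub (natCell 11) (natCell 3)))
        (assign 12 (.add (natCell 12) (.lit 1)))))

/-- The natural numbers have no division; the quotient is at most `5`, so repeated subtraction takes
constant time. -/
theorem haltsIn_decodeProg (s : Mem) {N a b : ℕ} (hN : s.nat 3 = N) (ha : a ≤ 5) (hb : b < N)
    (hd : s.dig (s.nat 7) = a * N + b) :
    HaltsIn decodeProg s 18 fun s' => s'.real = s.real ∧
      (∀ m, m ≠ 11 → m ≠ 12 → s'.nat m = s.nat m) ∧ s'.nat 11 = b ∧ s'.nat 12 = a := by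
  refine (HaltsIn.seq (B := 2) (B' := a * 3 + 1)
    (Prog.LoopFree.haltsIn (by exact ⟨trivial, trivial⟩) le_rfl ?_)).mono (by omega) fun _ h => h
  refine (HaltsIn.loop (B := 2) (fun m s' => s'.real = s.real ∧
      (∀ m, m ≠ 11 → m ≠ 12 → s'.nat m = s.nat m) ∧ s'.nat 11 = m * N + b ∧ s'.nat 12 + m = a)
      ?_ a _ ?_).mono le_rfl ?_
  · rintro m s' ⟨hr, hf, h11, h12⟩ ht
    simp only [Test.Holds, NatExp.eval, h11, hf 3 (by omega) (by omega), hN] at ht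
    obtain ⟨m, rfl⟩ : ∃ m', m = m' + 1 := ⟨m - 1, by
      rcases Nat.eq_zero_or_pos m with rfl | h
      · omega
      · omega⟩
    refine ⟨m, rfl, Prog.LoopFree.haltsIn (by exact ⟨trivial, trivial⟩) le_rfl ⟨hr, ?_, ?_, ?_⟩⟩
    · intro i h1 h2
      simp only [Prog.run, NatExp.eval, Mem.setNat_nat]
      rw [if_neg h2, if_neg h1, hf i h1 h2]
    · simp [Prog.run, NatExp.eval, Mem.setNat_nat, h11, hf 3 (by omega) (by omega), hN, add_mul]
      omega
    · simp [Prog.run, NatExp.eval, Mem.setNat_nat]; omega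
  · refine ⟨rfl, fun m h1 h2 => ?_, ?_, ?_⟩
    · simp only [Prog.run, NatExp.eval, Mem.setNat_nat]
      rw [if_neg h2, if_neg h1]
    · simp only [Prog.run, NatExp.eval, Mem.setNat_nat, eval_arr]
      simpa [Mem.dig] using hd
    · simp [Prog.run, NatExp.eval, Mem.setNat_nat]
  · rintro s' ⟨hn, m, hr, hf, h11, h12⟩
    simp only [Test.Holds, NatExp.eval, h11, hf 3 (by omega) (by omega), hN] at hn
    obtain rfl : m = 0 := by
      by_contra h
      have := Nat.mul_le_mul_right N (Nat.one_le_iff_ne_zero.2 h)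
      omega
    exact ⟨hr, hf, by omega, by omega⟩

/-- The address of coordinate `c` of the segment with index `e`. -/
def segAddr (c : ℕ) (e : NatExp) : NatExp :=
  .add (.add (.add (natCell 0) (natCell 0)) (.lit c)) (.add (.add e e) (.add e e))

theorem eval_segAddr (c : ℕ) (e : NatExp) (s : Mem) :
    (segAddr c e).eval s = 2 * s.nat 0 + c + 4 * e.eval s := by
  simp only [segAddr, NatExp.eval]; omega

/-- Expressions for the two coordinates of a point. -/
structure PtExp where
  fst : RealExp
  snd : RealExp

def PtExp.Denotes (e : PtExp) (s : Mem) (x : Plane) : Prop :=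
  e.fst.eval s = x 0 ∧ e.snd.eval s = x 1

def sqLenExp (a b : PtExp) : RealExp :=
  .add (.mul (.sub b.fst a.fst) (.sub b.fst a.fst)) (.mul (.sub b.snd a.snd) (.sub b.snd a.snd))

def dotExp (a b c : PtExp) : RealExp :=
  .add (.mul (.sub c.fst a.fst) (.sub b.fst a.fst)) (.mul (.sub c.snd a.snd) (.sub b.snd a.snd))

def crossExp (a b c : PtExp) : RealExp :=
  .sub (.mul (.sub c.fst a.fst) (.sub b.snd a.snd)) (.mul (.sub c.snd a.snd) (.sub b.fst a.fst))

def circleExp (σ : ℚ) (ρ : RealExp) (a b c : PtExp) : RealExp :=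
  .add (.div (dotExp a b c) (sqLenExp a b)) (.mul (.lit σ) (.sqrt (.div (.sub (.mul ρ ρ)
    (.div (.mul (crossExp a b c) (crossExp a b c)) (sqLenExp a b))) (sqLenExp a b))))

def tangentExp (σ : ℚ) (ρ : RealExp) (a b a' b' : PtExp) : RealExp :=
  .div (.sub (.mul (.lit σ) (.mul ρ (.sqrt (sqLenExp a' b')))) (crossExp a' b' a))
    (.sub (crossExp a' b' b) (crossExp a' b' a))

section

variable {s : Mem} {a b c a' b' : PtExp} {A B C A' B' : Plane}

theorem eval_sqLenExp (ha : a.Denotes s A) (hb : b.Denotes s B) :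
    (sqLenExp a b).eval s = sqLen A B := by
  simp only [sqLenExp, RealExp.eval, ha.1, ha.2, hb.1, hb.2, sqLen]

theorem eval_dotExp (ha : a.Denotes s A) (hb : b.Denotes s B) (hc : c.Denotes s C) :
    (dotExp a b c).eval s = dotAt A B C := by
  simp only [dotExp, RealExp.eval, ha.1, ha.2, hb.1, hb.2, hc.1, hc.2, dotAt]

theorem eval_crossExp (ha : a.Denotes s A) (hb : b.Denotes s B) (hc : c.Denotes s C) :
    (crossExp a b c).eval s = crossAt A B C := by
  simp only [crossExp, RealExp.eval, ha.1, ha.2, hb.1, hb.2, hc.1, hc.2, crossAt]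

theorem eval_circleExp (σ : ℚ) (ρ : RealExp) (ha : a.Denotes s A) (hb : b.Denotes s B)
    (hc : c.Denotes s C) :
    (circleExp σ ρ a b c).eval s = circleParam σ (ρ.eval s) A B C := by
  simp only [circleExp, RealExp.eval, eval_sqLenExp ha hb, eval_dotExp ha hb hc,
    eval_crossExp ha hb hc, circleParam]

theorem eval_tangentExp (σ : ℚ) (ρ : RealExp) (ha : a.Denotes s A) (hb : b.Denotes s B)
    (ha' : a'.Denotes s A') (hb' : b'.Denotes s B') :
    (tangentExp σ ρ a b a' b').eval s = tangentParam σ (ρ.eval s) A B A' B' := by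
  simp only [tangentExp, RealExp.eval, eval_sqLenExp ha' hb', eval_crossExp ha' hb' ha,
    eval_crossExp ha' hb' hb, tangentParam]

end

/-- The extremities of the segment with index `e`. -/
def sourceExp (e : NatExp) : PtExp := ⟨.cell (segAddr 0 e), .cell (segAddr 1 e)⟩
def targetExp (e : NatExp) : PtExp := ⟨.cell (segAddr 2 e), .cell (segAddr 3 e)⟩

/-- The current point of the element with index `e`. -/
def pointExp (e : NatExp) : PtExp := ⟨.cell (ptX e), .cell (ptY e)⟩

theorem Instance.Loaded.start_denotes {I : Instance n k} {s : Mem} (h : I.Loaded s) {e : NatExp}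
    {j : Fin k} (he : e.eval s = j) : (sourceExp e).Denotes s (I.a j) := by
  constructor
  · simp only [sourceExp, RealExp.eval, eval_segAddr, he, h.cell_n]; exact h.a_fst j
  · simp only [sourceExp, RealExp.eval, eval_segAddr, he, h.cell_n]; exact h.a_snd j

theorem Instance.Loaded.stop_denotes {I : Instance n k} {s : Mem} (h : I.Loaded s) {e : NatExp}
    {j : Fin k} (he : e.eval s = j) : (targetExp e).Denotes s (I.b j) := by
  constructor
  · simp only [targetExp, RealExp.eval, eval_segAddr, he, h.cell_n]; exact h.b_fst j
  · simp only [targetExp, RealExp.eval, eval_segAddr, he, h.cell_n]; exact h.b_snd j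

theorem point_denotes (s : Mem) (e : NatExp) : (pointExp e).Denotes s (s.pt (e.eval s)) := by
  constructor
  · simp [pointExp, RealExp.eval, eval_ptX, Mem.pt]
  · simp [pointExp, RealExp.eval, eval_ptY, Mem.pt]

/-- The parameter determined by a rule of kind `a`. -/
def paramExp (a : ℕ) : RealExp :=
  let j := natCell 7
  let c := .sub (natCell 11) (natCell 0)
  match a with
  | 0 => .lit 0
  | 1 => .lit 1
  | 2 => circleExp 1 (rv 1) (sourceExp j) (targetExp j) (pointExp (natCell 11))
  | 3 => circleExp (-1) (rv 1) (sourceExp j) (targetExp j) (pointExp (natCell 11))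
  | 4 => tangentExp 1 (rv 1) (sourceExp j) (targetExp j) (sourceExp c) (targetExp c)
  | _ => tangentExp (-1) (rv 1) (sourceExp j) (targetExp j) (sourceExp c) (targetExp c)

theorem Instance.Loaded.eval_paramExp {I : Instance n k} {s : Mem} (h : I.Loaded s) {j : Fin k}
    (hj : s.nat 7 = j) (R : Rule n k) (harg : s.nat 11 = R.arg) :
    (paramExp R.kind).eval s = R.value I s.rho (s.points n k) j := by
  have hj' : (natCell 7).eval s = j := hj
  have hs := h.start_denotes hj'
  have ht := h.stop_denotes hj'
  have hc : ∀ c : Fin k, s.nat 11 = n + c →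
      (NatExp.sub (natCell 11) (natCell 0)).eval s = c := fun c hc => by
    simp only [NatExp.eval, hc, h.cell_n]; omega
  have hp : ∀ v : Elt n k, s.nat 11 = idx v →
      (pointExp (natCell 11)).Denotes s (s.points n k v) := fun v hv => by
    have := point_denotes s (natCell 11)
    simp only [NatExp.eval, hv] at this
    exact this
  rcases R with _ | _ | ⟨_ | _, v⟩ | ⟨_ | _, c⟩
  · simp [Rule.kind, paramExp, RealExp.eval, Rule.value]
  · simp [Rule.kind, paramExp, RealExp.eval, Rule.value]
  · simp only [Rule.kind, paramExp, Rule.value, Bool.false_eq_true, if_false]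
    rw [eval_circleExp _ _ hs ht (hp v harg)]
    simp [boolSign, RealExp.eval, eval_var, Mem.rho]
  · simp only [Rule.kind, paramExp, Rule.value, if_true]
    rw [eval_circleExp _ _ hs ht (hp v harg)]
    simp [boolSign, RealExp.eval, eval_var, Mem.rho]
  · simp only [Rule.kind, paramExp, Rule.value, Bool.false_eq_true, if_false]
    rw [eval_tangentExp _ _ hs ht (h.start_denotes (hc c harg)) (h.stop_denotes (hc c harg))]
    simp [boolSign, RealExp.eval, eval_var, Mem.rho]
  · simp only [Rule.kind, paramExp, Rule.value, if_true]
    rw [eval_tangentExp _ _ hs ht (h.start_denotes (hc c harg)) (h.stop_denotes (hc c harg))]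
    simp [boolSign, RealExp.eval, eval_var, Mem.rho]

/-- Compute the parameter of the segment in cell `7` according to its rule. -/
def paramProg : Prog :=
  .ite (.natLe (natCell 12) (.lit 0)) (.realSet (var 12) (paramExp 0)) <|
  .ite (.natLe (natCell 12) (.lit 1)) (.realSet (var 12) (paramExp 1)) <|
  .ite (.natLe (natCell 12) (.lit 2)) (.realSet (var 12) (paramExp 2)) <|
  .ite (.natLe (natCell 12) (.lit 3)) (.realSet (var 12) (paramExp 3)) <|
  .ite (.natLe (natCell 12) (.lit 4)) (.realSet (var 12) (paramExp 4)) <|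
  .realSet (var 12) (paramExp 5)

theorem run_paramProg (s : Mem) (h : s.nat 12 ≤ 5) :
    paramProg.run s = s.setReal (s.nat 2 + 12) ((paramExp (s.nat 12)).eval s) := by
  simp only [paramProg, Prog.run, Test.Holds, NatExp.eval, eval_var]
  have h' : s.nat 12 = 0 ∨ s.nat 12 = 1 ∨ s.nat 12 = 2 ∨ s.nat 12 = 3 ∨ s.nat 12 = 4 ∨
      s.nat 12 = 5 := by omega
  rcases h' with h | h | h | h | h | h <;> simp [h]

/-- Truncate the parameter to the unit interval and move the point of the segment there. -/
def moveProg : Prog :=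
  .seq (.ite (.realLe (rv 12) (.lit 0)) (.realSet (var 12) (.lit 0)) .skip) <|
  .seq (.ite (.realLe (.lit 1) (rv 12)) (.realSet (var 12) (.lit 1)) .skip) <|
  .seq (.realSet (ptX (.add (natCell 0) (natCell 7))) (.add (.cell (segAddr 0 (natCell 7)))
    (.mul (rv 12) (.sub (.cell (segAddr 2 (natCell 7))) (.cell (segAddr 0 (natCell 7))))))) <|
  .realSet (ptY (.add (natCell 0) (natCell 7))) (.add (.cell (segAddr 1 (natCell 7)))
    (.mul (rv 12) (.sub (.cell (segAddr 3 (natCell 7))) (.cell (segAddr 1 (natCell 7))))))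

/-- `s'` differs from `s` at most in the auxiliary variable and in the points of segments. -/
def Mem.SamePoints (n : ℕ) (s s' : Mem) (v : ℕ → Prop) : Prop :=
  ∀ m, m ≠ s.nat 2 + 12 → (∀ j, v j → m ≠ s.nat 2 + 32 + 2 * (n + j) ∧
    m ≠ s.nat 2 + 33 + 2 * (n + j)) → s'.real m = s.real m

/-- Truncation puts the point on its segment whatever the parameter was, and changes nothing if the
parameter is already admissible. -/
theorem haltsIn_moveProg {I : Instance n k} {s : Mem} (h : I.Loaded s) {j : Fin k}
    (hj : s.nat 7 = j) :
    HaltsIn moveProg s 6 fun s' => s'.nat = s.nat ∧ s.SamePoints n s' (· = j) ∧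
      ∃ τ ∈ Set.Icc (0 : ℝ) 1, s'.pt (n + j) = I.a j + τ • (I.b j - I.a j) ∧
        (s.real (s.nat 2 + 12) ∈ Set.Icc (0 : ℝ) 1 → τ = s.real (s.nat 2 + 12)) := by
  have hclamp : ∀ (b : Test) (c : ℚ) (s : Mem),
      HaltsIn (.ite b (.realSet (var 12) (.lit c)) .skip) s 2 fun s' =>
        (b.Holds s ∧ s' = s.setReal (s.nat 2 + 12) c) ∨ (¬ b.Holds s ∧ s' = s) := by
    intro b c s
    refine HaltsIn.ite (fun hb => ?_) (fun hb => ?_)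
    · exact Prog.LoopFree.haltsIn (by trivial) le_rfl (Or.inl ⟨hb, rfl⟩)
    · exact Prog.LoopFree.haltsIn (by trivial) le_rfl (Or.inr ⟨hb, rfl⟩)
  -- the memory after truncation
  have hstep : HaltsIn (.ite (.realLe (rv 12) (.lit 0)) (.realSet (var 12) (.lit 0)) .skip) s 2
      fun s₁ => HaltsIn (.ite (.realLe (.lit 1) (rv 12)) (.realSet (var 12) (.lit 1)) .skip) s₁ 2
      fun s₂ => s₂.nat = s.nat ∧ (∀ m, m ≠ s.nat 2 + 12 → s₂.real m = s.real m) ∧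
        s₂.real (s.nat 2 + 12) ∈ Set.Icc (0 : ℝ) 1 ∧ (s.real (s.nat 2 + 12) ∈ Set.Icc (0 : ℝ) 1 →
          s₂.real (s.nat 2 + 12) = s.real (s.nat 2 + 12)) := by
    refine (hclamp _ _ s).mono le_rfl fun s₁ hs₁ => (hclamp _ _ s₁).mono le_rfl fun s₂ hs₂ => ?_
    simp only [Test.Holds, RealExp.eval, eval_var, Rat.cast_zero, Rat.cast_one] at hs₁ hs₂
    set w := s.nat 2 + 12
    have h1 : s₁.nat = s.nat ∧ (∀ m, m ≠ w → s₁.real m = s.real m) ∧ 0 ≤ s₁.real w ∧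
        (s.real w ∈ Set.Icc (0 : ℝ) 1 → s₁.real w = s.real w) := by
      rcases hs₁ with ⟨hc, rfl⟩ | ⟨hc, rfl⟩
      · refine ⟨rfl, fun m hm => by rw [Mem.setReal_real, if_neg hm], ?_, fun hw => ?_⟩
        · rw [Mem.setReal_real, if_pos rfl]
        · rw [Mem.setReal_real, if_pos rfl]; exact le_antisymm hw.1 hc
      · exact ⟨rfl, fun m hm => rfl, (not_le.1 hc).le, fun _ => rfl⟩
    obtain ⟨e1, e2, e3, e4⟩ := h1
    rw [e1] at hs₂
    change ((1 ≤ s₁.real w) ∧ _) ∨ (¬ (1 ≤ s₁.real w) ∧ _) at hs₂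
    rcases hs₂ with ⟨hc, rfl⟩ | ⟨hc, rfl⟩
    · refine ⟨e1, fun m hm => ?_, ?_, fun hw => ?_⟩
      · rw [Mem.setReal_real, if_neg hm, e2 m hm]
      · rw [Mem.setReal_real, if_pos rfl]; exact ⟨zero_le_one, le_rfl⟩
      · rw [Mem.setReal_real, if_pos rfl]
        rw [e4 hw] at hc
        exact le_antisymm hc hw.2
    · exact ⟨e1, e2, ⟨e3, (not_le.1 hc).le⟩, e4⟩
  refine (HaltsIn.seq (B := 2) (B' := 4) (hstep.mono le_rfl fun s₁ hs₁ =>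
    HaltsIn.seq (B := 2) (B' := 2) (hs₁.mono le_rfl ?_)))
  rintro s₂ ⟨hn, hf, hτ, hτ'⟩
  refine Prog.LoopFree.haltsIn (by exact ⟨trivial, trivial⟩) le_rfl ?_
  have hload : I.Loaded s₂ := h.congr (fun m _ => by rw [hn]) fun m hm =>
    hf m (by rw [h.cell_base]; omega)
  have hj₂ : s₂.nat 7 = j := by rw [hn, hj]
  have hw := h.cell_base
  have hw₂ := hload.cell_base
  have hjk := j.2
  have ha1 := hload.a_snd j
  have hb1 := hload.b_snd j
  have ha0 := hload.a_fst j
  have hb0 := hload.b_fst j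
  rw [hw] at hτ hτ'
  simp only [Prog.run, eval_ptX, eval_ptY, RealExp.eval, NatExp.eval, eval_segAddr, eval_var,
    Mem.setReal_nat, hj₂, hload.cell_n, hw₂]
  refine ⟨hn, fun m hm hm' => ?_, _, hτ, ?_, hw ▸ hτ'⟩
  · have := hm' j rfl
    rw [hw] at this hm
    rw [Mem.setReal_real, if_neg (by omega), Mem.setReal_real, if_neg (by omega), hf m (by omega)]
  · have hpt : ∀ (s : Mem), s.nat 2 = 2 * n + 4 * k + 1 →
        s.pt (n + j) = !₂[s.real (2 * n + 4 * k + 1 + 32 + 2 * (n + j)),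
          s.real (2 * n + 4 * k + 1 + 33 + 2 * (n + j))] := fun s hs => by rw [Mem.pt, hs]
    rw [hpt _ (by exact hw₂)]
    simp only [Mem.setReal_real, if_true]
    rw [if_neg (by omega), if_neg (by omega), if_neg (by omega),
      if_neg (by omega), ha1, hb1, hb0]
    rw [show 2 * n + 0 + 4 * (j : ℕ) = 2 * n + 4 * j by omega, ha0]
    ext i
    fin_cases i <;> simp

/-- Move the point of the segment in cell `7` according to its rule. -/
def evalProg : Prog := .seq decodeProg (.seq paramProg moveProg)

/-- The digit need not code a rule: the new point lies on the segment in any case, and agreement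
with a rule is claimed only under the condition that the digit is its code and the value lies in the
unit interval. -/
theorem haltsIn_evalProg {I : Instance n k} {s : Mem} (h : I.Loaded s) {j : Fin k}
    (hj : s.nat 7 = j) (hd : s.dig j < 6 * (n + k)) :
    HaltsIn evalProg s 30 fun s' =>
      (∀ m, m ≠ 11 → m ≠ 12 → s'.nat m = s.nat m) ∧ s.SamePoints n s' (· = j) ∧
      ∃ τ ∈ Set.Icc (0 : ℝ) 1, s'.pt (n + j) = I.a j + τ • (I.b j - I.a j) ∧
        ∀ R : Rule n k, s.dig j = R.code →
          R.value I s.rho (s.points n k) j ∈ Set.Icc (0 : ℝ) 1 →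
          τ = R.value I s.rho (s.points n k) j := by
  have hk : 1 ≤ k := by have := j.2; omega
  have hdiv : s.dig j / (n + k) ≤ 5 := by
    have := Nat.div_lt_of_lt_mul (m := s.dig j) (n := n + k) (k := 6) (by rw [mul_comm]; exact hd)
    omega
  have hmod : s.dig j % (n + k) < n + k := Nat.mod_lt _ (by omega)
  have heq : s.dig j = s.dig j / (n + k) * (n + k) + s.dig j % (n + k) := by
    rw [mul_comm]; exact (Nat.div_add_mod _ _).symm
  refine (HaltsIn.seq (B := 18) (B' := 12) ((haltsIn_decodeProg s h.cell_card hdiv hmod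
    (by rw [hj]; exact heq)).mono le_rfl ?_))
  rintro s₁ ⟨hr₁, hf₁, h11, h12⟩
  have hload₁ : I.Loaded s₁ := h.congr (fun m hm => hf₁ m (by omega) (by omega))
    fun m _ => by rw [hr₁]
  have hj₁ : s₁.nat 7 = j := by rw [hf₁ 7 (by omega) (by omega), hj]
  have h2₁ : s₁.nat 2 = s.nat 2 := hf₁ 2 (by omega) (by omega)
  refine HaltsIn.seq (B := 6) (B' := 6) (Prog.LoopFree.haltsIn
    (by exact ⟨trivial, trivial, trivial, trivial, trivial, trivial⟩) le_rfl ?_)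
  rw [run_paramProg s₁ (by omega)]
  have hload₂ : I.Loaded (s₁.setReal (s₁.nat 2 + 12) ((paramExp (s₁.nat 12)).eval s₁)) :=
    hload₁.congr (fun m _ => rfl) fun m hm => by
      rw [Mem.setReal_real, if_neg (by rw [hload₁.cell_base]; omega)]
  refine (haltsIn_moveProg hload₂ (j := j) hj₁).mono le_rfl ?_
  rintro s₃ ⟨hn₃, hsame, τ, hτ, hpt, hτ'⟩
  refine ⟨fun m h1 h2 => ?_, fun m hm hm' => ?_, τ, hτ, hpt, fun R hR hv => ?_⟩
  · rw [hn₃]; exact hf₁ m h1 h2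
  · rw [hsame m (by rw [Mem.setReal_nat, h2₁]; exact hm)
      (by rw [Mem.setReal_nat, h2₁]; exact hm'), Mem.setReal_real, if_neg (by rw [h2₁]; exact hm),
      hr₁]
  · obtain ⟨hka, har⟩ := R.kind_arg_of_code hk hmod (heq.symm.trans hR)
    have hval := hload₁.eval_paramExp hj₁ R (by rw [h11, har])
    have hrho : s₁.rho = s.rho := by simp only [Mem.rho, h2₁, hr₁]
    have hpts : s₁.points n k = s.points n k := by
      funext v; simp only [Mem.points, Mem.pt, h2₁, hr₁]
    rw [hrho, hpts] at hval
    simp only [Mem.setReal_nat, Mem.setReal_real, if_true, h12, hka, hval] at hτ'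
    exact hτ' hv

/-! ### Evaluation of a guess -/

theorem Mem.pt_congr {s s' : Mem} {u : ℕ} (h2 : s'.nat 2 = s.nat 2)
    (h : ∀ m, m = s.nat 2 + 32 + 2 * u ∨ m = s.nat 2 + 33 + 2 * u → s'.real m = s.real m) :
    s'.pt u = s.pt u := by
  rw [Mem.pt, Mem.pt, h2, h _ (Or.inl rfl), h _ (Or.inr rfl)]

theorem Mem.SamePoints.trans {s s' s'' : Mem} {v v' : ℕ → Prop} (h : s.SamePoints n s' v)
    (h' : s'.SamePoints n s'' v') (h2 : s'.nat 2 = s.nat 2) (hv : ∀ j, v' j → v j) :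
    s.SamePoints n s'' v := fun m hm hm' => by
  rw [h' m (by rwa [h2]) (by rw [h2]; exact fun j hj => hm' j (hv j hj)), h m hm hm']

theorem Mem.SamePoints.pt_of_lt {s s' : Mem} {v : ℕ → Prop} (h : s.SamePoints n s' v)
    (h2 : s'.nat 2 = s.nat 2) {u : ℕ} (hu : u < n) : s'.pt u = s.pt u :=
  Mem.pt_congr h2 fun m hm => h m (by omega) fun j _ => by omega

theorem Mem.SamePoints.pt_of_not {s s' : Mem} {v : ℕ → Prop} (h : s.SamePoints n s' v)
    (h2 : s'.nat 2 = s.nat 2) {u : ℕ} (hu : ¬ v u) : s'.pt (n + u) = s.pt (n + u) :=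
  Mem.pt_congr h2 fun m hm => h m (by omega) fun j hj => by
    have : j ≠ u := fun hju => hu (hju ▸ hj)
    omega

theorem Mem.SamePoints.rho_eq {s s' : Mem} {v : ℕ → Prop} (h : s.SamePoints n s' v)
    (h2 : s'.nat 2 = s.nat 2) : s'.rho = s.rho := by
  rw [Mem.rho, Mem.rho, h2, h _ (by omega) fun j _ => by omega]

theorem Mem.SamePoints.loaded {I : Instance n k} {s s' : Mem} {v : ℕ → Prop}
    (h : s.SamePoints n s' v) (hs : I.Loaded s) (hn : ∀ m < 5, s'.nat m = s.nat m) :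
    I.Loaded s' :=
  hs.congr hn fun m hm => h m (by rw [hs.cell_base]; omega) fun j _ => by rw [hs.cell_base]; omega

/-- The digits `code` are rules that determine the parameters `t`, in the order of `rank`. -/
def Instance.IsGuess (I : Instance n k) (ρ : ℝ) (code : ℕ → ℕ) (t : Fin k → ℝ)
    (rank : Fin k → ℕ) : Prop :=
  t ∈ cube k ∧ ∃ rule : Fin k → Rule n k, ∀ j : Fin k, code j = (rule j).code ∧
    t j = (rule j).value I ρ (I.pos t) j ∧ ∀ c, (rule j).DependsOn c → rank c < rank j

/-- During a sweep only some segment points are correct; a rule needs no more than those it depends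
on. -/
theorem Rule.value_points (I : Instance n k) (ρ : ℝ) {t : Fin k → ℝ} {p : Elt n k → Plane}
    (hp : ∀ i, p (Sum.inl i) = I.site i) (j : Fin k) (R : Rule n k)
    (h : ∀ c, R.DependsOn c → p (Sum.inr c) = I.pos t (Sum.inr c)) :
    R.value I ρ p j = R.value I ρ (I.pos t) j := by
  rcases R with _ | _ | ⟨s, i | c⟩ | ⟨s, c⟩
  · rfl
  · rfl
  · simp only [Rule.value, hp, Instance.pos, Sum.elim_inl]
  · simp only [Rule.value, h c rfl]
  · rfl

/-- Apply the rule of every segment once. -/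
def roundProg : Prog := .seq (assign 7 (.lit 0)) (forLoop 7 1 evalProg)

/-- If all points of rank below `r` are right before the round, then all of rank below `r + 1` are
right after it, because a rule depends on smaller ranks only. -/
theorem haltsIn_roundProg {I : Instance n k} {s : Mem} (h : I.Loaded s)
    (hsite : ∀ i : Fin n, s.pt i = I.site i) (hd : ∀ j : Fin k, s.dig j < 6 * (n + k)) :
    HaltsIn roundProg s (32 * k + 2) fun s' =>
      (∀ m, m ≠ 7 → m ≠ 11 → m ≠ 12 → s'.nat m = s.nat m) ∧ s.SamePoints n s' (· < k) ∧
      (∀ j : Fin k, ∃ τ ∈ Set.Icc (0 : ℝ) 1, s'.pt (n + j) = I.a j + τ • (I.b j - I.a j)) ∧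
      ∀ t rank, I.IsGuess s.rho s.dig t rank → ∀ r,
        (∀ j : Fin k, rank j < r → s.pt (n + j) = I.pos t (Sum.inr j)) →
        ∀ j : Fin k, rank j < r + 1 → s'.pt (n + j) = I.pos t (Sum.inr j) := by
  refine (HaltsIn.seq (B := 1) (B' := k * 32 + 1) (Prog.LoopFree.haltsIn (by trivial) le_rfl
    ?_)).mono (by omega) fun _ h => h
  set s₀ := (assign 7 (.lit 0)).run s with hs₀
  have hn₀ : ∀ m, s₀.nat m = if m = 7 then 0 else s.nat m := fun m => by
    rw [hs₀]; simp only [Prog.run, NatExp.eval, Mem.setNat_nat]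
  have h7 : s₀.nat 7 = 0 := by rw [hn₀, if_pos rfl]
  refine (HaltsIn.forLoop (i := 7) (b := 1) (body := evalProg) (B := 30) (hi := k)
    -- The points are overwritten in place. Those of rank below `r` stay right throughout the round,
    -- being recomputed from right points; those of rank `r` become right when their turn comes.
    (fun i s' => (∀ m, m ≠ 7 → m ≠ 11 → m ≠ 12 → s'.nat m = s.nat m) ∧
      s.SamePoints n s' (· < k) ∧
      (∀ j : Fin k, (j : ℕ) < i →
        ∃ τ ∈ Set.Icc (0 : ℝ) 1, s'.pt (n + j) = I.a j + τ • (I.b j - I.a j)) ∧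
      ∀ t rank, I.IsGuess s.rho s.dig t rank → ∀ r,
        (∀ j : Fin k, rank j < r → s.pt (n + j) = I.pos t (Sum.inr j)) →
        ∀ j : Fin k, rank j < r ∨ (rank j < r + 1 ∧ (j : ℕ) < i) →
          s'.pt (n + j) = I.pos t (Sum.inr j)) ?_ ?_ ?_ ?_).mono ?_ ?_
  · rw [hn₀, if_neg (by omega), h.cell_k]
  · omega
  · rw [h7]
    have hpt : ∀ u, s₀.pt u = s.pt u := fun u => by
      refine Mem.pt_congr ?_ fun m _ => rfl
      rw [hn₀, if_neg (by omega)]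
    refine ⟨fun m h1 _ _ => by rw [hn₀, if_neg h1], fun m _ _ => rfl, fun j hj => by omega,
      fun t rank _ r hr j hj => ?_⟩
    rw [hpt]
    exact hr j (by omega)
  · rintro i s' hi h7' - ⟨hf, hsame, hseg, hguess⟩
    have h2 : s'.nat 2 = s.nat 2 := hf 2 (by omega) (by omega) (by omega)
    have hload : I.Loaded s' := hsame.loaded h fun m hm => hf m (by omega) (by omega) (by omega)
    have hdig : s'.dig = s.dig := funext fun u => hf _ (by omega) (by omega) (by omega)
    have hrho : s'.rho = s.rho := hsame.rho_eq h2
    refine (haltsIn_evalProg hload (j := ⟨i, hi⟩) h7' (by rw [hdig]; exact hd ⟨i, hi⟩)).mono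
      le_rfl ?_
    rintro s'' ⟨hf', hsame', τ, hτ, hpt, hval⟩
    set s₃ := s''.setNat 7 (i + 1) with hs₃
    have hn₃ : ∀ m, m ≠ 7 → m ≠ 11 → m ≠ 12 → s₃.nat m = s.nat m := fun m h1 h2 h3 => by
      rw [hs₃, Mem.setNat_nat, if_neg h1, hf' m h2 h3, hf m h1 h2 h3]
    have h2₃ : s₃.nat 2 = s'.nat 2 := by rw [hn₃ 2 (by omega) (by omega) (by omega), h2]
    have hsame₃ : s'.SamePoints n s₃ (· = i) := hsame'
    have hpt₃ : s₃.pt (n + i) = I.a ⟨i, hi⟩ + τ • (I.b ⟨i, hi⟩ - I.a ⟨i, hi⟩) := by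
      rw [← hpt]
      exact Mem.pt_congr (by rw [h2₃, hf' 2 (by omega) (by omega)]) fun m _ => rfl
    refine ⟨by rw [hf' 7 (by omega) (by omega), h7'], by
      rw [hn₃ 1 (by omega) (by omega) (by omega), h.cell_k], hn₃,
      hsame.trans hsame₃ h2 (by rintro j rfl; exact hi), fun j hj => ?_,
      fun t rank hg r hr j hj => ?_⟩
    · by_cases hji : (j : ℕ) = i
      · obtain rfl : j = ⟨i, hi⟩ := Fin.ext hji
        exact ⟨τ, hτ, hpt₃⟩
      · rw [hsame₃.pt_of_not h2₃ hji]
        exact hseg j (by omega)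
    · by_cases hji : (j : ℕ) = i
      · obtain rfl : j = ⟨i, hi⟩ := Fin.ext hji
        obtain ⟨ht, rule, hrule⟩ := id hg
        obtain ⟨hcode, hteq, hdep⟩ := hrule ⟨i, hi⟩
        have hv : (rule ⟨i, hi⟩).value I s'.rho (s'.points n k) ⟨i, hi⟩ = t ⟨i, hi⟩ := by
          rw [hrho, hteq]
          refine Rule.value_points I _ (fun i => ?_) _ _ fun c hc => ?_
          · change s'.pt i = _
            rw [hsame.pt_of_lt h2 i.2, hsite]
          · have := hdep c hc
            exact hguess t rank hg r hr c (Or.inl (by omega))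
        have hτt := hval (rule ⟨i, hi⟩) (by rw [hdig]; exact hcode)
          (by rw [hv]; exact mem_cube.1 ht _)
        rw [hpt₃, hτt, hv]
        rfl
      · rw [hsame₃.pt_of_not h2₃ hji]
        exact hguess t rank hg r hr j (by omega)
  · rw [h7, Nat.sub_zero]
  · rintro s' ⟨-, -, hf, hsame, hseg, hguess⟩
    exact ⟨hf, hsame, fun j => hseg j j.2, fun t rank hg r hr j hj =>
      hguess t rank hg r hr j (Or.inr ⟨hj, j.2⟩)⟩

/-- Apply the rules as often as there are segments. -/
def sweepProg : Prog := .seq (assign 8 (.lit 0)) (forLoop 8 1 roundProg)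

/-- After `i` rounds all points of rank below `i` are right, so `k` rounds suffice for ranks below
`k`, whatever the order of determination. -/
theorem haltsIn_sweepProg {I : Instance n k} {s : Mem} (hk : 1 ≤ k) (h : I.Loaded s)
    (hsite : ∀ i : Fin n, s.pt i = I.site i) (hd : ∀ j : Fin k, s.dig j < 6 * (n + k)) :
    HaltsIn sweepProg s (k * (32 * k + 4) + 2) fun s' =>
      (∀ m, m ≠ 7 → m ≠ 8 → m ≠ 11 → m ≠ 12 → s'.nat m = s.nat m) ∧ s.SamePoints n s' (· < k) ∧
      (∀ j : Fin k, ∃ τ ∈ Set.Icc (0 : ℝ) 1, s'.pt (n + j) = I.a j + τ • (I.b j - I.a j)) ∧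
      ∀ t rank, I.IsGuess s.rho s.dig t rank → (∀ j, rank j < k) →
        ∀ j : Fin k, s'.pt (n + j) = I.pos t (Sum.inr j) := by
  refine (HaltsIn.seq (B := 1) (B' := k * (32 * k + 4) + 1) (Prog.LoopFree.haltsIn (by trivial)
    le_rfl ?_)).mono (by omega) fun _ h => h
  set s₀ := (assign 8 (.lit 0)).run s with hs₀
  have hn₀ : ∀ m, s₀.nat m = if m = 8 then 0 else s.nat m := fun m => by
    rw [hs₀]; simp only [Prog.run, NatExp.eval, Mem.setNat_nat]
  have h8 : s₀.nat 8 = 0 := by rw [hn₀, if_pos rfl]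
  refine (HaltsIn.forLoop (i := 8) (b := 1) (body := roundProg) (B := 32 * k + 2) (hi := k)
    (fun i s' => (∀ m, m ≠ 7 → m ≠ 8 → m ≠ 11 → m ≠ 12 → s'.nat m = s.nat m) ∧
      s.SamePoints n s' (· < k) ∧
      (0 < i → ∀ j : Fin k,
        ∃ τ ∈ Set.Icc (0 : ℝ) 1, s'.pt (n + j) = I.a j + τ • (I.b j - I.a j)) ∧
      ∀ t rank, I.IsGuess s.rho s.dig t rank →
        ∀ j : Fin k, rank j < i → s'.pt (n + j) = I.pos t (Sum.inr j)) ?_ ?_ ?_ ?_).mono ?_ ?_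
  · rw [hn₀, if_neg (by omega), h.cell_k]
  · omega
  · rw [h8]
    exact ⟨fun m _ h1 _ _ => by rw [hn₀, if_neg h1], fun m _ _ => rfl, fun h => by omega,
      fun t rank _ j hj => by omega⟩
  · rintro i s' hi h8' - ⟨hf, hsame, hseg, hguess⟩
    have h2 : s'.nat 2 = s.nat 2 := hf 2 (by omega) (by omega) (by omega) (by omega)
    have hload : I.Loaded s' := hsame.loaded h fun m hm =>
      hf m (by omega) (by omega) (by omega) (by omega)
    have hdig : s'.dig = s.dig := funext fun u =>
      hf _ (by omega) (by omega) (by omega) (by omega)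
    have hrho : s'.rho = s.rho := hsame.rho_eq h2
    refine (haltsIn_roundProg hload (fun i => by rw [hsame.pt_of_lt h2 i.2, hsite])
      (by rw [hdig]; exact hd)).mono le_rfl ?_
    rintro s'' ⟨hf', hsame', hseg', hguess'⟩
    rw [hrho, hdig] at hguess'
    have h2' : s''.nat 2 = s'.nat 2 := hf' 2 (by omega) (by omega) (by omega)
    have hpt : ∀ u, (s''.setNat 8 (i + 1)).pt u = s''.pt u := fun u =>
      Mem.pt_congr (by rw [Mem.setNat_nat, if_neg (by omega)]) fun m _ => rfl
    refine ⟨by rw [hf' 8 (by omega) (by omega) (by omega), h8'], ?_, fun m h1 h2 h3 h4 => ?_,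
      hsame.trans (s'' := s''.setNat 8 (i + 1)) hsame' h2 (fun _ h => h), fun _ j => ?_,
      fun t rank hg j hj => ?_⟩
    · rw [Mem.setNat_nat, if_neg (by omega), hf' 1 (by omega) (by omega) (by omega),
        hload.cell_k]
    · rw [Mem.setNat_nat, if_neg h2, hf' m h1 h3 h4, hf m h1 h2 h3 h4]
    · rw [hpt]; exact hseg' j
    · rw [hpt]; exact hguess' t rank hg i (hguess t rank hg) j hj
  · rw [h8, Nat.sub_zero]
  · rintro s' ⟨-, -, hf, hsame, hseg, hguess⟩
    exact ⟨hf, hsame, hseg (by omega), fun t rank hg hr j => hguess t rank hg j (hr j)⟩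

/-! ### The connectivity test -/

/-- Restore the labels of the fixed points and remove all marks. -/
def restoreProg : Prog :=
  .seq (assign 6 (.lit 0)) (forLoop 6 3 (.seq
    (.natSet (arr 32 (natCell 6)) (.cell (arr 33 (natCell 6))))
    (.natSet (arr 34 (natCell 6)) (.lit 0))))

theorem haltsIn_restoreProg (s : Mem) {N : ℕ} (hN : s.nat 3 = N) :
    HaltsIn restoreProg s (4 * N + 2) fun s' => s'.real = s.real ∧
      (∀ m, m ≠ 6 → (m < 32 ∨ m % 4 = 1 ∨ m % 4 = 3) → s'.nat m = s.nat m) ∧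
      (∀ u < N, s'.lab u = s.savedLab u) ∧ ∀ u < N, s'.mark u = 0 := by
  refine (HaltsIn.seq (B := 1) (B' := N * 4 + 1) (Prog.LoopFree.haltsIn (by trivial) le_rfl
    ?_)).mono (by omega) fun _ h => h
  set s₀ := (assign 6 (.lit 0)).run s with hs₀
  have hn₀ : ∀ m, s₀.nat m = if m = 6 then 0 else s.nat m := fun m => by
    rw [hs₀]; simp only [Prog.run, NatExp.eval, Mem.setNat_nat]
  have h6 : s₀.nat 6 = 0 := by rw [hn₀, if_pos rfl]
  refine (HaltsIn.forLoop (i := 6) (b := 3) (B := 2) (hi := N) (fun i s' => s'.real = s.real ∧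
      (∀ m, m ≠ 6 → (m < 32 ∨ m % 4 = 1 ∨ m % 4 = 3) → s'.nat m = s.nat m) ∧
      (∀ u < i, s'.lab u = s.savedLab u) ∧ ∀ u < i, s'.mark u = 0) ?_ ?_ ?_ ?_).mono ?_ ?_
  · rw [hn₀, if_neg (by omega), hN]
  · omega
  · rw [h6]
    exact ⟨rfl, fun m h1 _ => by rw [hn₀, if_neg h1], fun u hu => by omega,
      fun u hu => by omega⟩
  · rintro i s' hi h6' h3' ⟨hr, hf, hl, hm⟩
    refine Prog.LoopFree.haltsIn (by exact ⟨trivial, trivial⟩) le_rfl ?_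
    have e : ∀ m, m ≠ 6 → (((Prog.natSet (arr 32 (natCell 6)) (.cell (arr 33 (natCell 6)))).seq
        (.natSet (arr 34 (natCell 6)) (.lit 0))).run s').nat m =
        if m = 34 + 4 * i then 0 else if m = 32 + 4 * i then s.savedLab i else s'.nat m := by
      intro m hm6
      have : s'.nat (33 + 4 * i) = s.savedLab i := hf _ (by omega) (by omega)
      simp only [Prog.run, NatExp.eval, eval_arr, Mem.setNat_nat, h6']
      rw [if_neg (show (6 : ℕ) ≠ 32 + 4 * i by omega), this]
    set s₁ := ((Prog.natSet (arr 32 (natCell 6)) (.cell (arr 33 (natCell 6)))).seq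
        (.natSet (arr 34 (natCell 6)) (.lit 0))).run s' with hs₁
    have e6 : s₁.nat 6 = i := by
      rw [hs₁]
      simp only [Prog.run, NatExp.eval, eval_arr, Mem.setNat_nat]
      rw [if_neg (by omega), if_neg (by omega), h6']
    refine ⟨e6, ?_, hr, fun m h1 h2 => ?_, fun u hu => ?_, fun u hu => ?_⟩
    · rw [Mem.setNat_nat, if_neg (by omega), e 3 (by omega), if_neg (by omega), if_neg (by omega),
        h3']
    · rw [Mem.setNat_nat, if_neg h1, e m h1, if_neg (by omega), if_neg (by omega), hf m h1 h2]
    · rw [Mem.lab, Mem.setNat_nat, if_neg (by omega), e _ (by omega), if_neg (by omega)]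
      split_ifs with hui
      · rw [show u = i by omega]
      · exact hl u (by omega)
    · rw [Mem.mark, Mem.setNat_nat, if_neg (by omega), e _ (by omega)]
      split_ifs with hui hui
      · rfl
      · omega
      · exact hm u (by omega)
  · rw [h6, Nat.sub_zero]
  · exact fun s' hs' => hs'.2.2

/-- Set the flag in cell `9` if all labels agree. -/
def verifyProg : Prog :=
  .seq (.seq (assign 9 (.lit 1)) (assign 6 (.lit 0))) (forLoop 6 3
    (.ite (.and (.natLe (.cell (arr 32 (natCell 6))) (.cell (arr 32 (.lit 0))))
      (.natLe (.cell (arr 32 (.lit 0))) (.cell (arr 32 (natCell 6))))) .skip (assign 9 (.lit 0))))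

theorem haltsIn_verifyProg (s : Mem) {N : ℕ} (hN : s.nat 3 = N) :
    HaltsIn verifyProg s (4 * N + 3) fun s' => s'.real = s.real ∧
      (∀ m, m ≠ 6 → m ≠ 9 → s'.nat m = s.nat m) ∧ s'.nat 9 ≤ 1 ∧
      (s'.nat 9 = 1 ↔ ∀ u < N, s.lab u = s.lab 0) := by
  refine (HaltsIn.seq (B := 2) (B' := N * 4 + 1) (Prog.LoopFree.haltsIn
    (by exact ⟨trivial, trivial⟩) le_rfl ?_)).mono (by omega) fun _ h => h
  set s₀ := (Prog.seq (assign 9 (.lit 1)) (assign 6 (.lit 0))).run s with hs₀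
  have hn₀ : ∀ m, s₀.nat m = if m = 6 then 0 else if m = 9 then 1 else s.nat m := fun m => by
    rw [hs₀]; simp only [Prog.run, NatExp.eval, Mem.setNat_nat]
  have h6 : s₀.nat 6 = 0 := by rw [hn₀, if_pos rfl]
  refine (HaltsIn.forLoop (i := 6) (b := 3) (B := 2) (hi := N) (fun i s' => s'.real = s.real ∧
      (∀ m, m ≠ 6 → m ≠ 9 → s'.nat m = s.nat m) ∧ s'.nat 9 ≤ 1 ∧
      (s'.nat 9 = 1 ↔ ∀ u < i, s.lab u = s.lab 0)) ?_ ?_ ?_ ?_).mono ?_ ?_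
  · rw [hn₀, if_neg (by omega), if_neg (by omega), hN]
  · omega
  · rw [h6]
    refine ⟨rfl, fun m h1 h2 => by rw [hn₀, if_neg h1, if_neg h2], ?_, ?_⟩
    · rw [hn₀]; simp
    · rw [hn₀]; simp
  · rintro i s' hi h6' h3' ⟨hr, hf, h9, h9'⟩
    have hl : ∀ u, s'.nat (32 + 4 * u) = s.lab u := fun u => hf _ (by omega) (by omega)
    have hcond : (Test.and (.natLe (.cell (arr 32 (natCell 6))) (.cell (arr 32 (.lit 0))))
      (.natLe (.cell (arr 32 (.lit 0))) (.cell (arr 32 (natCell 6))))).Holds s' ↔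
        s.lab i = s.lab 0 := by
      simp only [Test.Holds, NatExp.eval, eval_arr, h6', hl]
      omega
    refine HaltsIn.ite (fun hb => ?_) (fun hb => ?_) <;>
      refine Prog.LoopFree.haltsIn (by trivial) le_rfl ?_ <;> rw [hcond] at hb <;>
      simp only [Prog.run, NatExp.eval]
    · refine ⟨h6', ?_, hr, fun m h1 h2 => ?_, ?_, ?_⟩
      · rw [Mem.setNat_nat, if_neg (by omega), h3']
      · rw [Mem.setNat_nat, if_neg h1, hf m h1 h2]
      · rw [Mem.setNat_nat, if_neg (by omega)]; exact h9
      · rw [Mem.setNat_nat, if_neg (by omega), h9']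
        refine ⟨fun h u hu => ?_, fun h u hu => h u (by omega)⟩
        rcases Nat.lt_succ_iff_lt_or_eq.1 hu with hu | rfl
        · exact h u hu
        · exact hb
    · refine ⟨?_, ?_, hr, fun m h1 h2 => ?_, ?_, ?_⟩
      · rw [Mem.setNat_nat, if_neg (by omega), h6']
      · rw [Mem.setNat_nat, if_neg (by omega), Mem.setNat_nat, if_neg (by omega), h3']
      · rw [Mem.setNat_nat, if_neg h1, Mem.setNat_nat, if_neg h2, hf m h1 h2]
      · rw [Mem.setNat_nat, if_neg (by omega), Mem.setNat_nat, if_pos rfl]; omega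
      · rw [Mem.setNat_nat, if_neg (by omega), Mem.setNat_nat, if_pos rfl]
        exact ⟨fun h => by omega, fun h => absurd (h i (by omega)) hb⟩
  · rw [h6, Nat.sub_zero]
  · exact fun s' hs' => hs'.2.2

theorem IsLabeling.connected_iff (hk : 1 ≤ k) {s : Mem} {lab mark : ℕ → ℕ} {α : ℝ}
    (hα : s.rho = 2 * α) (h : IsLabeling (n + k) s.Near (n + k) lab mark) :
    (∀ u < n + k, lab u = lab 0) ↔ (connectivityGraph (s.points n k) α).Connected := by
  have hne : Nonempty (Elt n k) := ⟨Sum.inr ⟨0, hk⟩⟩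
  have hadj : ∀ v w : Elt n k, v ≠ w →
      ((connectivityGraph (s.points n k) α).Adj v w ↔ s.Near (idx v) (idx w)) := fun v w hvw => by
    simp only [connectivityGraph, Mem.Near, Mem.points, hα]
    tauto
  constructor
  · intro hall
    refine SimpleGraph.Connected.mk fun v w => ?_
    have hpath := h.sound _ (idx_lt v) _ (idx_lt w)
      ((hall _ (idx_lt v)).trans (hall _ (idx_lt w)).symm)
    generalize hb : idx w = b at hpath
    induction hpath generalizing w with
    | refl => rw [idx_injective hb]
    | tail _ hstep ih =>
      -- A step of the relation may join an index to itself, which adjacency excludes; hence the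
      -- distinction of cases.
      obtain ⟨x, hx⟩ := exists_idx (n := n) (k := k) hstep.1
      have hvx := ih x hx
      rcases eq_or_ne x w with rfl | hxw
      · exact hvx
      · refine hvx.trans (SimpleGraph.Adj.reachable ((hadj x w hxw).2 ?_))
        rw [hx, hb]
        exact hstep.2.2
  · intro hc
    have hreach : ∀ v w : Elt n k, lab (idx v) = lab (idx w) := by
      intro v w
      obtain ⟨p⟩ := hc.preconnected v w
      induction p with
      | nil => rfl
      | cons hvw _ ih =>
        rw [← ih]
        exact h.complete _ (idx_lt _) _ (idx_lt _) ((hadj _ _ hvw.ne).1 hvw)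
    intro u hu
    obtain ⟨v, rfl⟩ := exists_idx hu
    obtain ⟨w, hw⟩ := exists_idx (n := n) (k := k) (u := 0) (by omega)
    rw [← hw]
    exact hreach v w

/-- The memory between two guesses. -/
structure Instance.Ready (I : Instance n k) (s : Mem) : Prop where
  loaded : I.Loaded s
  site : ∀ i : Fin n, s.pt i = I.site i
  saved : IsLabeling n s.Near n s.savedLab fun _ => 0
  digit : ∀ j : Fin k, s.dig j < 6 * (n + k)

theorem Instance.Ready.congr {I : Instance n k} {s s' : Mem} (h : I.Ready s)
    (hn : ∀ m < 5, s'.nat m = s.nat m) (hs : ∀ u, s'.savedLab u = s.savedLab u)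
    (hd : ∀ j : Fin k, s'.dig j < 6 * (n + k)) (hsame : s.SamePoints n s' (· < k)) :
    I.Ready s' where
  loaded := hsame.loaded h.loaded hn
  site i := by rw [hsame.pt_of_lt (hn 2 (by omega)) i.2, h.site]
  saved := by
    rw [show s'.savedLab = s.savedLab from funext hs]
    refine h.saved.congr fun u hu u' hu' => ?_
    have h2 := hn 2 (by omega)
    simp only [Mem.Near, hsame.pt_of_lt h2 hu, hsame.pt_of_lt h2 hu', hsame.rho_eq h2]
  digit := hd

/-- Evaluate the current guess and test whether the resulting points are connected. -/
def guessProg : Prog :=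
  .seq sweepProg <| .seq restoreProg <| .seq (assign 5 (natCell 0)) <|
    .seq (forLoop 5 3 insertProg) verifyProg

/-- Restoring the saved labelling of the fixed points leaves `k` insertions of cost `O(n + k)`. The
claims on the choice and on the flag hold for all digits and give soundness; the last claim gives
completeness. -/
theorem haltsIn_guessProg {I : Instance n k} {s : Mem} (hk : 1 ≤ k) (h : I.Ready s) {α : ℝ}
    (hα : s.rho = 2 * α) :
    HaltsIn guessProg s (100 * (k * (n + k))) fun s' => I.Ready s' ∧
      (∀ m, 10 ≤ m → m ≠ 11 → m ≠ 12 → m < 32 → s'.nat m = s.nat m) ∧ s'.dig = s.dig ∧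
      s.SamePoints n s' (· < k) ∧ s'.nat 9 ≤ 1 ∧
      (s'.nat 9 = 1 ↔ (connectivityGraph (s'.points n k) α).Connected) ∧
      I.IsChoice (s'.points n k) ∧
      ∀ t rank, I.IsGuess (2 * α) s.dig t rank → (∀ j, rank j < k) → s'.points n k = I.pos t := by
  have hcost : (k * (32 * k + 4) + 2) + ((4 * (n + k) + 2) + (1 + ((k * (8 * (n + k) + 7) + 1) +
      (4 * (n + k) + 3)))) ≤ 100 * (k * (n + k)) := by
    have h1 : n + k ≤ k * (n + k) := Nat.le_mul_of_pos_left _ hk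
    have h2 : k * k ≤ k * (n + k) := Nat.mul_le_mul_left _ (by omega)
    have h3 : k * (32 * k + 4) = 32 * (k * k) + 4 * k := by ring
    have h4 : k * (8 * (n + k) + 7) = 8 * (k * (n + k)) + 7 * k := by ring
    omega
  refine HaltsIn.mono (HaltsIn.seq ((haltsIn_sweepProg hk h.loaded h.site h.digit).mono le_rfl
    ?_)) hcost fun _ h => h
  rintro s₁ ⟨hf₁, hsame₁, hseg₁, hguess₁⟩
  have hready₁ : I.Ready s₁ := by
    refine h.congr (fun m hm => hf₁ m (by omega) (by omega) (by omega) (by omega))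
      (fun u => hf₁ _ (by omega) (by omega) (by omega) (by omega)) (fun j => ?_) hsame₁
    rw [Mem.dig, hf₁ _ (by omega) (by omega) (by omega) (by omega)]
    exact h.digit j
  have h2₁ : s₁.nat 2 = s.nat 2 := hf₁ 2 (by omega) (by omega) (by omega) (by omega)
  refine HaltsIn.seq ((haltsIn_restoreProg s₁ hready₁.loaded.cell_card).mono le_rfl ?_)
  rintro s₂ ⟨hr₂, hf₂, hl₂, hm₂⟩
  refine HaltsIn.seq (Prog.LoopFree.haltsIn (by trivial) le_rfl ?_)
  set s₃ := (assign 5 (natCell 0)).run s₂ with hs₃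
  have hn₃ : ∀ m, s₃.nat m = if m = 5 then s₂.nat 0 else s₂.nat m := fun m => by
    rw [hs₃]; simp only [Prog.run, NatExp.eval, Mem.setNat_nat]
  have h5₃ : s₃.nat 5 = n := by
    rw [hn₃, if_pos rfl, hf₂ 0 (by omega) (by omega), hready₁.loaded.cell_n]
  have hr₃ : s₃.real = s₁.real := hr₂
  have h2₃ : s₃.nat 2 = s₁.nat 2 := by rw [hn₃, if_neg (by omega), hf₂ 2 (by omega) (by omega)]
  have hnear₃ : s₃.Near = s₁.Near := Mem.near_congr h2₃ hr₃
  have h3₃ : s₃.nat 3 = n + k := by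
    rw [hn₃, if_neg (by omega), hf₂ 3 (by omega) (by omega), hready₁.loaded.cell_card]
  have hlab₃ : IsLabeling (n + k) s₃.Near (s₃.nat 5) s₃.lab s₃.mark := by
    rw [h5₃, hnear₃]
    refine hready₁.saved.reset (by omega) (fun u hu => ?_) (fun l hl => ?_)
    · rw [Mem.lab, hn₃, if_neg (by omega)]; exact hl₂ u (by omega)
    · rw [Mem.mark, hn₃, if_neg (by omega)]; exact hm₂ l hl
  have hloop := haltsIn_labelLoop s₃ (N := n + k) (b := 3) (by omega) h3₃ le_rfl (by omega) hlab₃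
  rw [h5₃, Nat.add_sub_cancel_left] at hloop
  refine HaltsIn.seq (hloop.mono le_rfl ?_)
  rintro s₄ ⟨hr₄, hf₄, hlab₄⟩
  have h3₄ : s₄.nat 3 = n + k := by rw [hf₄ 3 (by omega) (by omega) (by omega), h3₃]
  refine (haltsIn_verifyProg s₄ h3₄).mono le_rfl ?_
  rintro s₅ ⟨hr₅, hf₅, h9₅, hall₅⟩
  have hr : s₅.real = s₁.real := by rw [hr₅, hr₄, hr₃]
  have hn : ∀ m, m ≠ 5 → m ≠ 6 → m ≠ 9 → (m < 32 ∨ m % 4 = 1 ∨ m % 4 = 3) →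
      s₅.nat m = s₁.nat m := fun m h5 h6 h9 hm => by
    rw [hf₅ m h6 h9, hf₄ m h5 h6 hm, hn₃, if_neg h5, hf₂ m h6 hm]
  have h2₅ : s₅.nat 2 = s₁.nat 2 := hn 2 (by omega) (by omega) (by omega) (by omega)
  have hsame : s₁.SamePoints n s₅ (· < k) := fun m _ _ => by rw [hr]
  have hdig : ∀ u, s₅.dig u = s₁.dig u := fun u =>
    hn _ (by omega) (by omega) (by omega) (by omega)
  have hpts : ∀ u, s₅.pt u = s₁.pt u := fun u => by simp only [Mem.pt, h2₅, hr]
  have hsite : ∀ i : Fin n, s₁.pt i = I.site i := hready₁.site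
  refine ⟨hready₁.congr (fun m hm => hn m (by omega) (by omega) (by omega) (by omega))
    (fun u => hn _ (by omega) (by omega) (by omega) (by omega))
    (fun j => by rw [hdig]; exact hready₁.digit j) hsame, ?_, ?_,
    hsame₁.trans hsame h2₁ (fun _ h => h), h9₅, ?_, ?_, ?_⟩
  · intro m h10 h11 h12 h32
    rw [hn m (by omega) (by omega) (by omega) (by omega), hf₁ m (by omega) (by omega) h11 h12]
  · funext u
    rw [hdig, Mem.dig, hf₁ _ (by omega) (by omega) (by omega) (by omega)]; rfl
  · rw [hall₅]
    have hnear : s₅.Near = s₃.Near := by rw [Mem.near_congr h2₅ hr, hnear₃]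
    rw [← hnear] at hlab₄
    refine hlab₄.connected_iff hk ?_
    rw [hsame.rho_eq h2₅, hsame₁.rho_eq h2₁, hα]
  · rintro (i | j)
    · change s₅.pt i = I.site i
      rw [hpts, hsite]
    · obtain ⟨τ, hτ, hp⟩ := hseg₁ j
      change s₅.pt (n + j) ∈ segment ℝ (I.a j) (I.b j)
      rw [hpts, hp, segment_eq_image']
      exact ⟨τ, hτ, rfl⟩
  · intro t rank hg hrank
    rw [← hα] at hg
    funext v
    rcases v with i | j
    · change s₅.pt i = I.site i
      rw [hpts, hsite]
    · change s₅.pt (n + j) = _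
      rw [hpts]
      exact hguess₁ t rank hg hrank j

/-! ### Enumeration of the guesses -/

/-- The number with the `k` digits `d` in base `M`. -/
def digitValue (M k : ℕ) (d : ℕ → ℕ) : ℕ := ∑ j ∈ Finset.range k, d j * M ^ j

theorem digitValue_lt {M k : ℕ} {d : ℕ → ℕ} (h : ∀ j < k, d j < M) : digitValue M k d < M ^ k := by
  induction k with
  | zero => simp [digitValue]
  | succ k ih =>
    have h1 := ih fun j hj => h j (by omega)
    have h2 : (d k + 1) * M ^ k ≤ M * M ^ k := Nat.mul_le_mul_right _ (h k (by omega))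
    rw [digitValue, Finset.sum_range_succ, pow_succ]
    rw [add_mul] at h2
    unfold digitValue at h1
    linarith

theorem digitValue_inj {M k : ℕ} {d d' : ℕ → ℕ} (h : ∀ j < k, d j < M) (h' : ∀ j < k, d' j < M)
    (heq : digitValue M k d = digitValue M k d') : ∀ j < k, d j = d' j := by
  induction k with
  | zero => intro j hj; omega
  | succ k ih =>
    have h1 := digitValue_lt fun j (hj : j < k) => h j (by omega)
    have h1' := digitValue_lt fun j (hj : j < k) => h' j (by omega)
    have hs : digitValue M k d + d k * M ^ k = digitValue M k d' + d' k * M ^ k := by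
      simpa only [digitValue, Finset.sum_range_succ] using heq
    have hpos : 0 < M ^ k := by omega
    have hk : d k = d' k := by
      have := congrArg (· / M ^ k) hs
      simpa only [Nat.add_mul_div_right _ _ hpos, Nat.div_eq_of_lt h1, Nat.div_eq_of_lt h1',
        zero_add] using this
    rw [hk] at hs
    intro j hj
    rcases Nat.lt_succ_iff_lt_or_eq.1 hj with hj | rfl
    · exact ih (fun j hj => h j (by omega)) (fun j hj => h' j (by omega)) (by omega) j hj
    · exact hk

/-- Stated additively, since subtraction of natural numbers is truncated. -/
theorem digitValue_update {M k : ℕ} {d d' : ℕ → ℕ} {i : ℕ} (hi : i < k)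
    (h : ∀ j, j ≠ i → d' j = d j) :
    digitValue M k d' + d i * M ^ i = digitValue M k d + d' i * M ^ i := by
  have hmem := Finset.mem_range.2 hi
  have hsum : ∑ j ∈ (Finset.range k).erase i, d' j * M ^ j =
      ∑ j ∈ (Finset.range k).erase i, d j * M ^ j :=
    Finset.sum_congr rfl fun j hj => by rw [h j (Finset.ne_of_mem_erase hj)]
  rw [digitValue, digitValue, ← Finset.add_sum_erase _ _ hmem, ← Finset.add_sum_erase _ _ hmem,
    hsum]
  ring

/-- Replace maximal leading digits by zeros. -/
def carryBody : Prog :=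
  .seq (.natSet (arr 35 (natCell 13)) (.lit 0)) (assign 13 (.add (natCell 13) (.lit 1)))

/-- Proceed to the next guess; if there is none, set the flag in cell `10`. -/
def nextProg : Prog :=
  .seq (assign 13 (.lit 0)) <|
  .seq (.loop (.and (.not (.natLe (natCell 1) (natCell 13)))
    (.natLe (natCell 4) (.cell (arr 35 (natCell 13))))) carryBody) <|
  .ite (.natLe (natCell 1) (natCell 13)) (assign 10 (.lit 1))
    (.natSet (arr 35 (natCell 13)) (.add (.cell (arr 35 (natCell 13))) (.lit 1)))

theorem haltsIn_nextProg (s : Mem) {M : ℕ} (hk : s.nat 1 = k) (hM : s.nat 4 = M - 1)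
    (hd : ∀ j < k, s.dig j < M) (h10 : s.nat 10 = 0) :
    HaltsIn nextProg s (3 * k + 4) fun s' => s'.real = s.real ∧
      (∀ m, m ≠ 10 → m ≠ 13 → (m < 32 ∨ m % 4 ≠ 3) → s'.nat m = s.nat m) ∧
      (∀ j < k, s'.dig j < M) ∧
      ((s'.nat 10 = 0 ∧ digitValue M k s'.dig = digitValue M k s.dig + 1) ∨
        (s'.nat 10 = 1 ∧ digitValue M k s.dig + 1 = M ^ k)) := by
  refine HaltsIn.mono (HaltsIn.seq (B := 1) (B' := k * 3 + 1 + 2) (Prog.LoopFree.haltsIn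
    (by trivial) le_rfl ?_)) (by omega) fun _ h => h
  set s₀ := (assign 13 (.lit 0)).run s with hs₀
  have hn₀ : ∀ m, s₀.nat m = if m = 13 then 0 else s.nat m := fun m => by
    rw [hs₀]; simp only [Prog.run, NatExp.eval, Mem.setNat_nat]
  -- Odometer: once the first `i` digits have been found maximal and set to zero, a carry worth `M ^
  -- i` is pending, and value plus carry equals the old value plus one.
  refine HaltsIn.seq ((HaltsIn.loop (B := 2) (fun m s' => s'.nat 13 + m = k ∧ s'.real = s.real ∧
      (∀ m, m ≠ 13 → (m < 32 ∨ m % 4 ≠ 3) → s'.nat m = s.nat m) ∧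
      (∀ j < k, s'.dig j < M) ∧
      digitValue M k s'.dig + M ^ s'.nat 13 = digitValue M k s.dig + 1) ?_ k s₀ ?_).mono le_rfl ?_)
  · rintro m s' ⟨hm, hr, hf, hd', hv⟩ ⟨ht1, ht2⟩
    have h1 := hf 1 (by omega) (by omega)
    have h4 := hf 4 (by omega) (by omega)
    simp only [Test.Holds, NatExp.eval, h1, hk] at ht1
    simp only [Test.Holds, NatExp.eval, eval_arr, h4, hM] at ht2
    refine ⟨m - 1, by omega, Prog.LoopFree.haltsIn (by exact ⟨trivial, trivial⟩) le_rfl ?_⟩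
    set i := s'.nat 13 with hi
    have hn : ∀ m, (carryBody.run s').nat m =
        if m = 13 then i + 1 else if m = 35 + 4 * i then 0 else s'.nat m := fun m => by
      simp only [carryBody, Prog.run, NatExp.eval, eval_arr, Mem.setNat_nat]
      rw [if_neg (show (13 : ℕ) ≠ 35 + 4 * s'.nat 13 by omega)]
    have hdig : ∀ u, (carryBody.run s').dig u = if u = i then 0 else s'.dig u := fun u => by
      rw [Mem.dig, hn, if_neg (by omega)]
      exact if_congr (by omega) rfl rfl
    have hdi : s'.dig i = M - 1 := by
      have := hd' i (by omega)
      change M - 1 ≤ s'.dig i at ht2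
      omega
    refine ⟨by rw [hn, if_pos rfl]; omega, hr, fun m h1 h2 => ?_, fun j hj => ?_, ?_⟩
    · rw [hn, if_neg h1, if_neg (by omega), hf m h1 h2]
    · rw [hdig]
      have := hd' j hj
      split_ifs <;> omega
    · have hup := digitValue_update (M := M) (k := k) (d := s'.dig) (d' := (carryBody.run s').dig)
        (i := i) (by omega) fun j hj => by rw [hdig, if_neg hj]
      rw [hdig, if_pos rfl, hdi, zero_mul, add_zero] at hup
      rw [hn, if_pos rfl, pow_succ]
      have hMpos : 1 ≤ M := by have := hd' i (by omega); omega
      have : M ^ i * M = (M - 1) * M ^ i + M ^ i := by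
        obtain ⟨M, rfl⟩ : ∃ M', M = M' + 1 := ⟨M - 1, by omega⟩
        simp only [Nat.add_sub_cancel]; ring
      omega
  · refine ⟨by rw [hn₀, if_pos rfl, zero_add], rfl, fun m h1 _ => by rw [hn₀, if_neg h1],
      fun j hj => ?_, ?_⟩
    · rw [Mem.dig, hn₀, if_neg (by omega)]; exact hd j hj
    · have : s₀.dig = s.dig := funext fun u => by rw [Mem.dig, hn₀, if_neg (by omega)]; rfl
      rw [hn₀, if_pos rfl, pow_zero, this]
  · rintro s' ⟨hex, m, hm, hr, hf, hd', hv⟩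
    have h1 := hf 1 (by omega) (by omega)
    have h4 := hf 4 (by omega) (by omega)
    refine HaltsIn.ite (fun hb => ?_) (fun hb => ?_) <;>
      refine Prog.LoopFree.haltsIn (by trivial) le_rfl ?_ <;>
      simp only [Test.Holds, NatExp.eval, h1, hk] at hb
    · have hn : ∀ m, ((assign 10 (.lit 1)).run s').nat m = if m = 10 then 1 else s'.nat m :=
        fun m => by simp only [Prog.run, NatExp.eval, Mem.setNat_nat]
      refine ⟨hr, fun m h1 h2 h3 => by rw [hn, if_neg h1, hf m h2 h3], fun j hj => ?_,
        Or.inr ⟨by rw [hn, if_pos rfl], ?_⟩⟩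
      · rw [Mem.dig, hn, if_neg (by omega)]; exact hd' j hj
      · have h13 : s'.nat 13 = k := by omega
        have := digitValue_lt hd
        rw [h13] at hv
        omega
    · set i := s'.nat 13 with hi
      set c : Prog := .natSet (arr 35 (natCell 13)) (.add (.cell (arr 35 (natCell 13))) (.lit 1))
        with hc
      have hn : ∀ m, (c.run s').nat m = if m = 35 + 4 * i then s'.dig i + 1 else s'.nat m :=
        fun m => by simp only [hc, Prog.run, NatExp.eval, eval_arr, Mem.setNat_nat]; rfl
      have hlt : s'.dig i + 1 < M := by
        by_contra hcon
        have := hd' i (by omega)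
        refine hex ⟨?_, ?_⟩
        · simp only [Test.Holds, NatExp.eval, h1, hk]; omega
        · simp only [Test.Holds, NatExp.eval, eval_arr, h4, hM]
          change M - 1 ≤ s'.dig i
          omega
      have hdig : ∀ u, (c.run s').dig u = if u = i then s'.dig i + 1 else s'.dig u := fun u => by
        rw [Mem.dig, hn]
        exact if_congr (by omega) rfl rfl
      refine ⟨hr, fun m h1 h2 h3 => by rw [hn, if_neg (by omega), hf m h2 h3], fun j hj => ?_,
        Or.inl ⟨by rw [hn, if_neg (by omega), hf 10 (by omega) (by omega), h10], ?_⟩⟩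
      · rw [hdig]
        have := hd' j hj
        split_ifs <;> omega
      · have hup := digitValue_update (M := M) (k := k) (d := s'.dig) (d' := (c.run s').dig)
          (i := i) (by omega) fun j hj => by rw [hdig, if_neg hj]
        rw [hdig i, if_pos rfl, add_mul, one_mul] at hup
        omega

/-- The digits `code` lead to points that attain the radius `α`. -/
def Instance.GoodGuess (I : Instance n k) (α : ℝ) (code : ℕ → ℕ) : Prop :=
  ∃ t rank, I.IsGuess (2 * α) code t rank ∧ (∀ j, rank j < k) ∧
    (connectivityGraph (I.pos t) α).Connected

theorem Instance.GoodGuess.congr {I : Instance n k} {α : ℝ} {code code' : ℕ → ℕ}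
    (h : I.GoodGuess α code) (hc : ∀ j < k, code' j = code j) : I.GoodGuess α code' := by
  obtain ⟨t, rank, ⟨ht, rule, hrule⟩, h⟩ := h
  exact ⟨t, rank, ⟨ht, rule, fun j => ⟨by rw [hc j j.2, (hrule j).1], (hrule j).2⟩⟩, h⟩

/-- The interface between geometry and enumeration: the rules that determine the points are turned
into digits. -/
theorem Instance.Feasible.exists_goodGuess {I : Instance n k} (hk : 1 ≤ k)
    (hI : I.GeneralPosition) {α : ℝ} (h : I.Feasible α) :
    ∃ code, (∀ j < k, code j < 6 * (n + k)) ∧ I.GoodGuess α code := by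
  obtain ⟨t, ht, hc, rank, rule, hr⟩ := h.exists_determined hI
  refine ⟨fun j => if hj : j < k then (rule ⟨j, hj⟩).code else 0, fun j hj => ?_, t, rank,
    ⟨ht, rule, fun j => ⟨?_, (hr j (Finset.mem_univ j)).2.1, fun c hc =>
      ((hr j (Finset.mem_univ j)).2.2 c hc).2⟩⟩, fun j => ?_, hc⟩
  · simp only [hj, dif_pos]; exact Rule.code_lt hk _
  · simp
  · simpa using (hr j (Finset.mem_univ j)).1

/-- Test all guesses. -/
def searchProg : Prog :=
  .loop (.and (.natLe (natCell 9) (.lit 0)) (.natLe (natCell 10) (.lit 0)))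
    (.seq guessProg (.ite (.natLe (natCell 9) (.lit 0)) nextProg .skip))

/-- The value of the digits serves as counter: all digit sequences of smaller value have failed, and
by `digitValue_inj` none is skipped. If the guesses run out, none was good, so the radius is
infeasible. -/
theorem haltsIn_searchProg {I : Instance n k} (hI : I.GeneralPosition) {s : Mem} (hk : 1 ≤ k)
    (h : I.Ready s) {α : ℝ} (hα : s.rho = 2 * α) (h9 : s.nat 9 = 0) (h10 : s.nat 10 = 0)
    (hdig : ∀ j < k, s.dig j = 0) :
    HaltsIn searchProg s ((6 * (n + k)) ^ k * (110 * (k * (n + k))) + 1) fun s' =>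
      I.Loaded s' ∧ (∀ m, 14 ≤ m → m < 32 → s'.nat m = s.nat m) ∧ s.SamePoints n s' (· < k) ∧
      s'.nat 9 ≤ 1 ∧ (s'.nat 9 = 1 → I.IsChoice (s'.points n k) ∧
        (connectivityGraph (s'.points n k) α).Connected) ∧ (I.Feasible α → s'.nat 9 = 1) := by
  set M := 6 * (n + k) with hMdef
  have hpos : 1 ≤ k * (n + k) := Nat.mul_pos hk (by omega)
  have hkN : k ≤ k * (n + k) := Nat.le_mul_of_pos_right _ (by omega)
  refine HaltsIn.mono (HaltsIn.loop (B := 109 * (k * (n + k))) (fun m s' => I.Ready s' ∧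
      (∀ m, 14 ≤ m → m < 32 → s'.nat m = s.nat m) ∧ s.SamePoints n s' (· < k) ∧
      s'.nat 9 ≤ 1 ∧ s'.nat 10 ≤ 1 ∧ (s'.nat 9 = 1 → I.IsChoice (s'.points n k) ∧
        (connectivityGraph (s'.points n k) α).Connected) ∧
      (s'.nat 9 = 0 → s'.nat 10 = 0 → digitValue M k s'.dig + m = M ^ k ∧
        ∀ code, (∀ j < k, code j < M) → digitValue M k code < digitValue M k s'.dig →
          ¬ I.GoodGuess α code) ∧
      (s'.nat 9 = 0 → s'.nat 10 = 1 → ∀ code, (∀ j < k, code j < M) → ¬ I.GoodGuess α code))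
      ?_ (M ^ k) s ?_) ?_ ?_
  · rintro m s' ⟨hready, hf, hsame, h9', h10', hgood, hrun, hend⟩ ⟨ht9, ht10⟩
    simp only [Test.Holds, NatExp.eval] at ht9 ht10
    have h9z : s'.nat 9 = 0 := by omega
    have h10z : s'.nat 10 = 0 := by omega
    obtain ⟨hval, hbad⟩ := hrun h9z h10z
    have hd : ∀ j < k, s'.dig j < M := fun j hj => hready.digit ⟨j, hj⟩
    have hlt := digitValue_lt hd
    have h2 : s'.nat 2 = s.nat 2 := by rw [hready.loaded.cell_base, h.loaded.cell_base]
    refine ⟨m - 1, by omega, HaltsIn.mono (HaltsIn.seq (B' := 3 * k + 5) ((haltsIn_guessProg hk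
      hready (by rw [hsame.rho_eq h2, hα])).mono le_rfl ?_)) (by omega) fun _ h => h⟩
    rintro s₁ ⟨hready₁, hf₁, hdig₁, hsame₁, h9₁, hcon₁, hch₁, hg₁⟩
    have h2₁ : s₁.nat 2 = s'.nat 2 := by
      rw [hready.loaded.cell_base, hready₁.loaded.cell_base]
    have h10₁ : s₁.nat 10 = 0 := by
      rw [hf₁ 10 (by omega) (by omega) (by omega) (by omega), h10z]
    have hsame' : s.SamePoints n s₁ (· < k) := hsame.trans hsame₁ h2 (fun _ h => h)
    refine HaltsIn.ite (fun hb => ?_) (fun hb => ?_) <;>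
      simp only [Test.Holds, NatExp.eval] at hb
    · have hnot : ¬ I.GoodGuess α s'.dig := by
        rintro ⟨t, rank, hg, hrank, hc⟩
        rw [← hg₁ t rank hg hrank, ← hcon₁] at hc
        omega
      refine (haltsIn_nextProg s₁ hready₁.loaded.cell_k hready₁.loaded.cell_radix
        (fun j hj => hready₁.digit ⟨j, hj⟩) h10₁).mono le_rfl ?_
      rintro s₂ ⟨hr₂, hf₂, hd₂, hval₂⟩
      have hsame₂ : s₁.SamePoints n s₂ (· < k) := fun m _ _ => by rw [hr₂]
      have h9₂ : s₂.nat 9 = 0 := by rw [hf₂ 9 (by omega) (by omega) (by omega)]; omega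
      rw [hdig₁, ← hMdef] at hval₂
      have hall : ∀ code, (∀ j < k, code j < M) →
          digitValue M k code < digitValue M k s'.dig + 1 → ¬ I.GoodGuess α code := by
        intro code hcode hle hg
        rcases Nat.lt_succ_iff_lt_or_eq.1 hle with hlt | heq
        · exact hbad code hcode hlt hg
        · exact hnot (hg.congr fun j hj => (digitValue_inj hcode hd heq j hj).symm)
      refine ⟨hready₁.congr (fun m hm => hf₂ m (by omega) (by omega) (by omega))
        (fun u => hf₂ _ (by omega) (by omega) (by omega)) (fun j => hd₂ j j.2) hsame₂,
        fun m h14 h32 => ?_, hsame'.trans hsame₂ (h2₁.trans h2) (fun _ h => h), by omega,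
        by omega, fun h => by omega, fun _ h0 => ?_, fun _ h1 code hcode => ?_⟩
      · rw [hf₂ m (by omega) (by omega) (by omega),
          hf₁ m (by omega) (by omega) (by omega) (by omega), hf m h14 h32]
      · rcases hval₂ with ⟨-, hv⟩ | ⟨hv, -⟩
        · refine ⟨by omega, fun code hcode hlt => hall code hcode (by omega)⟩
        · omega
      · rcases hval₂ with ⟨hv, -⟩ | ⟨-, hv⟩
        · omega
        · exact hall code hcode (by rw [hv]; exact digitValue_lt hcode)
    · refine Prog.LoopFree.haltsIn (by trivial) (by simp only [Prog.cost]; omega) ?_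
      simp only [Prog.run]
      have h91 : s₁.nat 9 = 1 := by omega
      refine ⟨hready₁, fun m h14 h32 => ?_, hsame', h9₁, by omega,
        fun _ => ⟨hch₁, hcon₁.1 h91⟩, fun h => by omega, fun h => by omega⟩
      rw [hf₁ m (by omega) (by omega) (by omega) (by omega), hf m h14 h32]
  · have hv0 : digitValue M k s.dig = 0 :=
      Finset.sum_eq_zero fun j hj => by rw [hdig j (Finset.mem_range.1 hj), zero_mul]
    refine ⟨h, fun m _ _ => rfl, fun m _ _ => rfl, by omega, by omega, fun h => by omega,
      fun _ _ => ⟨by rw [hv0, zero_add], fun code _ hlt => by omega⟩, fun _ h => by omega⟩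
  · have := Nat.mul_le_mul_left (M ^ k) (show 109 * (k * (n + k)) + 1 ≤ 110 * (k * (n + k)) by
      omega)
    omega
  · rintro s' ⟨hex, m, hready, hf, hsame, h9', h10', hgood, hrun, hend⟩
    refine ⟨hready.loaded, hf, hsame, h9', hgood, fun hfeas => ?_⟩
    by_contra hne
    have h9z : s'.nat 9 = 0 := by omega
    have h10o : s'.nat 10 = 1 := by
      by_contra hne'
      refine hex ⟨?_, ?_⟩ <;> simp only [Test.Holds, NatExp.eval] <;> omega
    obtain ⟨code, hcode, hg⟩ := hfeas.exists_goodGuess hk hI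
    exact hend h9z h10o code hcode hg

/-! ### The decision procedure -/

/-- Fill an array. -/
def fillProg (i b c : ℕ) (f : NatExp) : Prog :=
  .seq (assign i (.lit 0)) (forLoop i b (.natSet (arr c (natCell i)) f))

/-- The entry may be read from memory, provided that it does not depend on the array being filled;
this is the purpose of the quantification over memories. -/
theorem haltsIn_fillProg (s : Mem) {i b c hi : ℕ} {f : NatExp} (g : ℕ → ℕ) (hi32 : i < 32)
    (hb32 : b < 32) (hib : b ≠ i) (hc : 32 ≤ c) (hb : s.nat b = hi)
    (hf : ∀ s' : Mem, (∀ m, m ≠ i → (m < 32 ∨ m % 4 ≠ c % 4) → s'.nat m = s.nat m) →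
      f.eval s' = g (s'.nat i)) :
    HaltsIn (fillProg i b c f) s (3 * hi + 2) fun s' => s'.real = s.real ∧
      (∀ m, m ≠ i → (m < 32 ∨ m % 4 ≠ c % 4) → s'.nat m = s.nat m) ∧
      ∀ u < hi, s'.nat (c + 4 * u) = g u := by
  refine (HaltsIn.seq (B := 1) (B' := hi * 3 + 1) (Prog.LoopFree.haltsIn (by trivial) le_rfl
    ?_)).mono (by omega) fun _ h => h
  set s₀ := (assign i (.lit 0)).run s with hs₀
  have hn₀ : ∀ m, s₀.nat m = if m = i then 0 else s.nat m := fun m => by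
    rw [hs₀]; simp only [Prog.run, NatExp.eval, Mem.setNat_nat]
  have h0 : s₀.nat i = 0 := by rw [hn₀, if_pos rfl]
  refine (HaltsIn.forLoop (i := i) (b := b) (B := 1) (hi := hi) (fun v s' => s'.real = s.real ∧
      (∀ m, m ≠ i → (m < 32 ∨ m % 4 ≠ c % 4) → s'.nat m = s.nat m) ∧
      ∀ u < v, s'.nat (c + 4 * u) = g u) ?_ ?_ ?_ ?_).mono ?_ ?_
  · rw [hn₀, if_neg hib, hb]
  · omega
  · rw [h0]
    exact ⟨rfl, fun m h1 _ => by rw [hn₀, if_neg h1], fun u hu => by omega⟩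
  · rintro v s' hv hi' hb' ⟨hr, hfr, hg⟩
    refine Prog.LoopFree.haltsIn (by trivial) le_rfl ?_
    have hn : ∀ m, ((Prog.natSet (arr c (natCell i)) f).run s').nat m =
        if m = c + 4 * v then g v else s'.nat m := fun m => by
      simp only [Prog.run, NatExp.eval, eval_arr, Mem.setNat_nat, hf s' hfr, hi']
    refine ⟨by rw [hn, if_neg (by omega), hi'], ?_, hr, fun m h1 h2 => ?_, fun u hu => ?_⟩
    · rw [Mem.setNat_nat, if_neg hib, hn, if_neg (by omega), hb']
    · rw [Mem.setNat_nat, if_neg h1, hn, if_neg (by omega), hfr m h1 h2]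
    · rw [Mem.setNat_nat, if_neg (by omega), hn]
      split_ifs with h
      · rw [show u = v by omega]
      · exact hg u (by omega)
  · rw [h0, Nat.sub_zero]
  · exact fun s' hs' => hs'.2.2

/-- Copy the coordinates of one fixed point. -/
def copyBody : Prog :=
  .seq (.realSet (ptX (natCell 6)) (.cell (.add (natCell 6) (natCell 6))))
    (.realSet (ptY (natCell 6)) (.cell (.add (.add (natCell 6) (natCell 6)) (.lit 1))))

/-- Compute the threshold for the distances and copy the fixed points. -/
def copyProg : Prog :=
  .seq (.seq (.realSet (var 1) (.add (rv 0) (rv 0))) (assign 6 (.lit 0))) (forLoop 6 0 copyBody)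

theorem haltsIn_copyProg {I : Instance n k} {s : Mem} (h : I.Loaded s) :
    HaltsIn copyProg s (4 * n + 3) fun s' => (∀ m, m ≠ 6 → s'.nat m = s.nat m) ∧
      (∀ m, m ≤ s.nat 2 ∨ (s.nat 2 + 2 ≤ m ∧ m < s.nat 2 + 32) → s'.real m = s.real m) ∧
      s'.rho = 2 * s.real (s.nat 2) ∧ ∀ i : Fin n, s'.pt i = I.site i := by
  refine (HaltsIn.seq (B := 2) (B' := n * 4 + 1) (Prog.LoopFree.haltsIn
    (by exact ⟨trivial, trivial⟩) le_rfl ?_)).mono (by omega) fun _ h => h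
  set s₀ := (Prog.seq (.realSet (var 1) (.add (rv 0) (rv 0))) (assign 6 (.lit 0))).run s with hs₀
  have hn₀ : ∀ m, s₀.nat m = if m = 6 then 0 else s.nat m := fun m => by
    rw [hs₀]; simp only [Prog.run, NatExp.eval, Mem.setNat_nat, Mem.setReal_nat]
  have hr₀ : ∀ m, s₀.real m = if m = s.nat 2 + 1 then 2 * s.real (s.nat 2) else s.real m := by
    intro m
    rw [hs₀, two_mul]
    simp only [Prog.run, RealExp.eval, eval_var, Mem.setNat_real, Mem.setReal_real, add_zero]
  have h6 : s₀.nat 6 = 0 := by rw [hn₀, if_pos rfl]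
  have hw := h.cell_base
  refine (HaltsIn.forLoop (i := 6) (b := 0) (body := copyBody) (B := 2) (hi := n)
    (fun i s' => (∀ m, m ≠ 6 → s'.nat m = s.nat m) ∧
      (∀ m, m ≤ s.nat 2 ∨ (s.nat 2 + 2 ≤ m ∧ m < s.nat 2 + 32) → s'.real m = s.real m) ∧
      s'.real (s.nat 2 + 1) = 2 * s.real (s.nat 2) ∧
      ∀ j : Fin n, (j : ℕ) < i → s'.real (s.nat 2 + 32 + 2 * j) = I.site j 0 ∧
        s'.real (s.nat 2 + 33 + 2 * j) = I.site j 1) ?_ ?_ ?_ ?_).mono ?_ ?_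
  · rw [hn₀, if_neg (by omega), h.cell_n]
  · omega
  · rw [h6]
    exact ⟨fun m h1 => by rw [hn₀, if_neg h1], fun m hm => by rw [hr₀, if_neg (by omega)],
      by rw [hr₀, if_pos rfl], fun j hj => by omega⟩
  · rintro i s' hi h6' h0' ⟨hf, hr, hrho, hpt⟩
    refine Prog.LoopFree.haltsIn (by exact ⟨trivial, trivial⟩) le_rfl ?_
    have h2 : s'.nat 2 = s.nat 2 := hf 2 (by omega)
    have hx : s'.real (i + i) = I.site ⟨i, hi⟩ 0 := by
      rw [hr _ (by omega), ← h.site_fst ⟨i, hi⟩, two_mul]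
    have hy : s'.real (i + i + 1) = I.site ⟨i, hi⟩ 1 := by
      rw [hr _ (by omega), ← h.site_snd ⟨i, hi⟩, two_mul]
    have hreal : ∀ m, (copyBody.run s').real m = if m = s.nat 2 + 33 + 2 * i then
        I.site ⟨i, hi⟩ 1 else if m = s.nat 2 + 32 + 2 * i then I.site ⟨i, hi⟩ 0
        else s'.real m := fun m => by
      simp only [copyBody, Prog.run, RealExp.eval, NatExp.eval, eval_ptX, eval_ptY,
        Mem.setReal_real, Mem.setReal_nat, h6', h2, hx]
      rw [if_neg (show i + i + 1 ≠ s.nat 2 + 32 + 2 * i by omega), hy]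
    have hnat : (copyBody.run s').nat = s'.nat := rfl
    refine ⟨by rw [hnat, h6'], ?_, fun m h1 => ?_, fun m hm => ?_, ?_, fun j hj => ?_⟩
    · rw [Mem.setNat_nat, if_neg (by omega), hnat, h0']
    · rw [Mem.setNat_nat, if_neg h1, hnat, hf m h1]
    · rw [Mem.setNat_real, hreal, if_neg (by omega), if_neg (by omega), hr m hm]
    · rw [Mem.setNat_real, hreal, if_neg (by omega), if_neg (by omega), hrho]
    · rw [Mem.setNat_real, hreal, hreal]
      by_cases hji : (j : ℕ) = i
      · obtain rfl : j = ⟨i, hi⟩ := Fin.ext hji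
        exact ⟨by rw [if_neg (by simp only; omega), if_pos rfl], by rw [if_pos rfl]⟩
      · rw [if_neg (by omega), if_neg (by omega), if_neg (by omega), if_neg (by omega)]
        exact hpt j (by omega)
  · rw [h6, Nat.sub_zero]
  · rintro s' ⟨-, -, hf, hr, hrho, hpt⟩
    have h2 : s'.nat 2 = s.nat 2 := hf 2 (by omega)
    refine ⟨hf, hr, by rw [Mem.rho, h2, hrho], fun i => ?_⟩
    rw [Mem.pt, h2, (hpt i i.2).1, (hpt i i.2).2]
    ext l
    fin_cases l <;> rfl

/-- Label the components of the fixed points and prepare the first guess. -/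
def prepareProg : Prog :=
  .seq copyProg <| .seq restoreProg <| .seq (.seq (assign 5 (.lit 0)) (assign 9 (.lit 0))) <|
  .seq (forLoop 5 0 insertProg) <|
  .seq (fillProg 6 0 33 (.cell (arr 32 (natCell 6)))) <|
  .seq (fillProg 7 1 35 (.lit 0)) (assign 10 (.lit 0))

/-- The quadratic cost of labelling the fixed points is paid once per radius and not once per guess.
-/
theorem haltsIn_prepareProg {I : Instance n k} {s : Mem} (hk : 1 ≤ k) (h : I.Loaded s) :
    HaltsIn prepareProg s (40 * ((n + k) * (n + k))) fun s' => I.Ready s' ∧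
      (∀ m, 14 ≤ m → m < 32 → s'.nat m = s.nat m) ∧
      (∀ m, m ≤ s.nat 2 ∨ (s.nat 2 + 2 ≤ m ∧ m < s.nat 2 + 32) → s'.real m = s.real m) ∧
      s'.rho = 2 * s.real (s.nat 2) ∧ s'.nat 9 = 0 ∧ s'.nat 10 = 0 ∧ ∀ j < k, s'.dig j = 0 := by
  have hcost : (4 * n + 3) + ((4 * (n + k) + 2) + (2 + ((n * (8 * n + 7) + 1) + ((3 * n + 2) +
      ((3 * k + 2) + 1))))) ≤ 40 * ((n + k) * (n + k)) := by
    have h1 : n + k ≤ (n + k) * (n + k) := Nat.le_mul_of_pos_left _ (by omega)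
    have h2 : n * n ≤ (n + k) * (n + k) := Nat.mul_le_mul (by omega) (by omega)
    have h3 : n * (8 * n + 7) = 8 * (n * n) + 7 * n := by ring
    omega
  refine HaltsIn.mono (HaltsIn.seq ((haltsIn_copyProg h).mono le_rfl ?_)) hcost fun _ h => h
  rintro s₁ ⟨hf₁, hr₁, hrho₁, hpt₁⟩
  have h2₁ : s₁.nat 2 = s.nat 2 := hf₁ 2 (by omega)
  have hload₁ : I.Loaded s₁ := h.congr (fun m hm => hf₁ m (by omega)) fun m hm =>
    hr₁ m (by rw [h.cell_base]; omega)
  -- Only the erasure of the marks matters here; the labels copied are overwritten or never read.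
  refine HaltsIn.seq ((haltsIn_restoreProg s₁ hload₁.cell_card).mono le_rfl ?_)
  rintro s₂ ⟨hr₂, hf₂, -, hm₂⟩
  refine HaltsIn.seq (Prog.LoopFree.haltsIn (by exact ⟨trivial, trivial⟩) le_rfl ?_)
  set s₃ := (Prog.seq (assign 5 (.lit 0)) (assign 9 (.lit 0))).run s₂ with hs₃
  have hn₃ : ∀ m, s₃.nat m = if m = 9 then 0 else if m = 5 then 0 else s₂.nat m := fun m => by
    rw [hs₃]; simp only [Prog.run, NatExp.eval, Mem.setNat_nat]
  have h5₃ : s₃.nat 5 = 0 := by rw [hn₃]; simp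
  have h0₃ : s₃.nat 0 = n := by
    rw [hn₃, if_neg (by omega), if_neg (by omega), hf₂ 0 (by omega) (by omega), hload₁.cell_n]
  have hr₃ : s₃.real = s₁.real := hr₂
  have h2₃ : s₃.nat 2 = s₁.nat 2 := by
    rw [hn₃, if_neg (by omega), if_neg (by omega), hf₂ 2 (by omega) (by omega)]
  have hlab₃ : IsLabeling (n + k) s₃.Near (s₃.nat 5) s₃.lab s₃.mark := by
    rw [h5₃]
    refine ⟨fun u hu => by omega, fun u hu => by omega, fun u hu => by omega,
      fun u hu => by omega, fun l _ hl => ?_⟩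
    rw [Mem.mark, hn₃, if_neg (by omega), if_neg (by omega)]
    exact hm₂ l hl
  have hloop := haltsIn_labelLoop s₃ (N := n + k) (b := 0) (by omega) h0₃ (by omega) (by omega)
    hlab₃
  rw [h5₃, Nat.sub_zero] at hloop
  refine HaltsIn.seq (hloop.mono le_rfl ?_)
  rintro s₄ ⟨hr₄, hf₄, hlab₄⟩
  have h0₄ : s₄.nat 0 = n := by rw [hf₄ 0 (by omega) (by omega) (by omega), h0₃]
  refine HaltsIn.seq ((haltsIn_fillProg s₄ (g := s₄.lab) (by omega) (by omega) (by omega)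
    (by omega) h0₄ ?_).mono le_rfl ?_)
  · intro s' hs'
    simp only [NatExp.eval, eval_arr]
    exact hs' _ (by omega) (by omega)
  rintro s₅ ⟨hr₅, hf₅, hg₅⟩
  have h1₅ : s₅.nat 1 = k := by
    rw [hf₅ 1 (by omega) (by omega), hf₄ 1 (by omega) (by omega) (by omega), hn₃,
      if_neg (by omega), if_neg (by omega), hf₂ 1 (by omega) (by omega), hload₁.cell_k]
  refine HaltsIn.seq ((haltsIn_fillProg s₅ (g := fun _ => 0) (by omega) (by omega) (by omega)
    (by omega) h1₅ (fun s' _ => rfl)).mono le_rfl ?_)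
  rintro s₆ ⟨hr₆, hf₆, hg₆⟩
  refine Prog.LoopFree.haltsIn (by trivial) le_rfl ?_
  set s₇ := (assign 10 (.lit 0)).run s₆ with hs₇
  have hn₇ : ∀ m, s₇.nat m = if m = 10 then 0 else s₆.nat m := fun m => by
    rw [hs₇]; simp only [Prog.run, NatExp.eval, Mem.setNat_nat]
  have hn : ∀ m, m ≠ 5 → m ≠ 6 → m ≠ 7 → m ≠ 9 → m ≠ 10 → m < 32 → s₇.nat m = s₁.nat m := by
    intro m h5 h6 h7 h9 h10 h32
    rw [hn₇, if_neg h10, hf₆ m h7 (by omega), hf₅ m h6 (by omega), hf₄ m h5 h6 (by omega), hn₃,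
      if_neg h9, if_neg h5, hf₂ m h6 (by omega)]
  have hr : s₇.real = s₁.real := by
    change s₆.real = _
    rw [hr₆, hr₅, hr₄, hr₃]
  have h2₇ : s₇.nat 2 = s₁.nat 2 :=
    hn 2 (by omega) (by omega) (by omega) (by omega) (by omega) (by omega)
  have hdig : ∀ j < k, s₇.dig j = 0 := fun j hj => by
    rw [Mem.dig, hn₇, if_neg (by omega)]
    exact hg₆ j hj
  refine ⟨⟨hload₁.congr (fun m hm => hn m (by omega) (by omega) (by omega) (by omega) (by omega)
    (by omega)) fun m _ => by rw [hr], fun i => ?_, ?_, fun j => ?_⟩, fun m h14 h32 => ?_,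
    fun m hm => ?_, ?_, ?_, ?_, hdig⟩
  · rw [← hpt₁ i]
    exact Mem.pt_congr h2₇ fun m _ => by rw [hr]
  · have hnear : s₇.Near = s₃.Near := by
      rw [Mem.near_congr h2₇ hr, Mem.near_congr h2₃ hr₃]
    rw [hnear]
    refine hlab₄.reset le_rfl (fun u hu => ?_) fun _ _ => rfl
    rw [Mem.savedLab, hn₇, if_neg (by omega), hf₆ _ (by omega) (by omega)]
    exact hg₅ u hu
  · rw [hdig j j.2]; omega
  · rw [hn m (by omega) (by omega) (by omega) (by omega) (by omega) h32, hf₁ m (by omega)]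
  · rw [hr, hr₁ m hm]
  · rw [← hrho₁, Mem.rho, Mem.rho, h2₇, hr]
  · rw [hn₇, if_neg (by omega), hf₆ 9 (by omega) (by omega), hf₅ 9 (by omega) (by omega),
      hf₄ 9 (by omega) (by omega) (by omega), hn₃, if_pos rfl]
  · rw [hn₇, if_pos rfl]

/-- Decide whether the radius in variable `0` is feasible. -/
def decideProg : Prog := .seq prepareProg searchProg

/-- A bound for the running time of the decision procedure. -/
def decideCost (n k : ℕ) : ℕ := 160 * (k * (n + k) * (6 * (n + k)) ^ k)

/-- The frame conditions protect the tested radius and the cells in which the bisection keeps its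
state. -/
theorem haltsIn_decideProg {I : Instance n k} (hI : I.GeneralPosition) {s : Mem} (hk : 1 ≤ k)
    (h : I.Loaded s) {α : ℝ} (hα : s.real (s.nat 2) = α) :
    HaltsIn decideProg s (decideCost n k) fun s' => I.Loaded s' ∧
      (∀ m, 14 ≤ m → m < 32 → s'.nat m = s.nat m) ∧
      (∀ m, m ≤ s.nat 2 ∨ (s.nat 2 + 13 ≤ m ∧ m < s.nat 2 + 32) → s'.real m = s.real m) ∧
      s'.nat 9 ≤ 1 ∧ (s'.nat 9 = 1 → I.IsChoice (s'.points n k) ∧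
        (connectivityGraph (s'.points n k) α).Connected) ∧ (I.Feasible α → s'.nat 9 = 1) := by
  have hcost : 40 * ((n + k) * (n + k)) + ((6 * (n + k)) ^ k * (110 * (k * (n + k))) + 1) ≤
      decideCost n k := by
    have h1 : n + k ≤ (6 * (n + k)) ^ k :=
      (show n + k ≤ 6 * (n + k) by omega).trans (Nat.le_self_pow (by omega) _)
    have h2 : (n + k) * (n + k) ≤ k * (n + k) * (6 * (n + k)) ^ k :=
      Nat.mul_le_mul (Nat.le_mul_of_pos_left _ hk) h1
    have h3 : 1 ≤ (n + k) * (n + k) := Nat.mul_pos (by omega) (by omega)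
    have h4 : (6 * (n + k)) ^ k * (110 * (k * (n + k))) =
        110 * (k * (n + k) * (6 * (n + k)) ^ k) := by ring
    rw [decideCost]
    omega
  refine HaltsIn.mono (HaltsIn.seq ((haltsIn_prepareProg hk h).mono le_rfl ?_)) hcost fun _ h => h
  rintro s₁ ⟨hready, hf, hr, hrho, h9, h10, hdig⟩
  refine (haltsIn_searchProg hI hk hready (α := α) (by rw [hrho, hα]) h9 h10 hdig).mono le_rfl ?_
  rintro s₂ ⟨hload₂, hf₂, hsame, h9₂, hgood, hfeas⟩
  have h2 : s₁.nat 2 = s.nat 2 := by rw [hready.loaded.cell_base, h.cell_base]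
  refine ⟨hload₂, fun m h14 h32 => by rw [hf₂ m h14 h32, hf m h14 h32], fun m hm => ?_, h9₂,
    hgood, hfeas⟩
  rw [hsame m (by omega) (fun j _ => by omega), hr m (by omega)]

/-! ### Input and output -/

theorem getElem?_flatten_of_length {β : Type*} (c : ℕ) (L : List (List β))
    (hL : ∀ l ∈ L, l.length = c) (i r : ℕ) (hr : r < c) (hi : i < L.length) :
    L.flatten[c * i + r]? = L[i][r]? := by
  induction L generalizing i with
  | nil => simp at hi
  | cons l L ih =>
    have hl : l.length = c := hL l (by simp)
    cases i with
    | zero =>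
      simp only [List.flatten_cons, mul_zero, zero_add, List.getElem_cons_zero]
      rw [List.getElem?_append_left (by omega)]
    | succ i =>
      simp only [List.flatten_cons, List.getElem_cons_succ]
      rw [List.getElem?_append_right (by rw [hl, mul_add]; omega), hl,
        show c * (i + 1) + r - c = c * i + r by rw [mul_add]; omega]
      exact ih (fun l hl => hL l (by simp [hl])) i (by simpa using hi)

theorem Instance.input_site (I : Instance n k) (extra : List ℝ) (i : Fin n) (r : Fin 2) :
    (I.input extra).real (2 * i + r) = I.site i r := by
  have hlen : (List.ofFn fun i => [I.site i 0, I.site i 1]).flatten.length = 2 * n := by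
    simp [List.length_flatten, Function.comp_def, mul_comm]
  have h := getElem?_flatten_of_length 2 (List.ofFn fun i => [I.site i 0, I.site i 1])
    (by simp) i r r.2 (by simp)
  simp only [Instance.input, Instance.encode, List.getD_eq_getElem?_getD, List.append_assoc]
  rw [List.getElem?_append_left (by rw [hlen]; omega), h]
  fin_cases r <;> simp

theorem Instance.input_segment (I : Instance n k) (extra : List ℝ) (j : Fin k) (r : ℕ)
    (hr : r < 4) :
    (I.input extra).real (2 * n + (4 * j + r)) =
      [I.a j 0, I.a j 1, I.b j 0, I.b j 1].getD r 0 := by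
  have hlen : (List.ofFn fun i => [I.site i 0, I.site i 1]).flatten.length = 2 * n := by
    simp [List.length_flatten, Function.comp_def, mul_comm]
  have hlen' : (List.ofFn fun j => [I.a j 0, I.a j 1, I.b j 0, I.b j 1]).flatten.length =
      4 * k := by
    simp [List.length_flatten, Function.comp_def, mul_comm]
  have h := getElem?_flatten_of_length 4
    (List.ofFn fun j => [I.a j 0, I.a j 1, I.b j 0, I.b j 1]) (by simp) j r hr (by simp)
  simp only [Instance.input, Instance.encode, List.getD_eq_getElem?_getD, List.append_assoc]
  rw [List.getElem?_append_right (by rw [hlen]; omega), hlen, Nat.add_sub_cancel_left,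
    List.getElem?_append_left (by rw [hlen']; omega), h]
  simp

theorem Instance.input_extra (I : Instance n k) (δ : ℝ) :
    (I.input [δ]).real (2 * n + 4 * k) = δ := by
  have hlen : I.encode.length = 2 * n + 4 * k := by
    simp [Instance.encode, List.length_flatten, Function.comp_def, mul_comm]
  simp only [Instance.input, List.getD_eq_getElem?_getD]
  rw [List.getElem?_append_right (by omega), hlen]
  simp

/-- Six times an expression. -/
def sixTimes (e : NatExp) : NatExp := .add (.add (.add e e) (.add e e)) (.add e e)

/-- Compute the constants. -/
def setupProg : Prog :=
  .seq (assign 2 (.add (.add (.add (natCell 0) (natCell 0)) (.add (.add (natCell 1) (natCell 1))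
    (.add (natCell 1) (natCell 1)))) (.lit 1))) <|
  .seq (assign 3 (.add (natCell 0) (natCell 1)))
    (assign 4 (.sub (sixTimes (natCell 3)) (.lit 1)))

theorem haltsIn_setupProg (I : Instance n k) (extra : List ℝ) :
    HaltsIn setupProg (I.input extra) 3 fun s => I.Loaded s ∧ s.real = (I.input extra).real := by
  refine Prog.LoopFree.haltsIn (by exact ⟨trivial, trivial, trivial⟩) le_rfl ?_
  have h0 : (I.input extra).nat 0 = n := rfl
  have h1 : (I.input extra).nat 1 = k := rfl
  have hr : (setupProg.run (I.input extra)).real = (I.input extra).real := rfl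
  refine ⟨⟨?_, ?_, ?_, ?_, ?_, fun i => ?_, fun i => ?_, fun j => ?_, fun j => ?_, fun j => ?_,
    fun j => ?_⟩, hr⟩
  · simp [setupProg, Prog.run, NatExp.eval, Mem.setNat_nat, h0]
  · simp [setupProg, Prog.run, NatExp.eval, Mem.setNat_nat, h1]
  · simp [setupProg, Prog.run, NatExp.eval, Mem.setNat_nat, h0, h1]; omega
  · simp [setupProg, Prog.run, NatExp.eval, Mem.setNat_nat, h0, h1]
  · simp [setupProg, sixTimes, Prog.run, NatExp.eval, Mem.setNat_nat, h0, h1]; omega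
  · rw [hr]; exact I.input_site extra i 0
  · rw [hr]; exact I.input_site extra i 1
  · rw [hr]; exact I.input_segment extra j 0 (by omega)
  · rw [hr, show 2 * n + 1 + 4 * (j : ℕ) = 2 * n + (4 * j + 1) by omega]
    exact I.input_segment extra j 1 (by omega)
  · rw [hr, show 2 * n + 2 + 4 * (j : ℕ) = 2 * n + (4 * j + 2) by omega]
    exact I.input_segment extra j 2 (by omega)
  · rw [hr, show 2 * n + 3 + 4 * (j : ℕ) = 2 * n + (4 * j + 3) by omega]
    exact I.input_segment extra j 3 (by omega)

/-- Write the position of one segment. -/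
def outputBody : Prog :=
  .seq (.realSet (.add (.add (natCell 7) (natCell 7)) (.lit 1))
      (.cell (ptX (.add (natCell 0) (natCell 7)))))
    (.realSet (.add (.add (natCell 7) (natCell 7)) (.lit 2))
      (.cell (ptY (.add (natCell 0) (natCell 7)))))

/-- Write the radius and the positions. -/
def outputProg : Prog :=
  .seq (.seq (.realSet (.lit 0) (rv 0)) (assign 7 (.lit 0))) (forLoop 7 1 outputBody)

/-- The output occupies the real cells up to `2k`. It may overwrite coordinates of the instance, but
it ends below the work area from which the points are copied. -/
theorem haltsIn_outputProg {I : Instance n k} {s : Mem} (hk : 1 ≤ k) (h : I.Loaded s)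
    (hp : I.IsChoice (s.points n k)) :
    HaltsIn outputProg s (4 * k + 3) fun s' => s'.radius = s.real (s.nat 2) ∧
      I.choiceOf s' = s.points n k := by
  refine (HaltsIn.seq (B := 2) (B' := k * 4 + 1) (Prog.LoopFree.haltsIn
    (by exact ⟨trivial, trivial⟩) le_rfl ?_)).mono (by omega) fun _ h => h
  set s₀ := (Prog.seq (.realSet (.lit 0) (rv 0)) (assign 7 (.lit 0))).run s with hs₀
  have hn₀ : ∀ m, s₀.nat m = if m = 7 then 0 else s.nat m := fun m => by
    rw [hs₀]; simp only [Prog.run, NatExp.eval, Mem.setNat_nat, Mem.setReal_nat]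
  have hr₀ : ∀ m, s₀.real m = if m = 0 then s.real (s.nat 2) else s.real m := by
    intro m
    rw [hs₀]
    simp only [Prog.run, RealExp.eval, NatExp.eval, eval_var, Mem.setNat_real, Mem.setReal_real,
      add_zero]
  have h7 : s₀.nat 7 = 0 := by rw [hn₀, if_pos rfl]
  have hw := h.cell_base
  refine (HaltsIn.forLoop (i := 7) (b := 1) (body := outputBody) (B := 2) (hi := k)
    (fun i s' => (∀ m, m ≠ 7 → s'.nat m = s.nat m) ∧
      (∀ m, s.nat 2 ≤ m → s'.real m = s.real m) ∧
      s'.real 0 = s.real (s.nat 2) ∧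
      ∀ j < i, s'.real (2 * j + 1) = s.real (s.nat 2 + 32 + 2 * (n + j)) ∧
        s'.real (2 * j + 2) = s.real (s.nat 2 + 33 + 2 * (n + j))) ?_ ?_ ?_ ?_).mono ?_ ?_
  · rw [hn₀, if_neg (by omega), h.cell_k]
  · omega
  · rw [h7]
    exact ⟨fun m h1 => by rw [hn₀, if_neg h1], fun m hm => by rw [hr₀, if_neg (by omega)],
      by rw [hr₀, if_pos rfl], fun j hj => by omega⟩
  · rintro i s' hi h7' h1' ⟨hf, hr, hrad, hpt⟩
    refine Prog.LoopFree.haltsIn (by exact ⟨trivial, trivial⟩) le_rfl ?_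
    have h2 : s'.nat 2 = s.nat 2 := hf 2 (by omega)
    have h0' : s'.nat 0 = n := by rw [hf 0 (by omega), h.cell_n]
    have hreal : ∀ m, (outputBody.run s').real m = if m = 2 * i + 2 then
        s.real (s.nat 2 + 33 + 2 * (n + i)) else if m = 2 * i + 1 then
        s.real (s.nat 2 + 32 + 2 * (n + i)) else s'.real m := fun m => by
      simp only [outputBody, Prog.run, RealExp.eval, NatExp.eval, eval_ptX, eval_ptY,
        Mem.setReal_real, Mem.setReal_nat, h7', h2, h0']
      rw [if_neg (show s.nat 2 + 33 + 2 * (n + i) ≠ i + i + 1 by omega), hr _ (by omega),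
        hr _ (by omega), two_mul i]
    have hnat : (outputBody.run s').nat = s'.nat := rfl
    refine ⟨by rw [hnat, h7'], ?_, fun m h1 => ?_, fun m hm => ?_, ?_, fun j hj => ?_⟩
    · rw [Mem.setNat_nat, if_neg (by omega), hnat, h1']
    · rw [Mem.setNat_nat, if_neg h1, hnat, hf m h1]
    · rw [Mem.setNat_real, hreal, if_neg (by omega), if_neg (by omega), hr m hm]
    · rw [Mem.setNat_real, hreal, if_neg (by omega), if_neg (by omega), hrad]
    · rw [Mem.setNat_real, hreal, hreal]
      by_cases hji : j = i
      · subst hji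
        exact ⟨by rw [if_neg (by omega), if_pos rfl], by rw [if_pos rfl]⟩
      · rw [if_neg (by omega), if_neg (by omega), if_neg (by omega), if_neg (by omega)]
        exact hpt j (by omega)
  · rw [h7, Nat.sub_zero]
  · rintro s' ⟨-, -, hf, hr, hrad, hpt⟩
    refine ⟨hrad, funext ?_⟩
    rintro (i | j)
    · exact (hp (Sum.inl i)).symm
    · simp only [Instance.choiceOf, Sum.elim_inr, (hpt j j.2).1, (hpt j j.2).2]
      rfl

/-! ### The exact algorithm -/

/-- One run is chosen for every real `x`; the final memory is that of the run on `L`, so it inherits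
whatever is known about `R L`. -/
theorem HaltsIn.threshold {e : NatExp} {body : Prog} {b : Test} {s : Mem} {B : ℕ} (L : ℝ)
    (R : ℝ → Mem → Prop)
    (h : ∀ x, HaltsIn body (s.setReal (e.eval s) x) B fun s' => (b.Holds s' ↔ L ≤ x) ∧ R x s') :
    HaltsIn (.threshold e body b) s (B + 1) (R L) := by
  choose time res hexec htime hres using h
  exact ⟨_, _, .threshold L B time res hexec htime fun x => (hres x).1, le_rfl, (hres L).2⟩

/-- The algorithm with exact bisection. -/
def exactProg : Prog :=
  .seq setupProg <| .seq (.threshold (var 0) decideProg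
    (.and (.realLe (.lit 0) (rv 0)) (.natLe (.lit 1) (natCell 9)))) outputProg

theorem le_decideCost (hk : 1 ≤ k) : 160 * k ≤ decideCost n k := by
  have h1 : k ≤ k * (n + k) := Nat.le_mul_of_pos_right _ (by omega)
  have h2 : k * (n + k) ≤ k * (n + k) * (6 * (n + k)) ^ k :=
    Nat.le_mul_of_pos_right _ (Nat.pow_pos (by omega))
  rw [decideCost]
  omega

theorem haltsIn_exactProg {I : Instance n k} (hI : I.GeneralPosition) (hk : 1 ≤ k) :
    HaltsIn exactProg (I.input []) (2 * decideCost n k) I.SolvedBy := by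
  obtain ⟨α, hα⟩ := I.exists_isOptimalRadius hk
  have hcost := le_decideCost (n := n) hk
  refine HaltsIn.mono (HaltsIn.seq (B := 3) (B' := decideCost n k + 1 + (4 * k + 3))
    ((haltsIn_setupProg I []).mono le_rfl ?_)) (by omega) fun _ h => h
  rintro s ⟨hload, -⟩
  -- The acceptance threshold is the optimal radius. The run on it also leaves the points that
  -- attain it in memory.
  refine HaltsIn.seq ((HaltsIn.threshold α (fun x s' => I.Loaded s' ∧ s'.real (s'.nat 2) = x ∧
    (α ≤ x → I.IsChoice (s'.points n k) ∧
      (connectivityGraph (s'.points n k) x).Connected)) fun x => ?_).mono le_rfl ?_)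
  · rw [eval_var, add_zero]
    have hload' : I.Loaded (s.setReal (s.nat 2) x) := hload.congr (fun m _ => rfl) fun m hm => by
      rw [Mem.setReal_real, if_neg (by rw [hload.cell_base]; omega)]
    refine (haltsIn_decideProg hI hk hload' (α := x) ?_).mono le_rfl ?_
    · rw [Mem.setReal_real, Mem.setReal_nat, if_pos rfl]
    · rintro s' ⟨hl, -, hr, h9, hgood, hfeas⟩
      have hx : s'.real (s'.nat 2) = x := by
        rw [hl.cell_base, ← hload'.cell_base, hr _ (Or.inl le_rfl), Mem.setReal_real,
          Mem.setReal_nat, if_pos rfl]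
      have h1 : s'.nat 9 = 1 ↔ I.Feasible x := ⟨fun h => ⟨_, hgood h⟩, hfeas⟩
      refine ⟨?_, hl, hx, fun hle => hgood (h1.2 (hα.le_iff.1 hle).2)⟩
      rw [hα.le_iff, ← h1]
      simp only [Test.Holds, RealExp.eval, NatExp.eval, eval_var, add_zero, hx, Rat.cast_zero]
      refine and_congr_right fun _ => ?_
      omega
  · rintro s' ⟨hl, hx, hsol⟩
    obtain ⟨hch, hcon⟩ := hsol le_rfl
    refine (haltsIn_outputProg hk hl hch).mono le_rfl ?_
    rintro s'' ⟨hrad, hpos⟩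
    rw [hx] at hrad
    refine ⟨by rw [hrad]; exact hα, by rw [hpos]; exact hch, by rw [hpos, hrad]; exact hcon⟩

/-! ### The approximation algorithm -/

/-- The memory during the bisection: lower bound, step, and number of halvings to come. -/
structure Instance.Bisecting (I : Instance n k) (s : Mem) (lo step : ℝ) (c : ℕ) : Prop where
  loaded : I.Loaded s
  lower : s.real (s.nat 2 + 20) = lo
  width : s.real (s.nat 2 + 21) = step
  count : s.nat 14 = c

/-- Decide whether the sum of lower bound and step is feasible. -/
def probeProg : Prog := .seq (.realSet (var 0) (.add (rv 20) (rv 21))) decideProg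

theorem haltsIn_probeProg {I : Instance n k} (hI : I.GeneralPosition) {s : Mem} (hk : 1 ≤ k)
    {lo step : ℝ} {c : ℕ} (h : I.Bisecting s lo step c) :
    HaltsIn probeProg s (decideCost n k + 1) fun s' => I.Bisecting s' lo step c ∧
      s'.real (s'.nat 2) = lo + step ∧ s'.nat 9 ≤ 1 ∧ (s'.nat 9 = 1 ↔ I.Feasible (lo + step)) ∧
      (s'.nat 9 = 1 → I.IsChoice (s'.points n k) ∧
        (connectivityGraph (s'.points n k) (lo + step)).Connected) := by
  refine HaltsIn.mono (HaltsIn.seq (B := 1) (B' := decideCost n k) (Prog.LoopFree.haltsIn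
    (by trivial) le_rfl ?_)) (by omega) fun _ h => h
  have hw := h.loaded.cell_base
  set s₀ := (Prog.realSet (var 0) (.add (rv 20) (rv 21))).run s with hs₀
  have hr₀ : ∀ m, s₀.real m = if m = s.nat 2 then lo + step else s.real m := fun m => by
    rw [hs₀]
    simp only [Prog.run, RealExp.eval, eval_var, Mem.setReal_real, add_zero, h.lower, h.width]
  have hn₀ : s₀.nat = s.nat := rfl
  have hload₀ : I.Loaded s₀ := h.loaded.congr (fun m _ => rfl) fun m hm => by
    rw [hr₀, if_neg (by omega)]
  refine (haltsIn_decideProg hI hk hload₀ (α := lo + step)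
    (by rw [hr₀, hn₀, if_pos rfl])).mono le_rfl ?_
  rintro s' ⟨hl, hf, hr, h9, hgood, hfeas⟩
  rw [hn₀] at hr
  have h2 : s'.nat 2 = s.nat 2 := by rw [hl.cell_base, hw]
  refine ⟨⟨hl, ?_, ?_, ?_⟩, ?_, h9, ⟨fun h => ⟨_, hgood h⟩, hfeas⟩, hgood⟩
  · rw [h2, hr _ (by omega), hr₀, if_neg (by omega), h.lower]
  · rw [h2, hr _ (by omega), hr₀, if_neg (by omega), h.width]
  · rw [hf 14 (by omega) (by omega), hn₀, h.count]
  · rw [h2, hr _ (by omega), hr₀, if_pos rfl]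

/-- Double the step until it is feasible. -/
def doublingProg : Prog :=
  .loop (.natLe (natCell 9) (.lit 0))
    (.seq (.seq (.realSet (var 21) (.add (rv 21) (rv 21)))
      (assign 14 (.add (natCell 14) (.lit 1)))) probeProg)

/-- Reals cannot be rounded on this machine, so the number of doublings is counted and not computed;
`r` enters only as a bound for it. -/
theorem haltsIn_doublingProg {I : Instance n k} (hI : I.GeneralPosition) {s : Mem} (hk : 1 ≤ k)
    {δ : ℝ} (h : I.Bisecting s 0 δ 0) (h9 : s.nat 9 ≤ 1) (hs : s.nat 9 = 1 ↔ I.Feasible δ) {r : ℕ}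
    (hr : I.Feasible (2 ^ r * δ)) :
    HaltsIn doublingProg s (r * (decideCost n k + 4) + 1) fun s' =>
      ∃ c ≤ r, I.Bisecting s' 0 (2 ^ c * δ) c ∧ I.Feasible (2 ^ c * δ) := by
  refine (HaltsIn.loop (B := decideCost n k + 3) (fun m s' => ∃ c, c + m = r ∧
    I.Bisecting s' 0 (2 ^ c * δ) c ∧ s'.nat 9 ≤ 1 ∧ (s'.nat 9 = 1 ↔ I.Feasible (2 ^ c * δ)))
    ?_ r s ?_).mono le_rfl ?_
  · rintro m s' ⟨c, hc, hb, h9', hs'⟩ ht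
    simp only [Test.Holds, NatExp.eval] at ht
    have hm : m ≠ 0 := by
      rintro rfl
      rw [add_zero] at hc
      subst hc
      have := hs'.2 hr
      omega
    refine ⟨m - 1, by omega, HaltsIn.mono (HaltsIn.seq (B := 2) (B' := decideCost n k + 1)
      (Prog.LoopFree.haltsIn (by exact ⟨trivial, trivial⟩) le_rfl ?_)) (by omega) fun _ h => h⟩
    set s₀ := (Prog.seq (.realSet (var 21) (.add (rv 21) (rv 21)))
      (assign 14 (.add (natCell 14) (.lit 1)))).run s' with hs₀
    have hr₀ : ∀ m, s₀.real m = if m = s'.nat 2 + 21 then 2 ^ (c + 1) * δ else s'.real m := by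
      intro m
      rw [hs₀, pow_succ, mul_assoc, mul_left_comm, two_mul]
      simp only [Prog.run, RealExp.eval, eval_var, Mem.setReal_real, Mem.setNat_real, hb.width]
    have hn₀ : ∀ m, s₀.nat m = if m = 14 then c + 1 else s'.nat m := fun m => by
      rw [hs₀]
      simp only [Prog.run, NatExp.eval, Mem.setNat_nat, Mem.setReal_nat, hb.count]
    have h2 : s₀.nat 2 = s'.nat 2 := by rw [hn₀, if_neg (by omega)]
    have hw := hb.loaded.cell_base
    have hb₀ : I.Bisecting s₀ 0 (2 ^ (c + 1) * δ) (c + 1) :=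
      ⟨hb.loaded.congr (fun m hm => by rw [hn₀, if_neg (by omega)])
        fun m hm => by rw [hr₀, if_neg (by omega)],
        by rw [h2, hr₀, if_neg (by omega), hb.lower], by rw [h2, hr₀, if_pos rfl],
        by rw [hn₀, if_pos rfl]⟩
    refine (haltsIn_probeProg hI hk hb₀).mono le_rfl ?_
    rintro s'' ⟨hb', -, h9'', hs'', -⟩
    rw [zero_add] at hs''
    exact ⟨c + 1, by omega, hb', h9'', hs''⟩
  · exact ⟨0, by omega, by simpa using h, h9, by simpa using hs⟩
  · rintro s' ⟨hex, m, c, hc, hb, h9', hs'⟩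
    simp only [Test.Holds, NatExp.eval] at hex
    exact ⟨c, by omega, hb, hs'.1 (by omega)⟩

/-- Halve the step as often as it has been doubled. -/
def halvingProg : Prog :=
  .loop (.natLe (.lit 1) (natCell 14))
    (.seq (.seq (.realSet (var 21) (.div (rv 21) (.lit 2)))
      (assign 14 (.sub (natCell 14) (.lit 1)))) (.seq probeProg
      (.ite (.natLe (natCell 9) (.lit 0)) (.realSet (var 20) (.add (rv 20) (rv 21))) .skip)))

/-- Bisection with invariant: `lo` is at most the optimum and `lo` plus step is feasible. Halving as
often as the step was doubled returns it to exactly `δ`. -/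
theorem haltsIn_halvingProg {I : Instance n k} (hI : I.GeneralPosition) (hk : 1 ≤ k) {α δ : ℝ}
    (hα : I.IsOptimalRadius α) (hδ : 0 < δ) {s : Mem} {c : ℕ}
    (h : I.Bisecting s 0 (2 ^ c * δ) c) (hc : I.Feasible (2 ^ c * δ)) :
    HaltsIn halvingProg s (c * (decideCost n k + 6) + 1) fun s' =>
      ∃ lo, 0 ≤ lo ∧ lo ≤ α ∧ I.Bisecting s' lo δ 0 ∧ I.Feasible (lo + δ) := by
  refine (HaltsIn.loop (B := decideCost n k + 5) (fun m s' => ∃ lo, 0 ≤ lo ∧ lo ≤ α ∧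
    I.Bisecting s' lo (2 ^ m * δ) m ∧ I.Feasible (lo + 2 ^ m * δ)) ?_ c s ?_).mono le_rfl ?_
  · rintro m s' ⟨lo, hlo, hloα, hb, hf⟩ ht
    simp only [Test.Holds, NatExp.eval, hb.count] at ht
    obtain ⟨m, rfl⟩ : ∃ m', m = m' + 1 := ⟨m - 1, by omega⟩
    have hpow : (2 : ℝ) ^ (m + 1) * δ = 2 ^ m * δ + 2 ^ m * δ := by ring
    have hstep : 0 ≤ (2 : ℝ) ^ m * δ := by positivity
    refine ⟨m, rfl, HaltsIn.mono (HaltsIn.seq (B := 2) (B' := (decideCost n k + 1) + 2)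
      (Prog.LoopFree.haltsIn (by exact ⟨trivial, trivial⟩) le_rfl ?_)) (by omega) fun _ h => h⟩
    set s₀ := (Prog.seq (.realSet (var 21) (.div (rv 21) (.lit 2)))
      (assign 14 (.sub (natCell 14) (.lit 1)))).run s' with hs₀
    have hr₀ : ∀ m', s₀.real m' = if m' = s'.nat 2 + 21 then 2 ^ m * δ else s'.real m' := by
      intro m'
      have : (2 : ℝ) ^ m * δ = 2 ^ (m + 1) * δ / ((2 : ℚ) : ℝ) := by push_cast; ring
      rw [hs₀, this]
      simp only [Prog.run, RealExp.eval, eval_var, Mem.setReal_real, Mem.setNat_real, hb.width]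
    have hn₀ : ∀ m', s₀.nat m' = if m' = 14 then m else s'.nat m' := fun m' => by
      rw [hs₀]
      simp only [Prog.run, NatExp.eval, Mem.setNat_nat, Mem.setReal_nat, hb.count,
        Nat.add_sub_cancel]
    have h2 : s₀.nat 2 = s'.nat 2 := by rw [hn₀, if_neg (by omega)]
    have hw := hb.loaded.cell_base
    have hb₀ : I.Bisecting s₀ lo (2 ^ m * δ) m :=
      ⟨hb.loaded.congr (fun m hm => by rw [hn₀, if_neg (by omega)])
        fun m hm => by rw [hr₀, if_neg (by omega)],
        by rw [h2, hr₀, if_neg (by omega), hb.lower], by rw [h2, hr₀, if_pos rfl],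
        by rw [hn₀, if_pos rfl]⟩
    refine HaltsIn.seq ((haltsIn_probeProg hI hk hb₀).mono le_rfl ?_)
    rintro s₁ ⟨hb₁, -, h9, hs₁, -⟩
    refine HaltsIn.ite (fun hz => ?_) (fun hz => ?_) <;>
      refine Prog.LoopFree.haltsIn (by trivial) le_rfl ?_ <;>
      simp only [Test.Holds, NatExp.eval] at hz
    · set s₂ := (Prog.realSet (var 20) (.add (rv 20) (rv 21))).run s₁ with hs₂
      have hr₂ : ∀ m', s₂.real m' =
          if m' = s₁.nat 2 + 20 then lo + 2 ^ m * δ else s₁.real m' := fun m' => by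
        rw [hs₂]
        simp only [Prog.run, RealExp.eval, eval_var, Mem.setReal_real, hb₁.lower, hb₁.width]
      have hn₂ : s₂.nat = s₁.nat := rfl
      have hw₁ := hb₁.loaded.cell_base
      have hnot : ¬ I.Feasible (lo + 2 ^ m * δ) := fun hfe => by have := hs₁.2 hfe; omega
      refine ⟨lo + 2 ^ m * δ, by positivity, ?_, ⟨?_, ?_, ?_, ?_⟩, ?_⟩
      · by_contra! hlt
        exact hnot (hα.le_iff.1 hlt.le).2
      · exact hb₁.loaded.congr (fun m _ => rfl) fun m hm => by rw [hr₂, if_neg (by omega)]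
      · rw [hn₂, hr₂, if_pos rfl]
      · rw [hn₂, hr₂, if_neg (by omega), hb₁.width]
      · rw [hn₂, hb₁.count]
      · rwa [add_assoc, ← hpow]
    · exact ⟨lo, hlo, hloα, hb₁, hs₁.1 (by omega)⟩
  · exact ⟨0, le_rfl, hα.1.1, h, by rwa [zero_add]⟩
  · rintro s' ⟨hex, m, lo, hlo, hloα, hb, hf⟩
    simp only [Test.Holds, NatExp.eval, hb.count] at hex
    obtain rfl : m = 0 := by omega
    rw [pow_zero, one_mul] at hb hf
    exact ⟨lo, hlo, hloα, hb, hf⟩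

/-- The algorithm without exact bisection. -/
def approxProg : Prog :=
  .seq setupProg <| .seq (.seq (.realSet (var 20) (.lit 0)) (.seq
    (.realSet (var 21) (.cell (.sub (natCell 2) (.lit 1)))) (assign 14 (.lit 0)))) <|
  .seq probeProg <| .seq doublingProg <| .seq halvingProg <| .seq probeProg outputProg

theorem approxProg_plain : approxProg.Plain := by
  simp only [approxProg, setupProg, probeProg, decideProg, prepareProg, copyProg, copyBody,
    restoreProg, insertProg, markBody, relabelBody, fillProg, searchProg, guessProg, sweepProg,
    roundProg, evalProg, decodeProg, paramProg, moveProg, verifyProg, nextProg, carryBody,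
    doublingProg, halvingProg, outputProg, outputBody, forLoop, Prog.Plain, and_self]

theorem haltsIn_approxProg {I : Instance n k} (hI : I.GeneralPosition) (hk : 1 ≤ k) {δ : ℝ}
    (hδ : 0 < δ) {r : ℕ} (hr : I.Feasible (2 ^ r * δ)) :
    HaltsIn approxProg (I.input [δ]) (20 * ((r + 1) * decideCost n k)) (I.SolvedUpTo δ) := by
  obtain ⟨α, hα⟩ := I.exists_isOptimalRadius hk
  have hcost : 3 + (3 + ((decideCost n k + 1) + ((r * (decideCost n k + 4) + 1) +
      ((r * (decideCost n k + 6) + 1) + ((decideCost n k + 1) + (4 * k + 3)))))) ≤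
      20 * ((r + 1) * decideCost n k) := by
    have h0 := le_decideCost (n := n) hk
    have h1 : r * (decideCost n k + 4) ≤ r * (2 * decideCost n k) :=
      Nat.mul_le_mul_left _ (by omega)
    have h2 : r * (decideCost n k + 6) ≤ r * (2 * decideCost n k) :=
      Nat.mul_le_mul_left _ (by omega)
    have h3 : r * (2 * decideCost n k) = 2 * (r * decideCost n k) := by ring
    rw [add_mul]
    omega
  refine HaltsIn.mono (HaltsIn.seq ((haltsIn_setupProg I [δ]).mono le_rfl ?_)) hcost fun _ h => h
  rintro s ⟨hload, hreal⟩
  have hw := hload.cell_base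
  refine HaltsIn.seq (Prog.LoopFree.haltsIn (by exact ⟨trivial, trivial, trivial⟩) le_rfl ?_)
  set s₀ := (Prog.seq (.realSet (var 20) (.lit 0)) (.seq
    (.realSet (var 21) (.cell (.sub (natCell 2) (.lit 1)))) (assign 14 (.lit 0)))).run s with hs₀
  have hn₀ : ∀ m, s₀.nat m = if m = 14 then 0 else s.nat m := fun m => by
    rw [hs₀]; simp only [Prog.run, NatExp.eval, Mem.setNat_nat, Mem.setReal_nat]
  have hin : s.real (s.nat 2 - 1) = δ := by
    rw [hreal, hw, Nat.add_sub_cancel]; exact I.input_extra δ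
  have hr₀ : ∀ m, s₀.real m = if m = s.nat 2 + 21 then δ else if m = s.nat 2 + 20 then 0
      else s.real m := fun m => by
    rw [hs₀]
    simp only [Prog.run, RealExp.eval, NatExp.eval, eval_var, Mem.setReal_real, Mem.setNat_real,
      Mem.setReal_nat, Rat.cast_zero]
    rw [if_neg (show s.nat 2 - 1 ≠ s.nat 2 + 20 by omega), hin]
  have h2 : s₀.nat 2 = s.nat 2 := by rw [hn₀, if_neg (by omega)]
  have hb₀ : I.Bisecting s₀ 0 δ 0 :=
    ⟨hload.congr (fun m hm => by rw [hn₀, if_neg (by omega)])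
      fun m hm => by rw [hr₀, if_neg (by omega), if_neg (by omega)],
      by rw [h2, hr₀, if_neg (by omega), if_pos rfl], by rw [h2, hr₀, if_pos rfl],
      by rw [hn₀, if_pos rfl]⟩
  refine HaltsIn.seq ((haltsIn_probeProg hI hk hb₀).mono le_rfl ?_)
  rintro s₁ ⟨hb₁, -, h9₁, hf₁, -⟩
  rw [zero_add] at hf₁
  refine HaltsIn.seq ((haltsIn_doublingProg hI hk hb₁ h9₁ hf₁ hr).mono le_rfl ?_)
  rintro s₂ ⟨c, hc, hb₂, hf₂⟩
  refine HaltsIn.seq ((haltsIn_halvingProg hI hk hα hδ hb₂ hf₂).mono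
    (Nat.add_le_add_right (Nat.mul_le_mul_right _ hc) 1) ?_)
  rintro s₃ ⟨lo, hlo, hloα, hb₃, hf₃⟩
  -- The last radius tested may have been infeasible, so the points for `lo + δ` have to be
  -- recomputed.
  refine HaltsIn.seq ((haltsIn_probeProg hI hk hb₃).mono le_rfl ?_)
  rintro s₄ ⟨hb₄, hx, -, hf₄, hgood⟩
  obtain ⟨hch, hcon⟩ := hgood (hf₄.2 hf₃)
  refine (haltsIn_outputProg hk hb₄.loaded hch).mono le_rfl ?_
  rintro s₅ ⟨hrad, hpos⟩
  rw [hx] at hrad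
  refine ⟨⟨α, hα, ?_, ?_⟩, by rw [hpos]; exact hch, by rw [hpos, hrad]; exact hcon⟩
  · rw [hrad]; exact hα.le_iff.2 ⟨by linarith, hf₃⟩
  · rw [hrad]; linarith

/-! ### Running times -/

/-- The decision takes `O(k(n+k))` per guess, and `(n+k)^(k+1) ≤ (n+k)^(2k)` absorbs the factor `n +
k`. For `k = 1` this is an equality, so a test quadratic in `n + k` for every guess would be too
slow. The constant is `160 * 36`. -/
theorem decideCost_le (hk : 1 ≤ k) : (decideCost n k : ℝ) ≤ 5760 * timeBound n k := by
  have h6 : 6 ^ k ≤ 36 * (k ! * k ^ 2) ^ k := by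
    rcases (show k = 1 ∨ k = 2 ∨ 3 ≤ k by omega) with rfl | rfl | hk3
    · norm_num
    · norm_num
    · have h1 : 6 ≤ k ! * k ^ 2 :=
        (show 6 ≤ k ^ 2 by nlinarith).trans (Nat.le_mul_of_pos_left _ (Nat.factorial_pos k))
      have := Nat.pow_le_pow_left h1 k
      omega
  have hN : (n + k) * (n + k) ^ k ≤ ((n + k) ^ 2) ^ k := by
    rw [← pow_succ', ← pow_mul]
    exact Nat.pow_le_pow_right (by omega) (by omega)
  have key : decideCost n k ≤ 5760 * (((n + k) ^ 2 * k ! * k ^ 2) ^ k * k) := by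
    calc decideCost n k = 160 * k * (6 ^ k * ((n + k) * (n + k) ^ k)) := by
          rw [decideCost, mul_pow]; ring
      _ ≤ 160 * k * ((36 * (k ! * k ^ 2) ^ k) * ((n + k) ^ 2) ^ k) := by gcongr
      _ = 5760 * (((n + k) ^ 2 * (k ! * k ^ 2)) ^ k * k) := by
          rw [mul_pow ((n + k) ^ 2) (k ! * k ^ 2) k]; ring
      _ = 5760 * (((n + k) ^ 2 * k ! * k ^ 2) ^ k * k) := by rw [mul_assoc ((n + k) ^ 2)]
  rw [timeBound]
  exact_mod_cast key

theorem HaltsIn.haltsWithin {c : Prog} {s : Mem} {B : ℕ} {Q : Mem → Prop} (h : HaltsIn c s B Q)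
    {b : ℝ} (hb : (B : ℝ) ≤ b) : HaltsWithin c s b Q := by
  obtain ⟨t, s', he, ht, hq⟩ := h
  exact ⟨t, s', he, le_trans (by exact_mod_cast ht) hb, hq⟩

theorem haltsWithin_exactProg {I : Instance n k} (hI : I.GeneralPosition) (hk : 1 ≤ k) :
    HaltsWithin exactProg (I.input []) (11520 * timeBound n k) I.SolvedBy := by
  refine (haltsIn_exactProg hI hk).haltsWithin ?_
  push_cast
  linarith [decideCost_le (n := n) hk]

theorem timeBound_eq_eval (n k : ℕ) : timeBound n k =
    (((Polynomial.X + Polynomial.C (k : ℝ)) ^ 2 * Polynomial.C (k ! : ℝ) *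
      Polynomial.C (k : ℝ) ^ 2) ^ k * Polynomial.C (k : ℝ)).eval (n : ℝ) := by
  simp [timeBound]

theorem haltsWithin_approxProg {I : Instance n k} (hI : I.GeneralPosition) (hk : 1 ≤ k) {δ : ℝ}
    (hδ : 0 < δ) :
    HaltsWithin approxProg (I.input [δ])
      (230400 * timeBound n k * (1 + Real.logb 2 (1 + I.diameter / δ))) (I.SolvedUpTo δ) := by
  have hD : 0 ≤ I.diameter := Metric.diam_nonneg
  have hq : 0 ≤ I.diameter / δ := by positivity
  set l := Real.logb 2 (1 + I.diameter / δ) with hl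
  have hl0 : 0 ≤ l := Real.logb_nonneg (by norm_num) (by linarith)
  have hpow : 1 + I.diameter / δ ≤ 2 ^ ⌈l⌉₊ := by
    rw [← Real.rpow_logb (b := 2) (x := 1 + I.diameter / δ) (by norm_num) (by norm_num)
      (by linarith), ← Real.rpow_natCast]
    exact Real.rpow_le_rpow_of_exponent_le (by norm_num) (Nat.le_ceil l)
  -- The choice of the exponent gives `2 ^ r * δ ≥ δ + D ≥ D`, and the diameter `D` is feasible.
  have hfeas : I.Feasible (2 ^ ⌈l⌉₊ * δ) := by
    refine (I.feasible_diameter hk).mono ?_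
    have := (div_le_iff₀ hδ).1 (show I.diameter / δ ≤ 2 ^ ⌈l⌉₊ by linarith)
    exact this
  refine (haltsIn_approxProg hI hk hδ hfeas).haltsWithin ?_
  -- Rounding up costs less than one, which explains the factor `2` in `230400 = 20 * 2 * 5760`.
  have hceil : (⌈l⌉₊ : ℝ) + 1 ≤ 2 * (1 + l) := by
    have := Nat.ceil_lt_add_one hl0
    linarith
  have hcost := decideCost_le (n := n) hk
  have h0 : (0 : ℝ) ≤ decideCost n k := Nat.cast_nonneg _
  push_cast
  have := mul_le_mul hceil hcost h0 (by linarith)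
  linarith

end

end BCU

/-! ### The main theorem. -/

theorem mainTheorem4 :
    -- the exact algorithm
    (∃ P : BCU.Prog,
      (∃ C : ℝ, ∀ (n k : ℕ), 1 ≤ k → ∀ I : BCU.Instance n k, I.GeneralPosition →
        BCU.HaltsWithin P (I.input []) (C * BCU.timeBound n k) I.SolvedBy) ∧
      (∀ k : ℕ, 1 ≤ k → ∃ f : Polynomial ℝ, ∀ (n : ℕ) (I : BCU.Instance n k), I.GeneralPosition →
        BCU.HaltsWithin P (I.input []) (f.eval (n : ℝ)) I.SolvedBy)) ∧
    -- the same up to a given precision, with the rounds of the bisection counted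
    (∃ P : BCU.Prog, P.Plain ∧
      ∃ C : ℝ, ∀ (n k : ℕ), 1 ≤ k → ∀ I : BCU.Instance n k, I.GeneralPosition →
        ∀ δ : ℝ, 0 < δ →
          BCU.HaltsWithin P (I.input [δ])
            (C * BCU.timeBound n k * (1 + Real.logb 2 (1 + I.diameter / δ))) (I.SolvedUpTo δ)) ∧
    -- a supporting sequence determines the critical path, and this choice is part of an optimal
    -- solution
    (∀ (n k : ℕ) (I : BCU.Instance n k), I.GeneralPosition →
      ∀ (p : BCU.Elt n k → BCU.Plane) (T : SimpleGraph (BCU.Elt n k)),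
        I.IsMinimumSolutionTree p T →
        ∀ (r : ℕ) (E : Fin (r + 2) → BCU.Elt n k), I.Supports p T E →
          (∃! x, I.IsCriticalPath E x) ∧
          (∀ x, I.IsCriticalPath E x →
            ∃ q T', I.IsMinimumSolutionTree q T' ∧ I.IsOptimalChoice q ∧
              ∀ i, q (E i) = x i)) := by
  refine ⟨⟨BCU.exactProg, ⟨11520, fun n k hk I hI => BCU.haltsWithin_exactProg hI hk⟩,
    fun k hk => ⟨Polynomial.C 11520 *
      (((Polynomial.X + Polynomial.C (k : ℝ)) ^ 2 * Polynomial.C (k ! : ℝ) *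
        Polynomial.C (k : ℝ) ^ 2) ^ k * Polynomial.C (k : ℝ)), fun n I hI => ?_⟩⟩,
    ⟨BCU.approxProg, BCU.approxProg_plain, 230400, fun n k hk I hI δ hδ =>
      BCU.haltsWithin_approxProg hI hk hδ⟩,
    fun n k I hI p T hT r E hE => BCU.supports_unique_and_optimal I hI p T hT r E hE⟩
  rw [Polynomial.eval_mul, Polynomial.eval_C, ← BCU.timeBound_eq_eval n k]
  exact BCU.haltsWithin_exactProg hI hk
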